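/- Let $f=\frac{dw_1}{d\omega_1}\ge 0$ be a measurable single-photon spectrum on $(0,\infty)$ (an upper cutoff $E$ is allowed: then $f=0$ beyond $E$). For $U\in(0,\infty]$, a function $g$ on $(0,\infty)$ and $W_0=1-\int_0^\infty g\,d\omega$, put $Z_U(s)=\int_0^U g(\omega)e^{-s\omega}d\omega+W_0$. Call a real $c_0$ *admissible for $U$* if $\int_0^U g(\omega)e^{-c_0\omega}d\omega$ converges absolutely and $Z_U$ has no zeros in $\operatorname{Re}s>c_0$ (all singularities of $\ln Z_U$ lie to the left of every contour $\operatorname{Re}s=c>c_0$). In this half-plane $\ln Z_U$ denotes the holomorphic branch that is real on the real axis. **(A) Infrared-finite case.** Let $w_1=\int_0^\infty f\,d\omega<\infty$ and let $$g(\omega)=\frac{dw}{d\omega}=e^{-w_1}\sum_{n\ge1}\frac1{n!}\,f^{*n}(\omega)$$ be the multiphoton spectrum, where $f^{*n}$ is the $n$-fold self-convolution. Then $W_0=e^{-w_1}$; $c_0=0$ is admissible for $U=\infty$, and for every $U\in(0,\infty]$ some $c_0$ is admissible. For every $U\in(0,\infty]$, every $c_0$ admissible for $U$ and every $c>c_0$,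 the branch of $\ln Z_U$ exists, and: 1. as distributions on $(-\infty,U)$, with $f$ extended by $0$ to $(-\infty,0]$, $$f(\omega_1)=\frac{1}{2\pi i}\int_{c-i\infty}^{c+i\infty}ds\,e^{s\omega_1}\ln\Big(\int_0^{U}d\omega\,g(\omega)e^{-s\omega}+W_0\Big)-\ln W_0\,\delta(\omega_1),$$ where $\int_{c-i\infty}^{c+i\infty}$ is the limit of $\int_{c-iT}^{c+iT}$ as $T\to\infty$ in the sense of distributions; 2. pointwise, for every $\omega_1$ with $0<\omega_1<U$ at which $f$ satisfies Dini's condition ($u\mapsto (f(\omega_1+u)-f(\omega_1))/u$ is integrable near $0$), $$f(\omega_1)=\lim_{T\to\infty}\frac{1}{2\pi i}\int_{c-iT}^{c+iT}ds\,e^{s\omega_1}\Big[\ln\Big(\int_0^{U}d\omega\,g(\omega)e^{-s\omega}+W_0\Big)-\ln W_0\Big].$$ Thus $U=\infty$ gives the reconstruction formula, and the upper limit may be lowered to any $U>\omega_1$, i.e. to $\omega_1+0$. 3. For almost every $\omega_1>0$, for every $U\in(\omega_1,\infty]$, $$f(\omega_1)=\sum_{n=1}^\infty\frac{(-1)^{n-1}}{n\,W_0^n}\int_0^{U}d\Omega_1\,g(\Omega_1)\cdots\int_0^{U}d\Omega_n\,g(\Omega_n)\,\delta\Big(\omega_1-\sum_{k=1}^n\Omega_k\Big),$$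 with absolute convergence; the multiple integral is the $n$-fold self-convolution of $g\,1_{(0,U)}$ at $\omega_1$. **(B) Infrared-divergent case.** Let $\int_0^\infty\min(1,\omega)f(\omega)\,d\omega<\infty$ but $\int_0^\infty f\,d\omega=\infty$. For $\varepsilon>0$ let $w_1^{\varepsilon}$ and $g_\varepsilon$ be the emission probability and multiphoton spectrum of $f1_{(\varepsilon,\infty)}$ as in (A). Let $g\ge0$ be an integrable function on $(0,\infty)$ that is the multiphoton spectrum of $f$, in the sense that $e^{-w_1^{\varepsilon}}\delta(\omega)+g_\varepsilon(\omega)$ converges weakly to $g(\omega)\,d\omega$ as $\varepsilon\to0+$. Then $W_0=0$; $c_0=0$ is admissible for $U=\infty$; and for every $U\in(0,\infty]$, every $c_0$ admissible for $U$ and every $c>c_0$, the branch of $\ln Z_U$ exists and, as distributions on $(0,U)$, $$f(\omega_1)=\frac{1}{2\pi i}\int_{c-i\infty}^{c+i\infty}ds\,e^{s\omega_1}\ln\int_0^{U}d\omega\,g(\omega)e^{-s\omega}.$$ -/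

import Mathlib

open Set Filter Topology MeasureTheory
open scoped BoundedContinuousFunction

noncomputable section

namespace PhotonReconstruction

/-- The energies `0 < ω < U`; the value `U = ⊤` gives the half-line `(0, ∞)`. -/
def window (U : EReal) : Set ℝ := {ω : ℝ | 0 < ω ∧ (ω : EReal) < U}

/-- A spectral density restricted to the energies `0 < ω < U`. -/
def cut (h : ℝ → ℝ) (U : EReal) : ℝ → ℝ := (window U).indicator h

/-- `selfConv h n` is the `(n+1)`-fold self-convolution of `h`, that is
`∫ dΩ₀ h(Ω₀) ⋯ ∫ dΩₙ h(Ωₙ) δ(ω - Ω₀ - ⋯ - Ωₙ)`. -/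
def selfConv (h : ℝ → ℝ) : ℕ → ℝ → ℝ
  | 0 => h
  | n + 1 => MeasureTheory.convolution h (selfConv h n) (ContinuousLinearMap.mul ℝ ℝ) volume

/-- The total single-photon emission probability `w₁ = ∫₀^∞ f`. -/
def photonNumber (f : ℝ → ℝ) : ℝ := ∫ ω in Ioi (0 : ℝ), f ω

/-- The multiphoton spectrum generated by independent (Poisson) emission with single-photon
spectrum `f`: the sum over `m ≥ 1` photons of `e^{-w₁} / m!` times the `m`-fold
self-convolution of `f`. -/
def multiphotonSpectrum (f : ℝ → ℝ) (ω : ℝ) : ℝ :=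
  Real.exp (-photonNumber f) *
    ∑' n : ℕ, (1 / ((n + 1).factorial : ℝ)) * selfConv (cut f ⊤) n ω

/-- A single-photon spectrum: a nonnegative measurable density on `(0, ∞)`. -/
structure IsSpectrum (f : ℝ → ℝ) : Prop where
  measurable : Measurable f
  nonneg : ∀ ω : ℝ, 0 < ω → 0 ≤ f ω

/-- The spectrum with the soft photons `ω ≤ ε` removed. -/
def infraredCut (f : ℝ → ℝ) (ε : ℝ) : ℝ → ℝ := (Ioi ε).indicator f

/-- `g` is the multiphoton spectrum of the infrared-divergent single-photon spectrum `f`: the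
distribution of the total emitted energy (an atom `e^{-w₁}` at zero plus the multiphoton
density) belonging to the infrared-regularised spectrum converges weakly to `g(ω) dω` when the
infrared cutoff is removed. -/
structure IsInfraredLimit (f g : ℝ → ℝ) : Prop where
  nonneg : ∀ ω : ℝ, 0 < ω → 0 ≤ g ω
  integrable : IntegrableOn g (Ioi 0)
  tendsto : ∀ φ : ℝ →ᵇ ℝ,
    Tendsto
      (fun ε : ℝ => Real.exp (-photonNumber (infraredCut f ε)) * φ 0
        + ∫ ω in Ioi (0 : ℝ), φ ω * multiphotonSpectrum (infraredCut f ε) ω)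
      (𝓝[>] 0) (𝓝 (∫ ω in Ioi (0 : ℝ), φ ω * g ω))

/-- The non-emission probability read off from the multiphoton spectrum, `W₀ = 1 - ∫₀^∞ g`. -/
def nonEmission (g : ℝ → ℝ) : ℝ := 1 - ∫ ω in Ioi (0 : ℝ), g ω

/-- The argument of the logarithm, `∫₀^U g(ω) e^{-sω} dω + W₀`. -/
def logArg (g : ℝ → ℝ) (U : EReal) (s : ℂ) : ℂ :=
  (∫ ω in window U, (g ω : ℂ) * Complex.exp (-s * (ω : ℂ))) + (nonEmission g : ℂ)

/-- All singularities of `ln (∫₀^U g(ω) e^{-sω} dω + W₀)` have real part at most `c₀`: the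
Laplace integral converges absolutely for `Re s ≥ c₀`, and the argument of the logarithm has
no zero with `Re s > c₀`. -/
structure SingularitiesLeftOf (g : ℝ → ℝ) (U : EReal) (c₀ : ℝ) : Prop where
  integrable : IntegrableOn (fun ω : ℝ => g ω * Real.exp (-c₀ * ω)) (window U)
  ne_zero : ∀ s : ℂ, c₀ < s.re → logArg g U s ≠ 0

/-- `L` is the branch of `ln Z` that is holomorphic in the half-plane `Re s > c₀` and real on
the real axis. -/
structure IsLogBranch (Z : ℂ → ℂ) (c₀ : ℝ) (L : ℂ → ℂ) : Prop where
  differentiableOn : DifferentiableOn ℂ L {s : ℂ | c₀ < s.re}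
  exp_eq : ∀ s : ℂ, c₀ < s.re → Complex.exp (L s) = Z s
  im_eq_zero : ∀ x : ℝ, c₀ < x → (L (x : ℂ)).im = 0

/-- The truncated contour integral `(1 / 2πi) ∫_{c-iT}^{c+iT} e^{sω} L(s) ds`, along
`s = c + it`, `ds = i dt`. -/
def contourIntegral (L : ℂ → ℂ) (c T ω : ℝ) : ℂ :=
  (2 * (Real.pi : ℂ) * Complex.I)⁻¹ *
    ∫ t in (-T)..T,
      Complex.exp (((c : ℂ) + (t : ℂ) * Complex.I) * (ω : ℂ))
        * L ((c : ℂ) + (t : ℂ) * Complex.I) * Complex.I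

/-- Dini's condition at `x`, satisfied for instance wherever `f` is differentiable or Hölder
continuous. -/
def DiniAt (f : ℝ → ℝ) (x : ℝ) : Prop :=
  ∃ δ : ℝ, 0 < δ ∧ IntegrableOn (fun u : ℝ => (f (x + u) - f x) / u) (Ioo (-δ) δ)

end PhotonReconstruction

end

open PhotonReconstruction

/-! Independent emission makes the total energy a compound Poisson variable, so its Laplace
transform, atom included, is exp E(s) with E(s) = ∫ f(ω)(e^{-sω} - 1) dω (`levyExponent`). In the
finite case the transform turns self-convolutions into powers and the exponential series sums up. In
the divergent case the identity passes to the limit ε → 0, and W₀ = 0 because total mass 1 survives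
in the limit. `IsLevyPair` records what both cases share, and the distributional formula is proved
once from it.

For U = ∞ the logarithm is E itself, and Fourier inversion of E against a test function φ gives ∫
f(ω)(φ(ω) - φ(0)) dω: the density f and, when f is integrable, an atom -w₁ at 0, which is ln W₀. For
smaller U the point is causality: energies above U cannot influence the result below U. On the real
axis Z_U differs from exp E by O(e^{-Vx}) for every real V ≤ U, and E(x) = o(x), so ln Z_U - E is
O(e^{-V'x}) for V' < V (`exists_norm_sub_levyExponent_le`). Off the axis ln Z_U has real part
bounded above, hence grows at most quadratically by Borel–Carathéodory (`norm_le_of_re_le`), and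
Phragmén–Lindelöf spreads the real decay over a half-plane (`norm_le_exp_of_real_decay`). If φ is
supported in [a, b] with b < V', its transform is O(e^{b Re s}) with rapid vertical decay. Moving
the contour to the far right therefore kills the difference, and only E remains
(`tendsto_integral_mul_contourIntegral`).

The series and pointwise formulas use W₀ > 0. Far to the right the transform G of g cut at U is
smaller than W₀, so ln(1 + G/W₀) expands into powers of G and is the transform of the logarithmic
series k in the convolution algebra. For U = ∞ uniqueness of the transform gives k = f almost
everywhere (`convSeries_logCoeff_ae_eq`). Below U the cut does not change self-convolutions, so
there k = f for every U. Dini's criterion inverts the transform of k on a far contour. The contour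
returns to Re s = c because ln Z_U - ln W₀ tends to 0 high up in vertical strips, by a uniform
Riemann–Lebesgue lemma. -/

/-! ### Branches of the logarithm on a half-plane -/

theorem isOpen_re_gt (c₀ : ℝ) : IsOpen {s : ℂ | c₀ < s.re} :=
  isOpen_lt continuous_const Complex.continuous_re

theorem convex_re_gt (c₀ : ℝ) : Convex ℝ {s : ℂ | c₀ < s.re} :=
  convex_halfSpace_re_gt c₀

/-- Two holomorphic logarithms of the same function on a connected open set agree as soon as
they agree at one point. -/
theorem eqOn_of_exp_eq {S : Set ℂ} (hS : IsOpen S) (hS' : IsPreconnected S) {F G : ℂ → ℂ}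
    (hF : DifferentiableOn ℂ F S) (hG : DifferentiableOn ℂ G S)
    (h : ∀ s ∈ S, Complex.exp (F s) = Complex.exp (G s)) {s₀ : ℂ} (hs₀ : s₀ ∈ S)
    (h0 : F s₀ = G s₀) : EqOn F G S := by
  refine hS.eqOn_of_deriv_eq hS' hF hG (fun s hs => ?_) hs₀ h0
  -- Differentiating e^F = e^G gives e^F F' = e^G G', and the common nonzero factor cancels.
  have hFs := ((hF s hs).differentiableAt (hS.mem_nhds hs)).hasDerivAt.cexp
  have hGs := ((hG s hs).differentiableAt (hS.mem_nhds hs)).hasDerivAt.cexp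
  have heq : (fun x => Complex.exp (F x)) =ᶠ[𝓝 s] fun x => Complex.exp (G x) :=
    Filter.eventually_of_mem (hS.mem_nhds hs) h
  have := (hFs.congr_of_eventuallyEq heq.symm).unique hGs
  rw [h s hs] at this
  exact mul_left_cancel₀ (Complex.exp_ne_zero _) this

/-- A continuous logarithm of a holomorphic function is holomorphic. -/
theorem differentiableOn_of_exp {S : Set ℂ} (hS : IsOpen S) {F Z : ℂ → ℂ}
    (hF : ContinuousOn F S) (hZ : DifferentiableOn ℂ Z S)
    (h : ∀ s ∈ S, Complex.exp (F s) = Z s) : DifferentiableOn ℂ F S := by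
  intro s hs
  have hFs : ContinuousAt F s := hF.continuousAt (hS.mem_nhds hs)
  have hZs := (hZ s hs).differentiableAt (hS.mem_nhds hs)
  have hne : Z s ≠ 0 := by rw [← h s hs]; exact Complex.exp_ne_zero _
  -- Near s, continuity keeps F x - F s within distance π of 0, where the principal logarithm
  -- inverts the exponential. So F agrees there with this manifestly holomorphic function.
  have hd : DifferentiableAt ℂ (fun x => F s + Complex.log (Z x / Z s)) s := by
    refine (DifferentiableAt.clog (hZs.div_const _) ?_).const_add _
    rw [div_self hne]
    exact Complex.one_mem_slitPlane
  refine (hd.congr_of_eventuallyEq ?_).differentiableWithinAt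
  have h1 : ∀ᶠ x in 𝓝 s, ‖F x - F s‖ < Real.pi := by
    have : Tendsto (fun x => ‖F x - F s‖) (𝓝 s) (𝓝 0) := by
      simpa using (hFs.tendsto.sub_const (F s)).norm
    exact this.eventually (gt_mem_nhds Real.pi_pos)
  filter_upwards [h1, hS.mem_nhds hs] with x hx hxS
  have him := (abs_le.1 (Complex.abs_im_le_norm (F x - F s)))
  rw [← h x hxS, ← h s hs, ← Complex.exp_sub, Complex.log_exp (by linarith) (by linarith)]
  ring

/-- A zero-free holomorphic function on a half-plane that is positive on the real axis has a
logarithm that is real on the real axis. -/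
theorem exists_isLogBranch {Z : ℂ → ℂ} {c₀ : ℝ}
    (hZ : DifferentiableOn ℂ Z {s : ℂ | c₀ < s.re}) (h0 : ∀ s : ℂ, c₀ < s.re → Z s ≠ 0)
    (hpos : ∀ x : ℝ, c₀ < x → ∃ r : ℝ, 0 < r ∧ Z x = r) : ∃ L, IsLogBranch Z c₀ L := by
  have hsc : IsSimplyConnected {s : ℂ | c₀ < s.re} := by
    have : ContractibleSpace {s : ℂ | c₀ < s.re} :=
      (convex_re_gt c₀).contractibleSpace ⟨((c₀ + 1 : ℝ) : ℂ), by simp⟩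
    exact SimplyConnectedSpace.ofContractible _
  obtain ⟨F, hFc, hF⟩ := Complex.exists_continuousOn_eqOn_exp_comp hsc (isOpen_re_gt c₀)
    hZ.continuousOn (by rintro ⟨s, hs, hs0⟩; exact h0 s hs hs0)
  have hF' : ∀ s : ℂ, c₀ < s.re → Complex.exp (F s) = Z s := fun s hs => hF hs
  have hx0 : c₀ < c₀ + 1 := by linarith
  obtain ⟨r₀, hr₀, hr₀'⟩ := hpos (c₀ + 1) hx0
  set x₀ : ℂ := ((c₀ + 1 : ℝ) : ℂ) with hx₀
  have hx₀m : c₀ < x₀.re := by simp [hx₀]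
  -- The constant makes L real at x₀. It is a multiple of 2πi, so exponentials are unchanged.
  let L : ℂ → ℂ := fun s => F s + (Real.log r₀ - F x₀)
  have hLexp : ∀ s : ℂ, c₀ < s.re → Complex.exp (L s) = Z s := by
    intro s hs
    simp only [L]
    rw [Complex.exp_add, Complex.exp_sub, hF' s hs, hF' x₀ hx₀m, hr₀', ← Complex.ofReal_exp,
      Real.exp_log hr₀, div_self (by exact_mod_cast hr₀.ne'), mul_one]
  have hLc : ContinuousOn L {s : ℂ | c₀ < s.re} := hFc.add continuousOn_const
  refine ⟨L, differentiableOn_of_exp (isOpen_re_gt c₀) hLc hZ hLexp, hLexp, ?_⟩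
  -- On the real ray the imaginary part lies in 2πℤ. Being continuous on a connected set it is
  -- constant, and it vanishes at c₀ + 1.
  have key : ∀ x : ℝ, c₀ < x → ∃ n : ℤ, (L x).im = n * (2 * Real.pi) := by
    intro x hx
    obtain ⟨r, hr, hr'⟩ := hpos x hx
    have h1 : Complex.exp (L x) = Complex.exp (Real.log r : ℂ) := by
      rw [hLexp x (by simpa using hx), hr', ← Complex.ofReal_exp, Real.exp_log hr]
    obtain ⟨n, hn⟩ := Complex.exp_eq_exp_iff_exists_int.1 h1
    refine ⟨n, ?_⟩
    rw [hn]
    simp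
  have hcont : ContinuousOn (fun x : ℝ => (L x).im / (2 * Real.pi)) (Ioi c₀) := by
    refine ContinuousOn.div_const (Complex.continuous_im.comp_continuousOn
      (hLc.comp Complex.continuous_ofReal.continuousOn fun x hx => by simpa using hx)) _
  have hmaps : MapsTo (fun x : ℝ => (L x).im / (2 * Real.pi)) (Ioi c₀)
      (range ((↑) : ℤ → ℝ)) := by
    intro x hx
    obtain ⟨n, hn⟩ := key x hx
    refine ⟨n, ?_⟩
    simp only
    rw [hn]
    field_simp
  intro x hx
  have hdisc : IsDiscrete (range ((↑) : ℤ → ℝ)) :=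
    Int.isClosedEmbedding_coe_real.isEmbedding.isDiscrete_range
  have := isPreconnected_Ioi.constant_of_mapsTo hdisc hcont hmaps
    (show x ∈ Ioi c₀ from hx) (show c₀ + 1 ∈ Ioi c₀ from hx0)
  have hL0 : (L ((c₀ + 1 : ℝ) : ℂ)).im = 0 := by
    simp only [L, ← hx₀]
    simp
  rw [hL0, zero_div, div_eq_zero_iff] at this
  exact this.resolve_right (by positivity)

theorem isLogBranch_ofReal {Z : ℂ → ℂ} {c₀ : ℝ} {L : ℂ → ℂ} (hL : IsLogBranch Z c₀ L)
    {x r : ℝ} (hx : c₀ < x) (hr : Z x = r) : 0 < r ∧ L x = (Real.log r : ℝ) := by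
  have h1 := hL.exp_eq x (by simpa using hx)
  have h2 : L x = ((L x).re : ℂ) := by
    apply Complex.ext <;> simp [hL.im_eq_zero x hx]
  rw [h2, ← Complex.ofReal_exp, hr] at h1
  have h3 : Real.exp (L x).re = r := by exact_mod_cast h1
  refine ⟨h3 ▸ Real.exp_pos _, ?_⟩
  rw [← h3, Real.log_exp, ← h2]

/-! ### Growth, decay and contour shifts in half-planes -/

/-- A holomorphic function on a half-plane whose real part is bounded above grows at most
quadratically away from the boundary. -/
theorem norm_le_of_re_le {L : ℂ → ℂ} {c₀ M : ℝ}
    (hL : DifferentiableOn ℂ L {s : ℂ | c₀ < s.re}) (hM : ∀ s : ℂ, c₀ < s.re → (L s).re ≤ M)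
    {c : ℝ} (hc : c₀ < c) :
    ∃ K : ℝ, 0 ≤ K ∧ ∀ s : ℂ, c ≤ s.re → ‖L s‖ ≤ K * (1 + ‖s‖ ^ 2) := by
  -- Borel–Carathéodory requires a positive bound on the real part.
  set M' := max M 1
  have hM' : 0 < M' := lt_of_lt_of_le one_pos (le_max_right _ _)
  -- Cayley map of the unit disc into the half-plane, which transports the disc estimate.
  let κ : ℂ → ℂ := fun w => c₀ + (1 + w) / (1 - w)
  have hne : ∀ w ∈ Metric.ball (0 : ℂ) 1, 1 - w ≠ 0 := by
    intro w hw h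
    rw [sub_eq_zero] at h
    rw [← h] at hw
    simp at hw
  have hκ : MapsTo κ (Metric.ball 0 1) {s : ℂ | c₀ < s.re} := by
    intro w hw
    have hw1 : ‖w‖ < 1 := by simpa using hw
    have h1 : 0 < Complex.normSq (1 - w) := Complex.normSq_pos.2 (hne w hw)
    have h2 : ‖w‖ ^ 2 = w.re * w.re + w.im * w.im := by rw [Complex.sq_norm, Complex.normSq_apply]
    have h3 : 0 < (1 + w.re) * (1 - w.re) + w.im * (-w.im) := by nlinarith [norm_nonneg w]
    show c₀ < (κ w).re
    simp only [κ, Complex.add_re, Complex.ofReal_re, Complex.div_re, Complex.one_re,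
      Complex.sub_re, Complex.add_im, Complex.one_im, Complex.sub_im, zero_add, zero_sub]
    rw [← add_div]
    have : 0 < ((1 + w.re) * (1 - w.re) + w.im * -w.im) / Complex.normSq (1 - w) := by positivity
    linarith
  have hκd : DifferentiableOn ℂ κ (Metric.ball 0 1) := by
    intro w hw
    have := hne w hw
    exact ((differentiableAt_const _).add (((differentiableAt_const _).add differentiableAt_id).div
      ((differentiableAt_const _).sub differentiableAt_id) this)).differentiableWithinAt
  have hG := hL.comp hκd hκ
  have hGM : MapsTo (L ∘ κ) (Metric.ball 0 1) {z | z.re ≤ M'} :=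
    fun w hw => (hM _ (hκ hw)).trans (le_max_left _ _)
  refine ⟨(2 * M' + 2 * ‖(L ∘ κ) 0‖) * ((1 + (|c₀| + 1) ^ 2) / (c - c₀)), by
    have : 0 < c - c₀ := by linarith
    positivity, fun s hs => ?_⟩
  set z := s - c₀ with hz
  have hzre : c - c₀ ≤ z.re := by simp [hz]; linarith
  have hzpos : 0 < z.re := by linarith
  have hz1 : z + 1 ≠ 0 := by
    intro h
    have := congrArg Complex.re h
    simp at this
    linarith
  set w := (z - 1) / (z + 1) with hw
  have hκw : κ w = s := by
    have h2 : 1 - w = 2 / (z + 1) := by rw [hw]; field_simp; ring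
    have h3 : 1 + w = 2 * z / (z + 1) := by rw [hw]; field_simp; ring
    simp only [κ]
    rw [h2, h3]
    field_simp
    rw [hz]; ring
  -- The Borel–Carathéodory bound blows up like 1/(1 - ‖w‖). This identity turns that into ‖z + 1‖²
  -- divided by the distance from the boundary, whence quadratic growth.
  have hnorm : ‖w‖ ^ 2 = 1 - 4 * z.re / ‖z + 1‖ ^ 2 := by
    have hp : 0 < ‖z + 1‖ ^ 2 := by positivity
    rw [hw, norm_div, div_pow]
    field_simp
    simp only [Complex.sq_norm, Complex.normSq_apply]
    simp
    ring
  have hp : 0 < ‖z + 1‖ ^ 2 := by positivity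
  have hw1 : ‖w‖ < 1 := by
    have : 0 < 4 * z.re / ‖z + 1‖ ^ 2 := by positivity
    nlinarith [norm_nonneg w]
  have hwb : w ∈ Metric.ball (0 : ℂ) 1 := by simpa using hw1
  have hBC := Complex.borelCaratheodory hM' hG hGM one_pos hwb
  have hdist : 1 / (1 - ‖w‖) ≤ ‖z + 1‖ ^ 2 / (2 * (c - c₀)) := by
    have h1 : (1 - ‖w‖) * (1 + ‖w‖) = 4 * z.re / ‖z + 1‖ ^ 2 := by nlinarith
    have h2 : 2 * z.re / ‖z + 1‖ ^ 2 ≤ 1 - ‖w‖ := by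
      have : 4 * z.re / ‖z + 1‖ ^ 2 ≤ (1 - ‖w‖) * 2 := by
        rw [← h1]
        exact mul_le_mul_of_nonneg_left (by linarith) (by linarith)
      have h4 : 4 * z.re / ‖z + 1‖ ^ 2 = 2 * (2 * z.re / ‖z + 1‖ ^ 2) := by ring
      linarith
    have h5 : 2 * (c - c₀) / ‖z + 1‖ ^ 2 ≤ 1 - ‖w‖ :=
      le_trans (by gcongr) h2
    have h6 : 0 < 2 * (c - c₀) / ‖z + 1‖ ^ 2 := by
      have : 0 < c - c₀ := by linarith
      positivity
    calc 1 / (1 - ‖w‖) ≤ 1 / (2 * (c - c₀) / ‖z + 1‖ ^ 2) := one_div_le_one_div_of_le h6 h5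
      _ = _ := by rw [one_div_div]
  have hle : ‖L s‖ ≤ (2 * M' + 2 * ‖(L ∘ κ) 0‖) * (1 / (1 - ‖w‖)) := by
    have h1 : 0 < 1 - ‖w‖ := by linarith
    have : (L ∘ κ) w = L s := by simp [hκw]
    rw [this] at hBC
    refine hBC.trans ?_
    rw [← add_div, mul_one_div]
    refine div_le_div_of_nonneg_right ?_ h1.le
    have h2 : 2 * M' * ‖w‖ ≤ 2 * M' * 1 := by gcongr
    have h3 : ‖(L ∘ κ) 0‖ * (1 + ‖w‖) ≤ ‖(L ∘ κ) 0‖ * 2 := by gcongr; linarith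
    linarith
  have hzs : ‖z + 1‖ ^ 2 ≤ 2 * ((1 + (|c₀| + 1) ^ 2) * (1 + ‖s‖ ^ 2)) := by
    have h1 : ‖z + 1‖ ≤ ‖s‖ + (|c₀| + 1) := by
      have : z + 1 = s - (c₀ - 1 : ℝ) := by rw [hz]; push_cast; ring
      rw [this]
      refine (norm_sub_le _ _).trans ?_
      rw [Complex.norm_real, Real.norm_eq_abs]
      gcongr
      exact (abs_sub _ _).trans (by simp)
    have h2 : ‖z + 1‖ ^ 2 ≤ (‖s‖ + (|c₀| + 1)) ^ 2 := by gcongr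
    nlinarith [sq_nonneg (‖s‖ - (|c₀| + 1)), sq_nonneg (‖s‖ * (|c₀| + 1)), norm_nonneg s]
  calc ‖L s‖ ≤ (2 * M' + 2 * ‖(L ∘ κ) 0‖) * (1 / (1 - ‖w‖)) := hle
    _ ≤ (2 * M' + 2 * ‖(L ∘ κ) 0‖) * (((1 + (|c₀| + 1) ^ 2) / (c - c₀)) * (1 + ‖s‖ ^ 2)) := by
        gcongr
        refine hdist.trans ?_
        have : 0 < c - c₀ := by linarith
        rw [div_mul_eq_mul_div, div_le_div_iff₀ (by positivity) this]
        nlinarith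
    _ = _ := by ring

/-- Moving a truncated vertical contour when the integrand is small on the horizontal edges. -/
theorem tendsto_contour_shift {F : ℂ → ℂ} {c₀ c C : ℝ}
    (hF : DifferentiableOn ℂ F {s : ℂ | c₀ < s.re}) (hc : c₀ < c) (hcC : c ≤ C)
    (hsmall : ∀ ε > 0, ∀ᶠ T : ℝ in atTop, ∀ σ ∈ Icc c C,
      ‖F (σ + T * Complex.I)‖ ≤ ε ∧ ‖F (σ + (-T : ℝ) * Complex.I)‖ ≤ ε) :
    Tendsto (fun T : ℝ => (∫ t in (-T)..T, F (c + t * Complex.I))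
      - ∫ t in (-T)..T, F (C + t * Complex.I)) atTop (𝓝 0) := by
  have hrect : ∀ T : ℝ, (∫ t in (-T)..T, F (c + t * Complex.I))
      - (∫ t in (-T)..T, F (C + t * Complex.I)) = -Complex.I *
      ((∫ x in c..C, F (x + (-T : ℝ) * Complex.I)) - ∫ x in c..C, F (x + T * Complex.I)) := by
    intro T
    have h := Complex.integral_boundary_rect_eq_zero_of_differentiableOn F
      (c + (-T : ℝ) * Complex.I) (C + T * Complex.I) (hF.mono (by
        intro s hs
        have := hs.1
        simp [uIcc_of_le hcC] at this
        exact lt_of_lt_of_le hc this.1))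
    simp [← sub_eq_add_neg] at h
    simp only [Complex.ofReal_neg, neg_mul, ← sub_eq_add_neg]
    linear_combination Complex.I * h + ((∫ t in (-T)..T, F (c + t * Complex.I))
      - (∫ t in (-T)..T, F (C + t * Complex.I))) * Complex.I_mul_I
  simp_rw [hrect]
  rw [Metric.tendsto_nhds]
  intro ε hε
  have hd : 0 < C - c + 1 := by linarith
  filter_upwards [hsmall (ε / (4 * (C - c + 1))) (by positivity)] with T hT
  have h1 : ‖∫ x in c..C, F (x + (-T : ℝ) * Complex.I)‖ ≤ ε / (4 * (C - c + 1)) * |C - c| := by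
    refine intervalIntegral.norm_integral_le_of_norm_le_const fun x hx => ?_
    rw [uIoc_of_le hcC] at hx
    exact (hT x ⟨hx.1.le, hx.2⟩).2
  have h2 : ‖∫ x in c..C, F (x + T * Complex.I)‖ ≤ ε / (4 * (C - c + 1)) * |C - c| := by
    refine intervalIntegral.norm_integral_le_of_norm_le_const fun x hx => ?_
    rw [uIoc_of_le hcC] at hx
    exact (hT x ⟨hx.1.le, hx.2⟩).1
  have h3 : ε / (4 * (C - c + 1)) * |C - c| ≤ ε / 4 := by
    rw [abs_of_nonneg (by linarith), div_mul_eq_mul_div, div_le_div_iff₀ (by positivity) (by norm_num)]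
    nlinarith
  rw [dist_zero_right, norm_mul]
  simp only [norm_neg, Complex.norm_I, one_mul]
  have := norm_sub_le (∫ x in c..C, F (x + (-T : ℝ) * Complex.I)) (∫ x in c..C, F (x + T * Complex.I))
  linarith

theorem integrable_vertical {F : ℂ → ℂ} {c₀ c K : ℝ}
    (hF : ContinuousOn F {s : ℂ | c₀ < s.re}) (hc : c₀ < c)
    (hK : ∀ t : ℝ, ‖F (c + t * Complex.I)‖ ≤ K / (1 + t ^ 2)) :
    Integrable (fun t : ℝ => F (c + t * Complex.I)) := by
  refine Integrable.mono' (integrable_inv_one_add_sq.const_mul K) ?_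
    (ae_of_all _ fun t => by simpa [div_eq_mul_inv] using hK t)
  refine Continuous.aestronglyMeasurable (hF.comp_continuous (by fun_prop) fun t => ?_)
  simpa using hc

/-- Moving a vertical contour for an integrand decaying like `1 / (1 + t ^ 2)`. -/
theorem integral_contour_shift {F : ℂ → ℂ} {c₀ c C K : ℝ}
    (hF : DifferentiableOn ℂ F {s : ℂ | c₀ < s.re}) (hc : c₀ < c) (hcC : c ≤ C)
    (hK : ∀ σ ∈ Icc c C, ∀ t : ℝ, ‖F (σ + t * Complex.I)‖ ≤ K / (1 + t ^ 2)) :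
    ∫ t : ℝ, F (c + t * Complex.I) = ∫ t : ℝ, F (C + t * Complex.I) := by
  have h0 : Tendsto (fun T : ℝ => K / (1 + T ^ 2)) atTop (𝓝 0) := by
    refine Tendsto.div_atTop tendsto_const_nhds ?_
    exact tendsto_atTop_add_const_left _ _ (tendsto_pow_atTop two_ne_zero)
  have h1 := tendsto_contour_shift hF hc hcC (by
    intro ε hε
    filter_upwards [h0.eventually (gt_mem_nhds hε)] with T hT σ hσ
    refine ⟨(hK σ hσ T).trans hT.le, (hK σ hσ (-T)).trans ?_⟩
    simpa using hT.le)
  have h2 := (intervalIntegral_tendsto_integral (integrable_vertical hF.continuousOn hc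
    (hK c ⟨le_rfl, hcC⟩)) tendsto_neg_atTop_atBot tendsto_id).sub
    (intervalIntegral_tendsto_integral (integrable_vertical hF.continuousOn (hc.trans_le hcC)
    (hK C ⟨hcC, le_rfl⟩)) tendsto_neg_atTop_atBot tendsto_id)
  exact sub_eq_zero.1 (tendsto_nhds_unique h2 h1)

/-- A holomorphic function of polynomial growth on a half-plane that decays exponentially on the
real axis decays exponentially on the half-plane. -/
theorem norm_le_exp_of_real_decay {D : ℂ → ℂ} {c₁ c K V : ℝ}
    (hD : DifferentiableOn ℂ D {s : ℂ | c₁ < s.re}) (hc : c₁ < c) (hc0 : 0 ≤ c)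
    (hK : ∀ s : ℂ, c ≤ s.re → ‖D s‖ ≤ K * (1 + ‖s‖ ^ 2))
    (hreal : ∃ B : ℝ, ∀ᶠ x : ℝ in atTop, ‖D x‖ ≤ B * Real.exp (-V * x)) :
    ∃ K' : ℝ, ∀ s : ℂ, c ≤ s.re → ‖D s‖ ≤ K' * (1 + ‖s‖ ^ 2) * Real.exp (-V * s.re) := by
  have hK0 : 0 ≤ K := by
    have h1 := (norm_nonneg _).trans (hK c (by simp))
    exact nonneg_of_mul_nonneg_left h1 (by positivity)
  set C := K * (2 + 2 * c ^ 2) with hC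
  have hC0 : 0 ≤ C := by positivity
  -- The half-plane is shifted to Re z > 0. The exponential undoes the expected decay and (1 + z)²
  -- absorbs the quadratic growth, so F is bounded on the imaginary axis and far out on the positive
  -- real axis.
  let F : ℂ → ℂ := fun z => D (c + z) * Complex.exp (V * z) / (1 + z) ^ 2
  have hne : ∀ z : ℂ, 0 ≤ z.re → 1 + z ≠ 0 := by
    intro z hz h
    have := congrArg Complex.re h
    simp at this
    linarith
  have h1z : ∀ z : ℂ, 0 ≤ z.re → 1 + ‖z‖ ^ 2 ≤ ‖1 + z‖ ^ 2 := by
    intro z hz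
    simp only [Complex.sq_norm, Complex.normSq_apply, Complex.add_re, Complex.one_re,
      Complex.add_im, Complex.one_im]
    nlinarith
  have hDz : ∀ z : ℂ, 0 ≤ z.re → ‖D (c + z)‖ ≤ C * ‖1 + z‖ ^ 2 := by
    intro z hz
    refine (hK (c + z) (by simpa using hz)).trans ?_
    have h2 : ‖(c : ℂ) + z‖ ≤ c + ‖z‖ := by
      refine (norm_add_le _ _).trans ?_
      rw [Complex.norm_real, Real.norm_of_nonneg hc0]
    have h3 : ‖(c : ℂ) + z‖ ^ 2 ≤ (c + ‖z‖) ^ 2 := by gcongr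
    have h4 : 1 + ‖(c : ℂ) + z‖ ^ 2 ≤ (2 + 2 * c ^ 2) * (1 + ‖z‖ ^ 2) := by
      nlinarith [sq_nonneg (c - ‖z‖), sq_nonneg (c * ‖z‖)]
    rw [hC, mul_assoc]
    gcongr
    exact h4.trans (by gcongr; exact h1z z hz)
  have hFz : ∀ z : ℂ, 0 ≤ z.re → ‖F z‖ ≤ C * Real.exp (V * z.re) := by
    intro z hz
    have hp : 0 < ‖1 + z‖ ^ 2 := by have := norm_pos_iff.2 (hne z hz); positivity
    simp only [F, norm_div, norm_mul, norm_pow, Complex.norm_exp]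
    rw [div_le_iff₀ hp]
    have : ((V : ℂ) * z).re = V * z.re := by simp
    rw [this]
    calc _ ≤ (C * ‖1 + z‖ ^ 2) * Real.exp (V * z.re) := by gcongr; exact hDz z hz
      _ = _ := by ring
  have hcl : closure {z : ℂ | 0 < z.re} ⊆ {z : ℂ | 0 ≤ z.re} :=
    closure_minimal (fun z (hz : 0 < z.re) => show 0 ≤ z.re from hz.le) (isClosed_le continuous_const Complex.continuous_re)
  have hFd : DiffContOnCl ℂ F {z | 0 < z.re} := by
    refine DifferentiableOn.diffContOnCl fun z hz => DifferentiableAt.differentiableWithinAt ?_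
    have hz0 : 0 ≤ z.re := hcl hz
    have h1 : DifferentiableAt ℂ D (c + z) :=
      (hD _ (by simp only [mem_ofPred_eq, Complex.add_re, Complex.ofReal_re]; linarith)).differentiableAt
        ((isOpen_re_gt c₁).mem_nhds
          (by simp only [mem_ofPred_eq, Complex.add_re, Complex.ofReal_re]; linarith))
    have h2 : DifferentiableAt ℂ (fun z : ℂ => D (c + z)) z :=
      h1.comp z (differentiableAt_id.const_add _)
    exact (h2.mul (by fun_prop)).div (by fun_prop) (pow_ne_zero 2 (hne z hz0))
  have hPL : ∀ z : ℂ, 0 ≤ z.re → ‖F z‖ ≤ C := by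
    intro z hz
    -- F has at most exponential growth, of order 1 < 2, so the boundary bound C holds throughout.
    refine PhragmenLindelof.right_half_plane_of_bounded_on_real hFd ⟨1, by norm_num, |V|, ?_⟩ ?_ ?_ hz
    · refine Asymptotics.IsBigO.of_bound C ?_
      filter_upwards [mem_inf_of_right (mem_principal_self _)] with z hz
      have hz : 0 < z.re := hz
      refine (hFz z hz.le).trans ?_
      rw [Real.norm_of_nonneg (Real.exp_pos _).le, Real.rpow_one]
      gcongr
      · exact le_abs_self V
      · exact (le_abs_self _).trans (Complex.abs_re_le_norm z)
    · obtain ⟨B, hB⟩ := hreal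
      refine ⟨B * Real.exp (-V * c), ?_⟩
      rw [eventually_map]
      have ht : Tendsto (fun x : ℝ => c + x) atTop atTop :=
        tendsto_atTop_add_const_left _ _ tendsto_id
      filter_upwards [ht.eventually hB, eventually_ge_atTop 0] with x hx hx0
      have hp : 1 ≤ ‖(1 : ℂ) + x‖ ^ 2 :=
        le_trans (by nlinarith [norm_nonneg (x : ℂ)]) (h1z x (by simpa using hx0))
      simp only [F, norm_div, norm_mul, norm_pow, Complex.norm_exp]
      have h5 : ((V : ℂ) * x).re = V * x := by simp
      rw [h5]
      refine (div_le_self (by positivity) hp).trans ?_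
      push_cast at hx
      calc _ ≤ (B * Real.exp (-V * (c + x))) * Real.exp (V * x) := by gcongr
        _ = _ := by rw [mul_assoc, ← Real.exp_add]; ring_nf
    · intro x
      simpa using hFz (x * Complex.I) (by simp)
  refine ⟨C * (2 * (1 + c) ^ 2) * Real.exp (V * c), fun s hs => ?_⟩
  have hz0 : 0 ≤ (s - c).re := by simpa using hs
  have h6 := hPL (s - c) hz0
  have hp : 0 < ‖1 + (s - c)‖ ^ 2 := by have := norm_pos_iff.2 (hne _ hz0); positivity
  simp only [F, norm_div, norm_mul, norm_pow, Complex.norm_exp, add_sub_cancel] at h6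
  rw [div_le_iff₀ hp] at h6
  have h7 : ((V : ℂ) * (s - c)).re = V * s.re - V * c := by simp; ring
  rw [h7] at h6
  have h8 : ‖1 + (s - c)‖ ^ 2 ≤ 2 * (1 + c) ^ 2 * (1 + ‖s‖ ^ 2) := by
    have h9 : ‖1 + (s - c)‖ ≤ ‖s‖ + (1 + c) := by
      have : 1 + (s - c) = s + (1 - c : ℝ) := by push_cast; ring
      rw [this]
      refine (norm_add_le _ _).trans ?_
      rw [Complex.norm_real, Real.norm_eq_abs]
      gcongr
      exact abs_le.2 ⟨by linarith, by linarith⟩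
    have h10 : ‖1 + (s - c)‖ ^ 2 ≤ (‖s‖ + (1 + c)) ^ 2 := by gcongr
    nlinarith [sq_nonneg (‖s‖ - (1 + c)), sq_nonneg ‖s‖, sq_nonneg (c * ‖s‖),
      mul_nonneg hc0 (sq_nonneg ‖s‖)]
  have h11 : ‖D s‖ = ‖D s‖ * Real.exp (V * s.re - V * c) * Real.exp (V * c) * Real.exp (-V * s.re) := by
    rw [mul_assoc, mul_assoc, ← Real.exp_add, ← Real.exp_add]
    ring_nf
    simp
  rw [h11]
  calc _ ≤ (C * (2 * (1 + c) ^ 2 * (1 + ‖s‖ ^ 2))) * Real.exp (V * c) * Real.exp (-V * s.re) := by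
        refine mul_le_mul_of_nonneg_right (mul_le_mul_of_nonneg_right ?_ (Real.exp_pos _).le)
          (Real.exp_pos _).le
        exact h6.trans (mul_le_mul_of_nonneg_left h8 hC0)
    _ = _ := by ring

/-! ### Holomorphy of Laplace integrals -/

theorem norm_cexp_neg_mul (s : ℂ) (ω : ℝ) :
    ‖Complex.exp (-s * ω)‖ = Real.exp (-s.re * ω) := by
  rw [Complex.norm_exp]; simp

/-- A Laplace integral, possibly with a subtraction, is holomorphic in its half-plane. -/
theorem differentiableOn_laplace {μ : Measure ℝ} {h : ℝ → ℂ} {κ : ℂ} {c₀ : ℝ}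
    (hm : AEStronglyMeasurable h μ)
    (hint : ∀ s : ℂ, c₀ < s.re → Integrable (fun ω : ℝ => h ω * (Complex.exp (-s * ω) - κ)) μ)
    (hder : ∀ c : ℝ, c₀ < c → Integrable (fun ω : ℝ => |ω| * ‖h ω‖ * Real.exp (-c * ω)) μ) :
    DifferentiableOn ℂ (fun s : ℂ => ∫ ω, h ω * (Complex.exp (-s * ω) - κ) ∂μ)
      {s : ℂ | c₀ < s.re} := by
  intro s hs
  have hs : c₀ < s.re := hs
  set δ := (s.re - c₀) / 2 with hδ
  have hδ0 : 0 < δ := by rw [hδ]; linarith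
  have hF' : ∀ s' : ℂ, AEStronglyMeasurable
      (fun ω : ℝ => h ω * (Complex.exp (-s' * ω) * (-(ω : ℂ)))) μ := fun s' =>
    hm.mul (Continuous.aestronglyMeasurable (by fun_prop))
  -- The two exponentials in the bound serve the two signs of ω: for ω ≥ 0 the smallest real part in
  -- the ball dominates, for ω ≤ 0 the largest.
  refine (hasDerivAt_integral_of_dominated_loc_of_deriv_le (μ := μ) (𝕜 := ℂ)
    (F := fun s ω => h ω * (Complex.exp (-s * ω) - κ))
    (F' := fun s ω => h ω * (Complex.exp (-s * ω) * (-(ω : ℂ)))) (x₀ := s)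
    (bound := fun ω => |ω| * ‖h ω‖ * Real.exp (-(s.re - δ) * ω)
      + |ω| * ‖h ω‖ * Real.exp (-(s.re + δ) * ω))
    (Metric.ball_mem_nhds s hδ0) ?_ (hint s hs) (hF' s) ?_
    ((hder _ (by linarith)).add (hder _ (by linarith))) ?_).2.differentiableAt.differentiableWithinAt
  · exact Eventually.of_forall fun s' =>
      hm.mul (Continuous.aestronglyMeasurable (by fun_prop))
  · refine ae_of_all _ fun ω s' hs' => ?_
    have hre : |s'.re - s.re| < δ := by
      have := Complex.abs_re_le_norm (s' - s)
      rw [Complex.sub_re] at this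
      exact this.trans_lt (by simpa [dist_eq_norm] using hs')
    rw [abs_lt] at hre
    rw [norm_mul, norm_mul, norm_cexp_neg_mul, norm_neg, Complex.norm_real, Real.norm_eq_abs,
      ← mul_add]
    have hexp : Real.exp (-s'.re * ω) ≤ Real.exp (-(s.re - δ) * ω) + Real.exp (-(s.re + δ) * ω) := by
      rcases le_total 0 ω with h0 | h0
      · have : Real.exp (-s'.re * ω) ≤ Real.exp (-(s.re - δ) * ω) := by
          apply Real.exp_le_exp.2; nlinarith
        linarith [Real.exp_pos (-(s.re + δ) * ω)]
      · have : Real.exp (-s'.re * ω) ≤ Real.exp (-(s.re + δ) * ω) := by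
          apply Real.exp_le_exp.2; nlinarith
        linarith [Real.exp_pos (-(s.re - δ) * ω)]
    calc ‖h ω‖ * (Real.exp (-s'.re * ω) * |ω|) = |ω| * ‖h ω‖ * Real.exp (-s'.re * ω) := by ring
      _ ≤ _ := by gcongr
  · refine ae_of_all _ fun ω s' _ => ?_
    have h1 : HasDerivAt (fun s : ℂ => -s * (ω : ℂ)) (-(ω : ℂ)) s' := by
      simpa using (hasDerivAt_id s').neg.mul_const (ω : ℂ)
    exact (h1.cexp.sub_const κ).const_mul (h ω)

/-! ### Transforms of test functions -/

/-- The bilateral transform `∫ φ(x) e^{sx} dx` of a test function. -/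
noncomputable def testTransform (φ : ℝ → ℂ) (s : ℂ) : ℂ := ∫ x : ℝ, φ x * Complex.exp (s * x)

theorem integrable_mul_of_hasCompactSupport {φ k : ℝ → ℂ} (hφ : Continuous φ)
    (hs : HasCompactSupport φ) (hk : Continuous k) : Integrable (fun x => φ x * k x) :=
  (hφ.mul hk).integrable_of_hasCompactSupport hs.mul_right

theorem differentiable_testTransform {φ : ℝ → ℂ} (hφ : Continuous φ)
    (hs : HasCompactSupport φ) (c₀ : ℝ) :
    DifferentiableOn ℂ (testTransform φ) {s : ℂ | c₀ < s.re} := by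
  -- The kernel here is e^{sx} rather than e^{-sx}, so the Laplace lemma is applied after reflecting
  -- s. Compact support allows every abscissa.
  have h : ∀ c₀ : ℝ, DifferentiableOn ℂ (fun s => testTransform φ (-s)) {s : ℂ | c₀ < s.re} := by
    intro c₀
    have := differentiableOn_laplace (μ := volume) (h := φ) (κ := 0) (c₀ := c₀)
      hφ.aestronglyMeasurable (fun s _ => by
        simp only [sub_zero]
        exact integrable_mul_of_hasCompactSupport hφ hs (by fun_prop)) (fun c _ => by
        refine Continuous.integrable_of_hasCompactSupport (by fun_prop) ?_
        exact (hs.norm.mul_left).mul_right)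
    simpa [testTransform] using this
  intro s hs'
  have h1 := (h (-s.re - 1) (-s) (by simp)).differentiableAt
    ((isOpen_re_gt (-s.re - 1)).mem_nhds (by simp))
  have h2 : DifferentiableAt ℂ (fun s => testTransform φ (- (- s))) s :=
    (h1.hasDerivAt.comp s (hasDerivAt_neg s)).differentiableAt
  simpa using h2.differentiableWithinAt

/-- Integration by parts: the derivative of φ(x)e^{sx} has integral zero. Iterating it trades
smoothness of φ for decay in s. -/
theorem testTransform_deriv {φ : ℝ → ℂ} (hφ : ContDiff ℝ 1 φ) (hs : HasCompactSupport φ) (s : ℂ) :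
    testTransform (deriv φ) s = -s * testTransform φ s := by
  have hd : ∀ x : ℝ, HasDerivAt (fun x : ℝ => φ x * Complex.exp (s * x))
      (deriv φ x * Complex.exp (s * x) + s * (φ x * Complex.exp (s * x))) x := by
    intro x
    have h1 := (hφ.differentiable one_ne_zero x).hasDerivAt
    have h2 : HasDerivAt (fun x : ℝ => Complex.exp (s * x)) (Complex.exp (s * x) * s) x := by
      have := ((hasDerivAt_id x).ofReal_comp.const_mul s).cexp
      simpa using this
    refine (h1.fun_mul h2).congr_deriv ?_
    ring
  have hi1 : Integrable (fun x : ℝ => deriv φ x * Complex.exp (s * x)) :=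
    integrable_mul_of_hasCompactSupport (hφ.continuous_deriv le_rfl) hs.deriv (by fun_prop)
  have hi2 : Integrable (fun x : ℝ => φ x * Complex.exp (s * x)) :=
    integrable_mul_of_hasCompactSupport hφ.continuous hs (by fun_prop)
  have h0 := integral_eq_zero_of_hasDerivAt_of_integrable hd (hi1.add (hi2.const_mul s)) hi2
  rw [integral_add hi1 (hi2.const_mul s), integral_const_mul] at h0
  simp only [testTransform]
  linear_combination h0

theorem norm_testTransform_le {φ : ℝ → ℂ} (hφ : Continuous φ) (hs : HasCompactSupport φ)
    {a b : ℝ} (hab : tsupport φ ⊆ Icc a b) (s : ℂ) :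
    ‖testTransform φ s‖ ≤ (∫ x, ‖φ x‖) * (Real.exp (a * s.re) + Real.exp (b * s.re)) := by
  rw [← integral_mul_const]
  refine norm_integral_le_of_norm_le
    ((hφ.integrable_of_hasCompactSupport hs).norm.mul_const _) (ae_of_all _ fun x => ?_)
  rw [norm_mul, Complex.norm_exp]
  have : (s * (x : ℂ)).re = x * s.re := by simp; ring
  rw [this]
  by_cases hx : x ∈ tsupport φ
  · have hx' := hab hx
    gcongr
    rcases le_total 0 s.re with h0 | h0
    · have : Real.exp (x * s.re) ≤ Real.exp (b * s.re) := by gcongr; exact hx'.2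
      linarith [Real.exp_pos (a * s.re)]
    · have : Real.exp (x * s.re) ≤ Real.exp (a * s.re) := by
        apply Real.exp_le_exp.2; nlinarith [hx'.1]
      linarith [Real.exp_pos (b * s.re)]
  · rw [image_eq_zero_of_notMem_tsupport hx]; simp

/-- The transform of a test function decays rapidly on vertical lines. -/
theorem exists_norm_testTransform_le {φ : ℝ → ℂ} (hφ : ContDiff ℝ (⊤ : ℕ∞) φ)
    (hs : HasCompactSupport φ) {a b : ℝ} (hab : tsupport φ ⊆ Icc a b) :
    ∃ A : ℝ, 0 ≤ A ∧ ∀ s : ℂ, ‖testTransform φ s‖ ≤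
      A * (Real.exp (a * s.re) + Real.exp (b * s.re)) / (1 + ‖s‖ ^ 2) ^ 2 := by
  have hφ1 : ∀ n : ℕ, ContDiff ℝ (⊤ : ℕ∞) (deriv^[n] φ) ∧ HasCompactSupport (deriv^[n] φ) ∧
      tsupport (deriv^[n] φ) ⊆ Icc a b ∧ ∀ s, testTransform (deriv^[n] φ) s
        = (-s) ^ n * testTransform φ s := by
    intro n
    induction n with
    | zero => exact ⟨hφ, hs, hab, fun s => by simp⟩
    | succ n ih =>
      obtain ⟨h1, h2, h3, h4⟩ := ih
      rw [Function.iterate_succ']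
      refine ⟨?_, h2.deriv, (closure_minimal (support_deriv_subset (𝕜 := ℝ))
        (isClosed_tsupport _)).trans h3, fun s => ?_⟩
      · exact (contDiff_infty_iff_deriv.1 h1).2
      · simp only [Function.comp]
        rw [testTransform_deriv (h1.of_le (by exact_mod_cast le_top)) h2, h4, pow_succ]
        ring
  -- Four derivatives: against a factor of quadratic growth, decay of order 4 leaves the integrable
  -- 1/(1 + t²).
  obtain ⟨h1, h2, h3, h4⟩ := hφ1 4
  set A0 := ∫ x, ‖φ x‖
  set A4 := ∫ x, ‖deriv^[4] φ x‖
  have hA0 : 0 ≤ A0 := integral_nonneg fun x => norm_nonneg _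
  have hA4 : 0 ≤ A4 := integral_nonneg fun x => norm_nonneg _
  refine ⟨2 * (A0 + A4), by positivity, fun s => ?_⟩
  have b0 := norm_testTransform_le hφ.continuous hs hab s
  have b4 := norm_testTransform_le h1.continuous h2 h3 s
  rw [h4, norm_mul, norm_pow, norm_neg] at b4
  rw [le_div_iff₀ (by positivity)]
  have hpoly : (1 + ‖s‖ ^ 2) ^ 2 ≤ 2 * (1 + ‖s‖ ^ 4) := by nlinarith [sq_nonneg (1 - ‖s‖ ^ 2)]
  calc _ ≤ ‖testTransform φ s‖ * (2 * (1 + ‖s‖ ^ 4)) := by gcongr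
    _ = 2 * (‖testTransform φ s‖ + ‖s‖ ^ 4 * ‖testTransform φ s‖) := by ring
    _ ≤ 2 * (A0 * (Real.exp (a * s.re) + Real.exp (b * s.re))
        + A4 * (Real.exp (a * s.re) + Real.exp (b * s.re))) := by gcongr
    _ = _ := by ring

/-- Products of a function of quadratic growth with the transform of a test function. -/
theorem norm_mul_testTransform_le {z w s : ℂ} {K A B : ℝ} (hK : 0 ≤ K) (hB : 0 ≤ A * B)
    (hz : ‖z‖ ≤ K * (1 + ‖s‖ ^ 2)) (hw : ‖w‖ ≤ A * B / (1 + ‖s‖ ^ 2) ^ 2) :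
    ‖z * w‖ ≤ K * A * B / (1 + s.im ^ 2) := by
  rw [norm_mul]
  have him : s.im ^ 2 ≤ ‖s‖ ^ 2 := by
    rw [Complex.sq_norm, Complex.normSq_apply]; nlinarith
  calc ‖z‖ * ‖w‖ ≤ (K * (1 + ‖s‖ ^ 2)) * (A * B / (1 + ‖s‖ ^ 2) ^ 2) := by gcongr
    _ = K * (A * B) / (1 + ‖s‖ ^ 2) := by field_simp
    _ ≤ K * (A * B) / (1 + s.im ^ 2) := by gcongr
    _ = _ := by ring

/-- Inversion of the bilateral transform on a vertical line. -/
theorem integral_exp_mul_testTransform {φ : ℝ → ℂ} (hφ : ContDiff ℝ (⊤ : ℕ∞) φ)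
    (hs : HasCompactSupport φ) (c ω : ℝ) :
    ∫ t : ℝ, Complex.exp (-(c + t * Complex.I) * ω) * testTransform φ (c + t * Complex.I)
      = 2 * Real.pi * φ ω := by
  -- With the weight e^{cx} the transform on Re s = c becomes a Fourier transform, with t = -2πv.
  -- Since ψ is a Schwartz function, its Fourier transform is integrable and inversion applies.
  let ψ : ℝ → ℂ := fun x => φ x * Complex.exp (c * x)
  have hψc : ContDiff ℝ (⊤ : ℕ∞) ψ := by
    refine hφ.mul ?_
    exact (contDiff_const.mul Complex.ofRealCLM.contDiff).cexp
  have hψs : HasCompactSupport ψ := hs.mul_right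
  let Ψ : SchwartzMap ℝ ℂ := hψs.toSchwartzMap hψc
  have hinv : FourierTransformInv.fourierInv (FourierTransform.fourier ψ) = ψ := by
    refine Continuous.fourierInv_fourier_eq hψc.continuous
      (hψc.continuous.integrable_of_hasCompactSupport hψs) ?_
    exact (FourierTransform.fourier Ψ).integrable
  have hF : ∀ v : ℝ, FourierTransform.fourier ψ v
      = testTransform φ (c + (-(2 * Real.pi * v) : ℝ) * Complex.I) := by
    intro v
    rw [Real.fourier_real_eq_integral_exp_smul]
    refine integral_congr_ae (ae_of_all _ fun x => ?_)
    simp only [ψ, smul_eq_mul]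
    rw [mul_left_comm, ← Complex.exp_add]
    push_cast
    ring_nf
  have h1 := congrFun hinv ω
  rw [Real.fourierInv_eq'] at h1
  simp only [hF] at h1
  have h2 := Measure.integral_comp_mul_left (fun t : ℝ => Complex.exp (-(t * ω : ℝ) * Complex.I)
    * testTransform φ (c + t * Complex.I)) (-(2 * Real.pi))
  have h3 : ∫ t : ℝ, Complex.exp (-(t * ω : ℝ) * Complex.I) * testTransform φ (c + t * Complex.I)
      = 2 * Real.pi * ψ ω := by
    rw [← h1]
    have h4 : (∫ v : ℝ, Complex.exp ((2 * Real.pi * inner ℝ v ω : ℝ) * Complex.I) •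
        testTransform φ (c + (-(2 * Real.pi * v) : ℝ) * Complex.I))
        = ∫ x : ℝ, (fun t : ℝ => Complex.exp (-(t * ω : ℝ) * Complex.I)
    * testTransform φ (c + t * Complex.I)) (-(2 * Real.pi) * x) := by
      refine integral_congr_ae (ae_of_all _ fun x => ?_)
      simp only [smul_eq_mul]
      congr 2
      · simp; ring
      · push_cast; ring_nf
    rw [h4, h2]
    have : |(-(2 * Real.pi))⁻¹| = (2 * Real.pi)⁻¹ := by
      rw [abs_inv, abs_neg, abs_of_pos (by positivity)]
    rw [this, Complex.real_smul, Complex.ofReal_inv, Complex.ofReal_mul, Complex.ofReal_ofNat,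
      ← mul_assoc, mul_inv_cancel₀ (by simp [Real.pi_ne_zero]), one_mul]
  have h5 : ∀ t : ℝ, Complex.exp (-(c + t * Complex.I) * ω) * testTransform φ (c + t * Complex.I)
      = Complex.exp (-(c * ω)) * (Complex.exp (-(t * ω : ℝ) * Complex.I)
        * testTransform φ (c + t * Complex.I)) := by
    intro t
    rw [← mul_assoc, ← Complex.exp_add]
    push_cast
    ring_nf
  simp_rw [h5]
  rw [integral_const_mul, h3]
  simp only [ψ]
  have : Complex.exp (-(c * ω)) * Complex.exp (c * ω) = 1 := by
    rw [← Complex.exp_add]; simp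
  linear_combination (2 * Real.pi * φ ω) * this

/-- Pairing the truncated contour integral with a test function. -/
theorem integral_mul_contourIntegral {φ : ℝ → ℂ} (hφ : Continuous φ) (hs : HasCompactSupport φ)
    {L : ℂ → ℂ} {c : ℝ} (hL : Continuous fun t : ℝ => L (c + t * Complex.I)) (T : ℝ) :
    ∫ ω, φ ω * contourIntegral L c T ω
      = (2 * Real.pi : ℂ)⁻¹ * ∫ t in (-T)..T, L (c + t * Complex.I)
        * testTransform φ (c + t * Complex.I) := by
  have h1 : ∀ ω : ℝ, φ ω * contourIntegral L c T ω = (2 * Real.pi : ℂ)⁻¹ *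
      ∫ t in (-T)..T, φ ω * Complex.exp ((c + t * Complex.I) * ω) * L (c + t * Complex.I) := by
    intro ω
    rw [contourIntegral, intervalIntegral.integral_mul_const]
    simp_rw [mul_assoc (φ ω)]
    rw [intervalIntegral.integral_const_mul]
    have hI : (2 * (Real.pi : ℂ) * Complex.I)⁻¹ * Complex.I = (2 * (Real.pi : ℂ))⁻¹ := by
      field_simp
    linear_combination (φ ω * ∫ t in (-T)..T, Complex.exp ((c + t * Complex.I) * ω)
      * L (c + t * Complex.I)) * hI
  simp_rw [h1]
  rw [integral_const_mul]
  congr 1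
  have hint : ∀ (ν : Measure ℝ) [SFinite ν], Integrable (fun t : ℝ => L (c + t * Complex.I)) ν →
      Integrable (Function.uncurry fun (ω t : ℝ) =>
      φ ω * Complex.exp ((c + t * Complex.I) * ω) * L (c + t * Complex.I)) (volume.prod ν) := by
    intro ν _ hν
    -- For Fubini the integrand splits into a product function, φ(ω)e^{cω} times L(c + it), and the
    -- unimodular factor e^{itω}.
    have h2 := (integrable_mul_of_hasCompactSupport hφ hs (k := fun x : ℝ => Complex.exp (c * x))
      (by fun_prop)).mul_prod hν
    have h3 := h2.bdd_mul (c := 1) (f := fun p : ℝ × ℝ => Complex.exp (p.2 * p.1 * Complex.I))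
      (Continuous.aestronglyMeasurable (by fun_prop)) (ae_of_all _ fun p => by
        rw [Complex.norm_exp]; simp)
    refine h3.congr (ae_of_all _ fun p => ?_)
    simp only [Function.uncurry]
    rw [add_mul, Complex.exp_add]
    ring_nf
  have hLi : ∀ a b : ℝ, IntegrableOn (fun t : ℝ => L (c + t * Complex.I)) (Ioc a b) :=
    fun a b => (hL.integrableOn_Icc).mono_set Ioc_subset_Icc_self
  have hsw : ∀ a b : ℝ, ∫ ω, ∫ t in Ioc a b, φ ω * Complex.exp ((c + t * Complex.I) * ω)
      * L (c + t * Complex.I) = ∫ t in Ioc a b, L (c + t * Complex.I)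
        * testTransform φ (c + t * Complex.I) := by
    intro a b
    rw [integral_integral_swap (hint _ (hLi a b))]
    refine integral_congr_ae (ae_of_all _ fun t => ?_)
    simp only
    rw [integral_mul_const, testTransform, mul_comm]
  simp only [intervalIntegral]
  rw [integral_sub, hsw, hsw]
  · exact (hint _ (hLi (-T) T)).integral_prod_left
  · exact (hint _ (hLi T (-T))).integral_prod_left

/-! ### Energy windows and the exponent of the Poisson law -/

theorem measurableSet_window (U : EReal) : MeasurableSet (window U) :=
  measurableSet_Ioi.inter (measurableSet_lt measurable_coe_real_ereal measurable_const)

theorem window_top : window ⊤ = Ioi (0 : ℝ) := by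
  ext ω; simp [window, EReal.coe_lt_top]

theorem window_subset (U : EReal) : window U ⊆ Ioi (0 : ℝ) := fun _ h => h.1

/-- The exponent `∫₀^∞ f(ω) (e^{-sω} - 1) dω`. -/
noncomputable def levyExponent (f : ℝ → ℝ) (s : ℂ) : ℂ :=
  ∫ ω in Ioi (0 : ℝ), (f ω : ℂ) * (Complex.exp (-s * ω) - 1)

/-- `f` is the density of the jump measure of the infinitely divisible distribution on `[0, ∞)`
with density `g` and an atom at zero. -/
structure IsLevyPair (f g : ℝ → ℝ) : Prop where
  spectrum : IsSpectrum f
  integrable_min : IntegrableOn (fun ω : ℝ => min 1 ω * f ω) (Ioi 0)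
  nonneg : ∀ ω : ℝ, 0 < ω → 0 ≤ g ω
  integrable : IntegrableOn g (Ioi 0)
  nonEmission_nonneg : 0 ≤ nonEmission g
  exp_eq : ∀ s : ℂ, 0 < s.re → Complex.exp (levyExponent f s) = logArg g ⊤ s

/-- The subtracted 1 gains a factor ω at soft energies, which is why integrability of min(1, ω) f
suffices for the exponent, even when f itself is not integrable at 0. -/
theorem norm_exp_sub_one_le_min {s : ℂ} (hs : 0 ≤ s.re) {ω : ℝ} (hω : 0 < ω) :
    ‖Complex.exp (-s * ω) - 1‖ ≤ (2 + 2 * ‖s‖) * min 1 ω := by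
  have h1 : ‖Complex.exp (-s * ω) - 1‖ ≤ 2 := by
    refine (norm_sub_le _ _).trans ?_
    rw [norm_cexp_neg_mul, norm_one]
    have : Real.exp (-s.re * ω) ≤ 1 := Real.exp_le_one_iff.2 (by nlinarith)
    linarith
  have h2 : ‖Complex.exp (-s * ω) - 1‖ ≤ 2 * ‖s‖ * ω := by
    have hn : ‖-s * (ω : ℂ)‖ = ‖s‖ * ω := by
      rw [norm_mul, norm_neg, Complex.norm_real, Real.norm_of_nonneg hω.le]
    rcases le_total (‖s‖ * ω) 1 with h | h
    · have := Complex.norm_exp_sub_one_le (x := -s * ω) (by rw [hn]; exact h)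
      rw [hn] at this
      linarith
    · linarith
  rcases le_total 1 ω with h | h
  · rw [min_eq_left h]; linarith [norm_nonneg s]
  · rw [min_eq_right h]; nlinarith [norm_nonneg s]

section exponent

variable {f : ℝ → ℝ} (hf : IsSpectrum f)
  (hmin : IntegrableOn (fun ω : ℝ => min 1 ω * f ω) (Ioi 0))
include hf hmin

theorem integrable_levyExponent {s : ℂ} (hs : 0 ≤ s.re) :
    IntegrableOn (fun ω : ℝ => (f ω : ℂ) * (Complex.exp (-s * ω) - 1)) (Ioi 0) := by
  refine Integrable.mono' (hmin.const_mul (2 + 2 * ‖s‖)) ?_ ?_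
  · exact (Complex.measurable_ofReal.comp hf.measurable).aestronglyMeasurable.mul
      (Continuous.aestronglyMeasurable (by fun_prop))
  · refine (ae_restrict_iff' measurableSet_Ioi).2 (ae_of_all _ fun ω hω => ?_)
    rw [norm_mul, Complex.norm_real, Real.norm_of_nonneg (hf.nonneg ω hω)]
    have := mul_le_mul_of_nonneg_left (norm_exp_sub_one_le_min hs hω) (hf.nonneg ω hω)
    linarith

theorem norm_levyExponent_le {s : ℂ} (hs : 0 ≤ s.re) :
    ‖levyExponent f s‖ ≤ (∫ ω in Ioi (0 : ℝ), min 1 ω * f ω) * (2 + 2 * ‖s‖) := by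
  rw [← integral_mul_const]
  refine norm_integral_le_of_norm_le (hmin.mul_const _) ?_
  refine (ae_restrict_iff' measurableSet_Ioi).2 (ae_of_all _ fun ω hω => ?_)
  rw [norm_mul, Complex.norm_real, Real.norm_of_nonneg (hf.nonneg ω hω)]
  have := mul_le_mul_of_nonneg_left (norm_exp_sub_one_le_min hs hω) (hf.nonneg ω hω)
  linarith

omit hmin in
theorem integral_min_nonneg : 0 ≤ ∫ ω in Ioi (0 : ℝ), min 1 ω * f ω :=
  setIntegral_nonneg measurableSet_Ioi fun ω hω =>
    mul_nonneg (le_min zero_le_one (le_of_lt hω)) (hf.nonneg ω hω)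

theorem differentiableOn_levyExponent :
    DifferentiableOn ℂ (levyExponent f) {s : ℂ | 0 < s.re} := by
  refine differentiableOn_laplace
    (Complex.measurable_ofReal.comp hf.measurable).aestronglyMeasurable
    (fun s hs => integrable_levyExponent hf hmin hs.le) fun c hc => ?_
  refine Integrable.mono' (hmin.const_mul (1 + 1 / c)) ?_ ?_
  · exact ((continuous_abs.aestronglyMeasurable).mul
      (Complex.measurable_ofReal.comp hf.measurable).aestronglyMeasurable.norm).mul
      (Continuous.aestronglyMeasurable (by fun_prop))
  · refine (ae_restrict_iff' measurableSet_Ioi).2 (ae_of_all _ fun ω hω => ?_)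
    have hω : 0 < ω := hω
    have hfω := hf.nonneg ω hω
    rw [Complex.norm_real, Real.norm_of_nonneg hfω, abs_of_pos hω,
      Real.norm_of_nonneg (by positivity)]
    have h1 : Real.exp (-c * ω) ≤ 1 := Real.exp_le_one_iff.2 (by nlinarith)
    have h2 : ω * Real.exp (-c * ω) ≤ 1 / c := by
      have h3 := Real.add_one_le_exp (c * ω)
      have h4 : Real.exp (-c * ω) * Real.exp (c * ω) = 1 := by rw [← Real.exp_add]; simp
      rw [le_div_iff₀ hc]
      nlinarith [Real.exp_pos (-c * ω)]
    have h5 : ω * Real.exp (-c * ω) ≤ (1 + 1 / c) * min 1 ω := by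
      have : 0 < 1 / c := by positivity
      rcases le_total 1 ω with h | h
      · rw [min_eq_left h]; linarith
      · rw [min_eq_right h]; nlinarith
    calc ω * f ω * Real.exp (-c * ω) = f ω * (ω * Real.exp (-c * ω)) := by ring
      _ ≤ f ω * ((1 + 1 / c) * min 1 ω) := by gcongr
      _ = _ := by ring

omit hf hmin in
theorem levyExponent_ofReal (x : ℝ) : levyExponent f x
    = ((∫ ω in Ioi (0 : ℝ), f ω * (Real.exp (-x * ω) - 1) : ℝ) : ℂ) := by
  rw [levyExponent, ← integral_complex_ofReal]
  refine integral_congr_ae (ae_of_all _ fun ω => ?_)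
  push_cast
  rfl

/-- Sublinearity keeps exp E(x) above e^{-ηx} for every η > 0 and all large x. Hence an
exponentially small absolute error in Z is still exponentially small relative to Z. For x ≥ 1 the
quotient is dominated through (1 - e^{-xω})/x ≤ min(1, ω). -/
theorem tendsto_levyExponent_div : Tendsto
    (fun x : ℝ => (∫ ω in Ioi (0 : ℝ), f ω * (Real.exp (-x * ω) - 1)) / x) atTop (𝓝 0) := by
  have h : Tendsto (fun x : ℝ => ∫ ω in Ioi (0 : ℝ), f ω * (Real.exp (-x * ω) - 1) / x)
      atTop (𝓝 (∫ ω in Ioi (0 : ℝ), (0 : ℝ))) := by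
    refine tendsto_integral_filter_of_dominated_convergence (fun ω => min 1 ω * f ω) ?_ ?_ hmin ?_
    · exact Eventually.of_forall fun x => (hf.measurable.aestronglyMeasurable.mul
        (Continuous.aestronglyMeasurable (by fun_prop))).mul
          (aestronglyMeasurable_const (b := x⁻¹))
    · filter_upwards [eventually_ge_atTop 1] with x hx
      refine (ae_restrict_iff' measurableSet_Ioi).2 (ae_of_all _ fun ω hω => ?_)
      have hω : 0 < ω := hω
      have hfω := hf.nonneg ω hω
      have h1 : Real.exp (-x * ω) ≤ 1 := Real.exp_le_one_iff.2 (by nlinarith)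
      have h2 := Real.add_one_le_exp (-x * ω)
      have hx0 : 0 < x := by linarith
      rw [mul_div_assoc, norm_mul, Real.norm_of_nonneg hfω, mul_comm]
      gcongr
      rw [norm_div, Real.norm_of_nonneg hx0.le, Real.norm_of_nonpos (by linarith),
        div_le_iff₀ hx0]
      have := Real.exp_pos (-x * ω)
      rcases le_total 1 ω with h | h
      · rw [min_eq_left h]; nlinarith
      · rw [min_eq_right h]; nlinarith
    · refine (ae_restrict_iff' measurableSet_Ioi).2 (ae_of_all _ fun ω hω => ?_)
      have hω : 0 < ω := hω
      have : Tendsto (fun x : ℝ => f ω * (Real.exp (-(x * ω)) - 1)) atTop (𝓝 (f ω * (0 - 1))) :=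
        ((Real.tendsto_exp_neg_atTop_nhds_zero.comp
          (tendsto_id.atTop_mul_const hω)).sub_const 1).const_mul _
      simpa using this.div_atTop tendsto_id
  simpa [integral_div] using h

/-- Inversion of the exponent against a test function. -/
theorem integral_levyExponent_mul_testTransform {φ : ℝ → ℂ} (hφ : ContDiff ℝ (⊤ : ℕ∞) φ)
    (hs : HasCompactSupport φ) {c : ℝ} (hc : 0 < c) :
    ∫ t : ℝ, levyExponent f (c + t * Complex.I) * testTransform φ (c + t * Complex.I)
      = 2 * Real.pi * ∫ ω in Ioi (0 : ℝ), (f ω : ℂ) * (φ ω - φ 0) := by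
  obtain ⟨R, hR⟩ := hs.isCompact.isBounded.subset_closedBall 0
  rw [Real.closedBall_eq_Icc] at hR
  obtain ⟨A, hA0, hA⟩ := exists_norm_testTransform_le hφ hs hR
  have hΦc : Continuous fun t : ℝ => testTransform φ (c + t * Complex.I) :=
    (differentiable_testTransform hφ.continuous hs (c - 1)).continuousOn.comp_continuous
      (by fun_prop) (fun t => by simp)
  set B := A * (Real.exp ((0 - R) * c) + Real.exp ((0 + R) * c)) with hB
  have hB0 : 0 ≤ B := by positivity
  have hΦi : Integrable (fun t : ℝ => (2 + 2 * ‖(c + t * Complex.I : ℂ)‖) *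
      ‖testTransform φ (c + t * Complex.I)‖) := by
    refine Integrable.mono' (integrable_inv_one_add_sq.const_mul (4 * B))
      (Continuous.aestronglyMeasurable (by fun_prop)) (ae_of_all _ fun t => ?_)
    set s : ℂ := c + t * Complex.I with hsdef
    rw [Real.norm_of_nonneg (by positivity)]
    have h1 := hA s
    have hre : s.re = c := by simp [hsdef]
    have him : s.im = t := by simp [hsdef]
    rw [hre, ← hB] at h1
    have him : t ^ 2 ≤ ‖s‖ ^ 2 := by
      rw [Complex.sq_norm, Complex.normSq_apply, him]; nlinarith
    calc (2 + 2 * ‖s‖) * ‖testTransform φ s‖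
        ≤ (4 * (1 + ‖s‖ ^ 2)) * (B / (1 + ‖s‖ ^ 2) ^ 2) := by
          gcongr; nlinarith [sq_nonneg (‖s‖ - 1)]
      _ = 4 * B * (1 + ‖s‖ ^ 2)⁻¹ := by field_simp
      _ ≤ 4 * B * (1 + t ^ 2)⁻¹ := by gcongr
  have hΦi' : Integrable (fun t : ℝ => testTransform φ (c + t * Complex.I)) := by
    refine Integrable.mono' hΦi hΦc.aestronglyMeasurable (ae_of_all _ fun t => ?_)
    have := norm_nonneg (testTransform φ (c + t * Complex.I))
    have := norm_nonneg (c + t * Complex.I : ℂ)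
    nlinarith
  -- The majorant separates into (2 + 2‖s‖)‖Φ(s)‖ on the contour, Φ being the transform of φ, and
  -- min(1, ω) f(ω) in energy.
  have hsw : Integrable (Function.uncurry fun (t ω : ℝ) => (f ω : ℂ) *
      (Complex.exp (-(c + t * Complex.I) * ω) - 1) * testTransform φ (c + t * Complex.I))
      (volume.prod (volume.restrict (Ioi (0 : ℝ)))) := by
    refine Integrable.mono' (hΦi.mul_prod hmin) ?_ ?_
    · refine AEStronglyMeasurable.mul (AEStronglyMeasurable.mul ?_ ?_) ?_
      · exact (Complex.measurable_ofReal.comp (hf.measurable.comp measurable_snd)).aestronglyMeasurable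
      · exact Continuous.aestronglyMeasurable (by fun_prop)
      · exact (hΦc.comp continuous_fst).aestronglyMeasurable
    · have : ∀ᵐ p : ℝ × ℝ ∂(volume.prod (volume.restrict (Ioi (0 : ℝ)))), 0 < p.2 := by
        exact Measure.quasiMeasurePreserving_snd.ae (ae_restrict_mem measurableSet_Ioi)
      filter_upwards [this] with p hp
      have hfω := hf.nonneg p.2 hp
      simp only [Function.uncurry]
      rw [norm_mul, norm_mul, Complex.norm_real, Real.norm_of_nonneg hfω]
      have h1 := norm_exp_sub_one_le_min (s := c + p.1 * Complex.I) (by simpa using hc.le) hp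
      calc _ ≤ f p.2 * ((2 + 2 * ‖(c + p.1 * Complex.I : ℂ)‖) * min 1 p.2)
            * ‖testTransform φ (c + p.1 * Complex.I)‖ := by gcongr
        _ = _ := by ring
  simp only [levyExponent]
  simp_rw [← integral_mul_const]
  rw [integral_integral_swap hsw, ← integral_const_mul]
  refine integral_congr_ae (ae_of_all _ fun ω => ?_)
  have hexp : Integrable (fun t : ℝ => Complex.exp (-(c + t * Complex.I) * ω)
      * testTransform φ (c + t * Complex.I)) := by
    refine hΦi'.bdd_mul (c := Real.exp (-c * ω)) (Continuous.aestronglyMeasurable (by fun_prop))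
      (ae_of_all _ fun t => ?_)
    rw [norm_cexp_neg_mul]
    simp
  -- Inversion is used at ω and at 0: the subtracted 1 in the exponent produces φ(0).
  have h1 := integral_exp_mul_testTransform hφ hs c ω
  have h0 := integral_exp_mul_testTransform hφ hs c 0
  simp only [Complex.ofReal_zero, mul_zero, Complex.exp_zero, one_mul] at h0
  calc ∫ t : ℝ, (f ω : ℂ) * (Complex.exp (-(c + t * Complex.I) * ω) - 1)
        * testTransform φ (c + t * Complex.I)
      = ∫ t : ℝ, (f ω : ℂ) * (Complex.exp (-(c + t * Complex.I) * ω)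
        * testTransform φ (c + t * Complex.I) - testTransform φ (c + t * Complex.I)) := by
        refine integral_congr_ae (ae_of_all _ fun t => ?_)
        simp only
        ring
    _ = _ := by
        rw [integral_const_mul, integral_sub hexp hΦi', h1, h0]
        ring

end exponent

/-! ### The argument of the logarithm -/

theorem aestronglyMeasurable_of_laplace {g : ℝ → ℝ} {c₀ : ℝ} {S : Set ℝ}
    (h : IntegrableOn (fun ω : ℝ => g ω * Real.exp (-c₀ * ω)) S) :
    AEStronglyMeasurable g (volume.restrict S) := by
  have h1 : AEStronglyMeasurable (fun ω : ℝ => g ω * Real.exp (-c₀ * ω) * Real.exp (c₀ * ω))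
      (volume.restrict S) :=
    h.aestronglyMeasurable.mul (Continuous.aestronglyMeasurable (by fun_prop))
  refine h1.congr (ae_of_all _ fun ω => ?_)
  simp only
  rw [mul_assoc, ← Real.exp_add]
  simp

theorem integrable_laplace {g : ℝ → ℝ} {c₀ : ℝ} {S : Set ℝ} (hS : MeasurableSet S)
    (hS0 : S ⊆ Ioi 0)
    (h : IntegrableOn (fun ω : ℝ => g ω * Real.exp (-c₀ * ω)) S) {s : ℂ} (hs : c₀ ≤ s.re) :
    IntegrableOn (fun ω : ℝ => (g ω : ℂ) * Complex.exp (-s * ω)) S := by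
  refine Integrable.mono' h.norm ?_ ?_
  · exact (Complex.continuous_ofReal.comp_aestronglyMeasurable
      (aestronglyMeasurable_of_laplace h)).mul (Continuous.aestronglyMeasurable (by fun_prop))
  · refine (ae_restrict_iff' hS).2 (ae_of_all _ fun ω hω => ?_)
    rw [norm_mul, norm_cexp_neg_mul, Complex.norm_real, norm_mul,
      Real.norm_of_nonneg (Real.exp_pos _).le]
    have : 0 < ω := hS0 hω
    gcongr

theorem norm_laplace_le {g : ℝ → ℝ} {c₀ : ℝ} {S : Set ℝ} (hS : MeasurableSet S)
    (hS0 : S ⊆ Ioi 0)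
    (h : IntegrableOn (fun ω : ℝ => g ω * Real.exp (-c₀ * ω)) S) {s : ℂ} (hs : c₀ ≤ s.re) :
    ‖∫ ω in S, (g ω : ℂ) * Complex.exp (-s * ω)‖ ≤ ∫ ω in S, ‖g ω * Real.exp (-c₀ * ω)‖ := by
  refine norm_integral_le_of_norm_le h.norm ?_
  refine (ae_restrict_iff' hS).2 (ae_of_all _ fun ω hω => ?_)
  rw [norm_mul, norm_cexp_neg_mul, Complex.norm_real, norm_mul,
    Real.norm_of_nonneg (Real.exp_pos _).le]
  have : 0 < ω := hS0 hω
  gcongr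

theorem differentiableOn_logArg {g : ℝ → ℝ} {U : EReal} {c₀ : ℝ}
    (h : IntegrableOn (fun ω : ℝ => g ω * Real.exp (-c₀ * ω)) (window U)) :
    DifferentiableOn ℂ (logArg g U) {s : ℂ | c₀ < s.re} := by
  have h1 := differentiableOn_laplace (μ := volume.restrict (window U)) (h := fun ω => (g ω : ℂ))
    (κ := 0) (c₀ := c₀)
    (Complex.continuous_ofReal.comp_aestronglyMeasurable (aestronglyMeasurable_of_laplace h))
    (fun s hs => by
      simp only [sub_zero]
      exact integrable_laplace (measurableSet_window U) (window_subset U) h hs.le)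
    (fun c hc => by
      refine Integrable.mono' (h.norm.const_mul (1 / (c - c₀))) ?_ ?_
      · exact ((continuous_abs.aestronglyMeasurable).mul
          (Complex.continuous_ofReal.comp_aestronglyMeasurable
          (aestronglyMeasurable_of_laplace h)).norm).mul
          (Continuous.aestronglyMeasurable (by fun_prop))
      · refine (ae_restrict_iff' (measurableSet_window U)).2 (ae_of_all _ fun ω hω => ?_)
        have hω : 0 < ω := hω.1
        rw [Complex.norm_real, abs_of_pos hω, Real.norm_of_nonneg (by positivity), norm_mul,
          Real.norm_of_nonneg (Real.exp_pos _).le]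
        have hcc : 0 < c - c₀ := by linarith
        -- The factor ω coming from differentiation is absorbed by the gap c - c₀, since 1 + x ≤
        -- e^x.
        have h2 : ω * Real.exp (-c * ω) ≤ 1 / (c - c₀) * Real.exp (-c₀ * ω) := by
          have h3 := Real.add_one_le_exp ((c - c₀) * ω)
          have h4 : Real.exp (-c * ω) * Real.exp ((c - c₀) * ω) = Real.exp (-c₀ * ω) := by
            rw [← Real.exp_add]; ring_nf
          rw [div_mul_eq_mul_div, le_div_iff₀ hcc, ← h4]
          nlinarith [Real.exp_pos (-c * ω)]
        calc ω * ‖g ω‖ * Real.exp (-c * ω) = ‖g ω‖ * (ω * Real.exp (-c * ω)) := by ring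
          _ ≤ ‖g ω‖ * (1 / (c - c₀) * Real.exp (-c₀ * ω)) := by gcongr
          _ = _ := by ring)
  simp only [sub_zero] at h1
  exact h1.add_const _

theorem logArg_ofReal (g : ℝ → ℝ) (U : EReal) (x : ℝ) : logArg g U x
    = (((∫ ω in window U, g ω * Real.exp (-x * ω)) + nonEmission g : ℝ) : ℂ) := by
  rw [logArg, Complex.ofReal_add, ← integral_complex_ofReal]
  congr 1
  refine integral_congr_ae (ae_of_all _ fun ω => ?_)
  push_cast
  rfl

/-- On the real axis the argument is a sum of nonnegative terms and is nonzero by assumption, hence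
positive there, as the existence of a real branch requires. -/
theorem exists_isLogBranch_logArg {g : ℝ → ℝ} {U : EReal} {c₀ : ℝ}
    (hg : ∀ ω : ℝ, 0 < ω → 0 ≤ g ω) (hW : 0 ≤ nonEmission g)
    (h : SingularitiesLeftOf g U c₀) : ∃ L, IsLogBranch (logArg g U) c₀ L := by
  refine exists_isLogBranch (differentiableOn_logArg h.integrable) h.ne_zero fun x hx => ?_
  refine ⟨_, lt_of_le_of_ne ?_ ?_, logArg_ofReal g U x⟩
  · exact add_nonneg (setIntegral_nonneg (measurableSet_window U) fun ω hω =>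
      mul_nonneg (hg ω hω.1) (Real.exp_pos _).le) hW
  · intro h0
    have := h.ne_zero x (by simpa using hx)
    rw [logArg_ofReal, ← h0] at this
    simp at this

/-- Growth of the branch of the logarithm. -/
theorem exists_norm_isLogBranch_le {g : ℝ → ℝ} {U : EReal} {c₀ : ℝ}
    (h : SingularitiesLeftOf g U c₀) {L : ℂ → ℂ} (hL : IsLogBranch (logArg g U) c₀ L)
    {c : ℝ} (hc : c₀ < c) :
    ∃ K : ℝ, 0 ≤ K ∧ ∀ s : ℂ, c ≤ s.re → ‖L s‖ ≤ K * (1 + ‖s‖ ^ 2) := by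
  refine norm_le_of_re_le (M := (∫ ω in window U, ‖g ω * Real.exp (-c₀ * ω)‖)
    + ‖(nonEmission g : ℂ)‖) hL.differentiableOn (fun s hs => ?_) hc
  -- Since Re L = ln‖Z‖ and Z is bounded, only an upper bound is available; Z may come close to 0.
  -- Borel–Carathéodory needs no more.
  have h1 : Real.exp (L s).re = ‖logArg g U s‖ := by rw [← hL.exp_eq s hs, Complex.norm_exp]
  have h2 := Real.add_one_le_exp (L s).re
  have h3 : ‖logArg g U s‖ ≤ (∫ ω in window U, ‖g ω * Real.exp (-c₀ * ω)‖)
      + ‖(nonEmission g : ℂ)‖ := (norm_add_le _ _).trans (add_le_add_left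
      (norm_laplace_le (measurableSet_window U) (window_subset U) h.integrable hs.le) _)
  linarith

theorem integrableOn_mul_exp_neg {g : ℝ → ℝ} (hg : IntegrableOn g (Ioi 0)) {x : ℝ} (hx : 0 ≤ x) :
    IntegrableOn (fun ω : ℝ => g ω * Real.exp (-x * ω)) (Ioi 0) := by
  refine Integrable.mono' hg.norm
    (hg.aestronglyMeasurable.mul (Continuous.aestronglyMeasurable (by fun_prop))) ?_
  refine (ae_restrict_iff' measurableSet_Ioi).2 (ae_of_all _ fun ω hω => ?_)
  have hω : 0 < ω := hω
  rw [norm_mul, Real.norm_of_nonneg (Real.exp_pos _).le]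
  exact mul_le_of_le_one_right (norm_nonneg _) (Real.exp_le_one_iff.2 (by nlinarith))

/-- On the real axis, the energies above `U` contribute at most `e^{-xV}` for `V ≤ U`. -/
theorem integral_sub_window_le {g : ℝ → ℝ} (hg0 : ∀ ω : ℝ, 0 < ω → 0 ≤ g ω)
    (hg : IntegrableOn g (Ioi 0)) {U : EReal} {V : ℝ} (hV : (V : EReal) ≤ U) {x : ℝ} (hx : 0 ≤ x) :
    0 ≤ (∫ ω in Ioi (0 : ℝ), g ω * Real.exp (-x * ω))
        - (∫ ω in window U, g ω * Real.exp (-x * ω)) ∧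
    (∫ ω in Ioi (0 : ℝ), g ω * Real.exp (-x * ω)) - (∫ ω in window U, g ω * Real.exp (-x * ω))
      ≤ (∫ ω in Ioi (0 : ℝ), g ω) * Real.exp (-V * x) := by
  have hint := integrableOn_mul_exp_neg hg hx
  have hd : (∫ ω in Ioi (0 : ℝ), g ω * Real.exp (-x * ω))
      - (∫ ω in window U, g ω * Real.exp (-x * ω))
      = ∫ ω in Ioi (0 : ℝ) \ window U, g ω * Real.exp (-x * ω) := by
    rw [setIntegral_sdiff (measurableSet_window U) hint (window_subset U)]
  have hm : MeasurableSet (Ioi (0 : ℝ) \ window U) := measurableSet_Ioi.diff (measurableSet_window U)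
  rw [hd]
  refine ⟨setIntegral_nonneg hm fun ω hω => mul_nonneg (hg0 ω hω.1) (Real.exp_pos _).le, ?_⟩
  calc ∫ ω in Ioi (0 : ℝ) \ window U, g ω * Real.exp (-x * ω)
      ≤ ∫ ω in Ioi (0 : ℝ) \ window U, g ω * Real.exp (-V * x) := by
        refine setIntegral_mono_on (hint.mono_set sdiff_subset)
          ((hg.mono_set sdiff_subset).mul_const _) hm fun ω hω => ?_
        refine mul_le_mul_of_nonneg_left (Real.exp_le_exp.2 ?_) (hg0 ω hω.1)
        have h1 : V ≤ ω := by
          by_contra h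
          exact hω.2 ⟨hω.1, lt_of_lt_of_le (by exact_mod_cast not_le.1 h) hV⟩
        nlinarith
    _ ≤ ∫ ω in Ioi (0 : ℝ), g ω * Real.exp (-V * x) := by
        refine setIntegral_mono_set (hg.mul_const _) ?_ sdiff_subset.eventuallyLE
        refine (ae_restrict_iff' measurableSet_Ioi).2 (ae_of_all _ fun ω hω => ?_)
        exact mul_nonneg (hg0 ω hω) (Real.exp_pos _).le
    _ = _ := integral_mul_const _ _

/-! ### The distributional inversion formula -/

section pair

variable {f g : ℝ → ℝ} (h : IsLevyPair f g) {U : EReal} {c₀ : ℝ}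
  (hU : SingularitiesLeftOf g U c₀) {L : ℂ → ℂ} (hL : IsLogBranch (logArg g U) c₀ L)
include h hL

/-- On the real axis the logarithm belonging to the upper limit `U` approaches the exponent
exponentially fast. -/
theorem exists_norm_sub_levyExponent_le {V V' : ℝ} (hV' : 0 < V') (hVV' : V' < V)
    (hV : (V : EReal) ≤ U) :
    ∃ B : ℝ, ∀ᶠ x : ℝ in atTop, ‖L x - levyExponent f x‖ ≤ B * Real.exp (-V' * x) := by
  set G := ∫ ω in Ioi (0 : ℝ), g ω with hG
  have hG0 : 0 ≤ G := setIntegral_nonneg measurableSet_Ioi h.nonneg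
  have hlim : Tendsto (fun x : ℝ => G * Real.exp (-V' * x)) atTop (𝓝 0) := by
    have : Tendsto (fun x : ℝ => Real.exp (-(V' * x))) atTop (𝓝 0) :=
      Real.tendsto_exp_neg_atTop_nhds_zero.comp (tendsto_id.const_mul_atTop hV')
    simpa using this.const_mul G
  refine ⟨2 * G, ?_⟩
  filter_upwards [(tendsto_levyExponent_div h.spectrum h.integrable_min).eventually
    (lt_mem_nhds (show -(V - V') < 0 by linarith)), hlim.eventually
    (gt_mem_nhds (show (0 : ℝ) < 1 / 2 by norm_num)), eventually_gt_atTop 0,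
    eventually_gt_atTop c₀] with x hx1 hx2 hx0 hxc
  set e := ∫ ω in Ioi (0 : ℝ), f ω * (Real.exp (-x * ω) - 1)
  -- Sublinearity of the exponent is paid for by the loss from V to V': dividing the tail e^{-Vx} by
  -- exp e costs at most e^{(V-V')x}.
  have he : -(V - V') * x < e := by rwa [lt_div_iff₀ hx0] at hx1
  have hLx := isLogBranch_ofReal hL hxc (logArg_ofReal g U x)
  obtain ⟨ht0, ht1⟩ := integral_sub_window_le h.nonneg h.integrable hV hx0.le
  rw [← hG] at ht1
  have hE := h.exp_eq x (by simpa using hx0)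
  rw [levyExponent_ofReal, logArg_ofReal, window_top, ← Complex.ofReal_exp] at hE
  have hE : Real.exp e = (∫ ω in Ioi (0 : ℝ), g ω * Real.exp (-x * ω)) + nonEmission g := by
    exact_mod_cast hE
  rw [levyExponent_ofReal, hLx.2, ← Complex.ofReal_sub, Complex.norm_real, Real.norm_eq_abs]
  set ZU := (∫ ω in window U, g ω * Real.exp (-x * ω)) + nonEmission g
  have hZU := hLx.1
  have hle : ZU ≤ Real.exp e := by rw [hE]; simp only [ZU]; linarith
  have hlog : Real.log ZU ≤ e := by rw [Real.log_le_iff_le_exp hZU]; exact hle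
  have htail : Real.exp e - ZU ≤ G * Real.exp (-V * x) := by
    rw [hE]; simp only [ZU]; linarith
  have hsplit : Real.exp (-V * x) = Real.exp (-V' * x) * Real.exp (-(V - V') * x) := by
    rw [← Real.exp_add]; ring_nf
  have h1 : Real.exp (-V * x) ≤ Real.exp (-V' * x) * Real.exp e := by
    rw [hsplit]; gcongr
  have h2 : Real.exp e - ZU ≤ (G * Real.exp (-V' * x)) * Real.exp e := by
    refine htail.trans ?_
    rw [mul_assoc]
    gcongr
  -- For large x the relative error is below 1/2, so 1/ZU is controlled by exp e and ln y ≤ y - 1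
  -- bounds the difference of logarithms.
  have h3 : Real.exp e / 2 ≤ ZU := by nlinarith [Real.exp_pos e]
  rw [abs_of_nonpos (by linarith)]
  have h4 : e - Real.log ZU ≤ Real.exp e / ZU - 1 := by
    have := Real.log_le_sub_one_of_pos (show 0 < Real.exp e / ZU by positivity)
    rwa [Real.log_div (Real.exp_pos e).ne' hZU.ne', Real.log_exp] at this
  have h5 : Real.exp e / ZU - 1 ≤ 2 * G * Real.exp (-V' * x) := by
    rw [div_sub_one hZU.ne', div_le_iff₀ hZU]
    have : 0 ≤ G * Real.exp (-V' * x) := by positivity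
    nlinarith
  linarith

include hU

/-- The contour integral of the logarithm, as a distribution on the energies below `U`. -/
theorem tendsto_integral_mul_contourIntegral (hU0 : 0 < U) {c : ℝ} (hc : c₀ < c) {φ : ℝ → ℂ}
    (hφ : ContDiff ℝ (⊤ : ℕ∞) φ) (hs : HasCompactSupport φ)
    (hsU : tsupport φ ⊆ {ω : ℝ | (ω : EReal) < U}) :
    Tendsto (fun T : ℝ => ∫ ω : ℝ, φ ω * contourIntegral L c T ω) atTop
      (𝓝 (∫ ω in Ioi (0 : ℝ), (f ω : ℂ) * (φ ω - φ 0))) := by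
  -- The support lies in [a, b], with room for V' and V between b and U. Adjoining a point x₀ of (0,
  -- U) to the support makes the set nonempty and forces b > 0.
  obtain ⟨a, b, V', V, hab, hab', hb0, hbV', hV'V, hVU⟩ : ∃ a b V' V : ℝ, a ≤ b ∧
      tsupport φ ⊆ Icc a b ∧ 0 < b ∧ b < V' ∧ V' < V ∧ (V : EReal) ≤ U := by
    obtain ⟨x₀, hx₀, hx₀U⟩ := EReal.lt_iff_exists_real_btwn.1 hU0
    have hx₀ : 0 < x₀ := by exact_mod_cast hx₀
    have hK : IsCompact (insert x₀ (tsupport φ)) := hs.isCompact.insert x₀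
    have hne : (insert x₀ (tsupport φ)).Nonempty := ⟨x₀, mem_insert _ _⟩
    obtain ⟨a, -, ha⟩ := hK.exists_isLeast hne
    obtain ⟨b, hbK, hb⟩ := hK.exists_isGreatest hne
    have hbU : (b : EReal) < U := by
      rcases hbK with rfl | hb'
      · exact hx₀U
      · exact hsU hb'
    obtain ⟨V, hbV, hVU⟩ := EReal.lt_iff_exists_real_btwn.1 hbU
    have hbV : b < V := by exact_mod_cast hbV
    have hb0 : x₀ ≤ b := hb (mem_insert _ _)
    refine ⟨a, b, (b + V) / 2, V, (ha (mem_insert _ _)).trans hb0,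
      fun x hx => ⟨ha (mem_insert_of_mem _ hx), hb (mem_insert_of_mem _ hx)⟩, by linarith,
      by linarith, by linarith, hVU.le⟩
  obtain ⟨A, hA0, hA⟩ := exists_norm_testTransform_le hφ hs hab'
  set c₁ := max c₀ 0 with hc₁
  set C := max c c₁ + 1 with hC
  have hcC : c ≤ C := by have := le_max_left c c₁; linarith
  have hc₁C : c₁ < C := by have := le_max_right c c₁; linarith
  have hc₁0 : 0 ≤ c₁ := le_max_right _ _
  have hc₁c₀ : c₀ ≤ c₁ := le_max_left _ _
  have hC0 : 0 < C := by linarith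
  obtain ⟨K, hK0, hK⟩ := exists_norm_isLogBranch_le hU hL hc
  -- the truncated integrals converge
  have hLΦd : DifferentiableOn ℂ (fun s => L s * testTransform φ s) {s : ℂ | c₀ < s.re} :=
    hL.differentiableOn.mul (differentiable_testTransform hφ.continuous hs c₀)
  -- Bounds e^{aσ} + e^{bσ} uniformly for c ≤ σ ≤ C, whatever the signs of a, b and σ.
  set B := Real.exp (|a| * max |c| |C|) + Real.exp (|b| * max |c| |C|) with hB
  have hLΦ : ∀ σ ∈ Icc c C, ∀ t : ℝ, ‖L (σ + t * Complex.I) * testTransform φ (σ + t * Complex.I)‖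
      ≤ K * A * B / (1 + t ^ 2) := by
    intro σ hσ t
    have hσ' : |σ| ≤ max |c| |C| := abs_le_max_abs_abs hσ.1 hσ.2
    have hexp : ∀ a : ℝ, Real.exp (a * σ) ≤ Real.exp (|a| * max |c| |C|) := fun a =>
      Real.exp_le_exp.2 ((le_abs_self _).trans (by rw [abs_mul]; gcongr))
    have := norm_mul_testTransform_le (s := σ + t * Complex.I) hK0
      (show 0 ≤ A * B by positivity) (hK (σ + t * Complex.I) (by simpa using hσ.1))
      ((hA (σ + t * Complex.I)).trans (by
        gcongr
        simp only [Complex.add_re, Complex.ofReal_re, Complex.mul_re, Complex.ofReal_im,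
          Complex.I_re, Complex.I_im, mul_zero, mul_one, sub_self, add_zero, hB]
        exact add_le_add (hexp a) (hexp b)))
    simpa using this
  have hLc : Continuous fun t : ℝ => L (c + t * Complex.I) :=
    hL.differentiableOn.continuousOn.comp_continuous (by fun_prop) fun t => by simpa using hc
  have hlim := (intervalIntegral_tendsto_integral (integrable_vertical
    (F := fun s => L s * testTransform φ s) hLΦd.continuousOn hc
    (hLΦ c ⟨le_rfl, hcC⟩)) tendsto_neg_atTop_atBot tendsto_id).const_mul (2 * Real.pi : ℂ)⁻¹
  simp_rw [integral_mul_contourIntegral hφ.continuous hs hLc]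
  simp only [id] at hlim
  suffices hval : (2 * Real.pi : ℂ)⁻¹ * ∫ t : ℝ, L (c + t * Complex.I)
      * testTransform φ (c + t * Complex.I) = ∫ ω in Ioi (0 : ℝ), (f ω : ℂ) * (φ ω - φ 0) by
    rwa [hval] at hlim
  rw [integral_contour_shift hLΦd hc hcC hLΦ]
  -- the difference to the exponent
  let D : ℂ → ℂ := fun s => L s - levyExponent f s
  have hDd : DifferentiableOn ℂ D {s : ℂ | c₁ < s.re} := by
    refine DifferentiableOn.sub (hL.differentiableOn.mono fun s hs => ?_)
      ((differentiableOn_levyExponent h.spectrum h.integrable_min).mono fun s hs => ?_)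
    · exact lt_of_le_of_lt hc₁c₀ hs
    · exact lt_of_le_of_lt hc₁0 hs
  set I₁ := ∫ ω in Ioi (0 : ℝ), min 1 ω * f ω with hI₁
  have hI₁0 : 0 ≤ I₁ := integral_min_nonneg h.spectrum
  have hE : ∀ s : ℂ, 0 ≤ s.re → ‖levyExponent f s‖ ≤ (4 * I₁) * (1 + ‖s‖ ^ 2) := by
    intro s hs
    refine (norm_levyExponent_le h.spectrum h.integrable_min hs).trans ?_
    rw [← hI₁]
    have : 2 + 2 * ‖s‖ ≤ 4 * (1 + ‖s‖ ^ 2) := by nlinarith [sq_nonneg (‖s‖ - 1)]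
    calc _ ≤ I₁ * (4 * (1 + ‖s‖ ^ 2)) := by gcongr
      _ = _ := by ring
  have hD : ∀ s : ℂ, C ≤ s.re → ‖D s‖ ≤ (K + 4 * I₁) * (1 + ‖s‖ ^ 2) := by
    intro s hs
    refine (norm_sub_le _ _).trans ?_
    rw [add_mul]
    exact add_le_add (hK s (hcC.trans hs)) (hE s (hC0.le.trans hs))
  obtain ⟨K₁, hK₁⟩ := norm_le_exp_of_real_decay (V := V') hDd hc₁C hC0.le hD
    (exists_norm_sub_levyExponent_le h hL (by linarith) hV'V hVU)
  have hK₁' : ∀ s : ℂ, C ≤ s.re → ‖D s‖ ≤ (|K₁| * Real.exp (-V' * s.re)) * (1 + ‖s‖ ^ 2) := by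
    intro s hs
    refine (hK₁ s hs).trans ?_
    rw [mul_right_comm]
    gcongr
    exact le_abs_self _
  have hΦ : ∀ s : ℂ, 0 ≤ s.re → ‖testTransform φ s‖
      ≤ A * (2 * Real.exp (b * s.re)) / (1 + ‖s‖ ^ 2) ^ 2 := by
    intro s hs
    refine (hA s).trans ?_
    gcongr
    have : Real.exp (a * s.re) ≤ Real.exp (b * s.re) := by gcongr
    linarith
  have hDΦd : DifferentiableOn ℂ (fun s => D s * testTransform φ s) {s : ℂ | c₁ < s.re} :=
    hDd.mul (differentiable_testTransform hφ.continuous hs c₁)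
  have hDΦ : ∀ σ : ℝ, C ≤ σ → ∀ t : ℝ, ‖D (σ + t * Complex.I) * testTransform φ (σ + t * Complex.I)‖
      ≤ (|K₁| * Real.exp (-V' * σ)) * A * (2 * Real.exp (b * σ)) / (1 + t ^ 2) := by
    intro σ hσ t
    have hre : (σ + t * Complex.I : ℂ).re = σ := by simp
    have h1 := hK₁' (σ + t * Complex.I) (by rwa [hre])
    have h2 := hΦ (σ + t * Complex.I) (by rw [hre]; linarith)
    rw [hre] at h1 h2
    simpa using norm_mul_testTransform_le (s := σ + t * Complex.I)
      (by positivity) (show 0 ≤ A * (2 * Real.exp (b * σ)) by positivity) h1 h2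
  -- The integral does not depend on the abscissa σ ≥ C, while its bound e^{-(V'-b)σ} tends to 0 as
  -- σ → ∞.
  have hzero : ∫ t : ℝ, D (C + t * Complex.I) * testTransform φ (C + t * Complex.I) = 0 := by
    rw [← norm_le_zero_iff]
    have hbound : ∀ σ : ℝ, C ≤ σ → ‖∫ t : ℝ, D (C + t * Complex.I)
        * testTransform φ (C + t * Complex.I)‖
        ≤ (|K₁| * A * 2 * Real.pi) * Real.exp (-((V' - b) * σ)) := by
      intro σ hσ
      rw [integral_contour_shift (K := |K₁| * A * (2 * Real.exp (b * σ))) hDΦd hc₁C hσ (by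
        intro σ' hσ' t
        refine (hDΦ σ' hσ'.1 t).trans ?_
        have h1 : Real.exp (-V' * σ') ≤ 1 :=
          Real.exp_le_one_iff.2 (by nlinarith [hσ'.1])
        have h2 : Real.exp (b * σ') ≤ Real.exp (b * σ) := by gcongr; exact hσ'.2
        calc _ ≤ (|K₁| * 1) * A * (2 * Real.exp (b * σ)) / (1 + t ^ 2) := by gcongr
          _ = _ := by rw [mul_one])]
      refine (norm_integral_le_of_norm_le (integrable_inv_one_add_sq.const_mul
        ((|K₁| * Real.exp (-V' * σ)) * A * (2 * Real.exp (b * σ)))) (ae_of_all _ fun t => ?_)).trans ?_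
      · simpa [div_eq_mul_inv] using hDΦ σ hσ t
      · rw [integral_const_mul, integral_univ_inv_one_add_sq]
        have : Real.exp (-((V' - b) * σ)) = Real.exp (-V' * σ) * Real.exp (b * σ) := by
          rw [← Real.exp_add]; ring_nf
        rw [this]
        apply le_of_eq; ring
    have hto : Tendsto (fun σ : ℝ => (|K₁| * A * 2 * Real.pi) * Real.exp (-((V' - b) * σ))) atTop
        (𝓝 0) := by
      have : Tendsto (fun σ : ℝ => Real.exp (-((V' - b) * σ))) atTop (𝓝 0) :=
        Real.tendsto_exp_neg_atTop_nhds_zero.comp (tendsto_id.const_mul_atTop (by linarith))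
      simpa using this.const_mul (|K₁| * A * 2 * Real.pi)
    exact ge_of_tendsto hto ((eventually_ge_atTop C).mono hbound)
  have hDi := integrable_vertical (F := fun s => D s * testTransform φ s) hDΦd.continuousOn hc₁C
    (hDΦ C le_rfl)
  have hLi := integrable_vertical (F := fun s => L s * testTransform φ s) hLΦd.continuousOn
    (hc.trans_le hcC) (hLΦ C ⟨hcC, le_rfl⟩)
  have hsub := integral_sub hLi hDi
  have hEint := integral_levyExponent_mul_testTransform h.spectrum h.integrable_min hφ hs hC0
  have hcongr : ∫ t : ℝ, (L (C + t * Complex.I) * testTransform φ (C + t * Complex.I)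
      - D (C + t * Complex.I) * testTransform φ (C + t * Complex.I))
      = ∫ t : ℝ, levyExponent f (C + t * Complex.I) * testTransform φ (C + t * Complex.I) := by
    refine integral_congr_ae (ae_of_all _ fun t => ?_)
    simp only [D]
    ring
  rw [hcongr, hEint, hzero, sub_zero] at hsub
  rw [← hsub, ← mul_assoc, inv_mul_cancel₀ (by simp [Real.pi_ne_zero]), one_mul]

end pair

/-! ### Series of integrable functions -/

theorem tsum_lintegral_enorm_ne_top {F : ℕ → ℝ → ℂ} (hF : ∀ n, Integrable (F n))
    (hs : Summable fun n => ∫ x, ‖F n x‖) : ∑' n, ∫⁻ x, ‖F n x‖ₑ ≠ ⊤ := by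
  have h1 : ∀ n, ∫⁻ x, ‖F n x‖ₑ = ENNReal.ofReal (∫ x, ‖F n x‖) := fun n =>
    (ofReal_integral_norm_eq_lintegral_enorm (hF n)).symm
  simp_rw [h1]
  exact hs.tsum_ofReal_ne_top

theorem ae_summable_norm_of_summable_integral_norm {F : ℕ → ℝ → ℂ} (hF : ∀ n, Integrable (F n))
    (hs : Summable fun n => ∫ x, ‖F n x‖) : ∀ᵐ x, Summable fun n => ‖F n x‖ := by
  have h := tsum_lintegral_enorm_ne_top hF hs
  rw [← lintegral_tsum fun n => (hF n).aestronglyMeasurable.enorm] at h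
  filter_upwards [ae_lt_top' (AEMeasurable.tsum fun n =>
    (hF n).aestronglyMeasurable.enorm) h] with x hx
  exact tsum_enorm_ne_top_iff_summable_norm.1 hx.ne

theorem integrable_tsum_of_summable_integral_norm {F : ℕ → ℝ → ℂ} (hF : ∀ n, Integrable (F n))
    (hs : Summable fun n => ∫ x, ‖F n x‖) : Integrable (fun x => ∑' n, F n x) := by
  have h := tsum_lintegral_enorm_ne_top hF hs
  rw [← lintegral_tsum fun n => (hF n).aestronglyMeasurable.enorm] at h
  have hae := ae_summable_norm_of_summable_integral_norm hF hs
  refine ⟨?_, ?_⟩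
  · refine aestronglyMeasurable_of_tendsto_ae (u := atTop)
      (f := fun (n : ℕ) x => ∑ i ∈ Finset.range n, F i x) (fun n => ?_) ?_
    · exact Finset.aestronglyMeasurable_fun_sum _ fun i _ => (hF i).aestronglyMeasurable
    · filter_upwards [hae] with x hx
      exact hx.of_norm.hasSum.tendsto_sum_nat
  · refine lt_of_le_of_lt (lintegral_mono_ae ?_) h.lt_top
    filter_upwards [hae] with x hx
    exact enorm_tsum_le_tsum_enorm

/-! ### Laplace transforms of self-convolutions -/

/-- The density `h` multiplied by `e^{-sω}`. -/
noncomputable def expWeight (s : ℂ) (h : ℝ → ℝ) (ω : ℝ) : ℂ := (h ω : ℂ) * Complex.exp (-s * ω)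

theorem norm_expWeight (s : ℂ) (h : ℝ → ℝ) (ω : ℝ) :
    ‖expWeight s h ω‖ = |h ω| * Real.exp (-s.re * ω) := by
  rw [expWeight, norm_mul, norm_cexp_neg_mul, Complex.norm_real, Real.norm_eq_abs]

theorem norm_expWeight_congr {s s' : ℂ} (hs : s.re = s'.re) (h : ℝ → ℝ) (ω : ℝ) :
    ‖expWeight s h ω‖ = ‖expWeight s' h ω‖ := by
  rw [norm_expWeight, norm_expWeight, hs]

/-- The weight factors as e^{-sω} = e^{-st}e^{-s(ω-t)}, so weighting is compatible with convolution.
This makes the Laplace transform multiplicative. -/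
theorem expWeight_convolution (s : ℂ) (h k : ℝ → ℝ) :
    expWeight s (MeasureTheory.convolution h k (ContinuousLinearMap.mul ℝ ℝ) volume)
      = MeasureTheory.convolution (expWeight s h) (expWeight s k)
        (ContinuousLinearMap.mul ℝ ℂ) volume := by
  funext ω
  rw [expWeight, convolution_def, convolution_def, ← integral_complex_ofReal, ← integral_mul_const]
  refine integral_congr_ae (ae_of_all _ fun t => ?_)
  simp only [ContinuousLinearMap.mul_apply', expWeight]
  have : Complex.exp (-s * ω) = Complex.exp (-s * t) * Complex.exp (-s * (ω - t : ℝ)) := by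
    rw [← Complex.exp_add]; push_cast; ring_nf
  rw [this]
  push_cast
  ring

theorem expWeight_selfConv {s : ℂ} {h : ℝ → ℝ} (hi : Integrable (expWeight s h)) (n : ℕ) :
    Integrable (expWeight s (selfConv h n)) ∧
      ∫ ω, expWeight s (selfConv h n) ω = (∫ ω, expWeight s h ω) ^ (n + 1) := by
  induction n with
  | zero => exact ⟨hi, by simp [selfConv]⟩
  | succ n ih =>
    rw [selfConv, expWeight_convolution]
    refine ⟨hi.integrable_convolution _ ih.1, ?_⟩
    rw [integral_convolution _ hi ih.1, ih.2, ContinuousLinearMap.mul_apply', pow_succ' _ (n + 1)]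

theorem selfConv_nonneg {h : ℝ → ℝ} (hh : ∀ ω, 0 ≤ h ω) (n : ℕ) (ω : ℝ) : 0 ≤ selfConv h n ω := by
  induction n generalizing ω with
  | zero => exact hh ω
  | succ n ih => exact integral_nonneg fun t => mul_nonneg (hh t) (ih _)

theorem selfConv_eq_zero {h : ℝ → ℝ} (hh : ∀ ω ≤ 0, h ω = 0) (n : ℕ) {ω : ℝ} (hω : ω ≤ 0) :
    selfConv h n ω = 0 := by
  induction n generalizing ω with
  | zero => exact hh ω hω
  | succ n ih =>
    rw [selfConv, convolution_def]
    refine integral_eq_zero_of_ae (ae_of_all _ fun t => ?_)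
    rcases le_or_gt t 0 with ht | ht
    · simp [hh t ht]
    · simp [ih (ω := ω - t) (by linarith)]

/-- The self-convolutions below `U` only depend on the density below `U`. -/
theorem selfConv_cut_eq (g : ℝ → ℝ) (U : EReal) (n : ℕ) {ω : ℝ} (hω : (ω : EReal) < U) :
    selfConv (cut g U) n ω = selfConv (cut g ⊤) n ω := by
  have hcut : ∀ {ω : ℝ}, (ω : EReal) < U → cut g U ω = cut g ⊤ ω := by
    intro ω hω
    by_cases h0 : 0 < ω <;> simp [cut, indicator, window, h0, hω, EReal.coe_lt_top]
  have h0 : ∀ (U : EReal), ∀ ω ≤ 0, cut g U ω = 0 := by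
    intro U ω hω
    simp [cut, indicator, window, not_lt.2 hω]
  induction n generalizing ω with
  | zero => exact hcut hω
  | succ n ih =>
    rw [selfConv, selfConv, convolution_def, convolution_def]
    refine integral_congr_ae (ae_of_all _ fun t => ?_)
    simp only [ContinuousLinearMap.mul_apply']
    -- Both factors vanish at nonpositive arguments, so only 0 < t < ω contributes, and then t and ω
    -- - t are both below U.
    rcases le_or_gt t 0 with ht | ht
    · rw [h0 U t ht, h0 ⊤ t ht, zero_mul, zero_mul]
    rcases le_or_gt (ω - t) 0 with ht' | ht'
    · rw [selfConv_eq_zero (h0 U) n ht', selfConv_eq_zero (h0 ⊤) n ht', mul_zero, mul_zero]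
    · rw [hcut (lt_of_le_of_lt (by exact_mod_cast (by linarith : t ≤ ω)) hω),
        ih (lt_of_le_of_lt (by exact_mod_cast (by linarith : ω - t ≤ ω)) hω)]

/-- A power series in the convolution algebra. -/
noncomputable def convSeries (a : ℕ → ℝ) (h : ℝ → ℝ) (ω : ℝ) : ℝ := ∑' n, a n * selfConv h n ω

theorem expWeight_const_mul (s : ℂ) (a : ℝ) (h : ℝ → ℝ) :
    expWeight s (fun ω => a * h ω) = fun ω => (a : ℂ) * expWeight s h ω := by
  funext ω; simp only [expWeight]; push_cast; ring

section convSeries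

variable {a : ℕ → ℝ} {h : ℝ → ℝ} {s : ℂ} (hh : ∀ ω, 0 ≤ h ω) (hi : Integrable (expWeight s h))
  (hs : Summable fun n => |a n| * (∫ ω, h ω * Real.exp (-s.re * ω)) ^ (n + 1))
include hh hi

/-- For a nonnegative density, absolute values amount to replacing s by Re s, so the weighted L¹
norm is exactly multiplicative under convolution. -/
theorem integral_norm_expWeight_selfConv (n : ℕ) :
    ∫ ω, ‖expWeight s (selfConv h n) ω‖ = (∫ ω, h ω * Real.exp (-s.re * ω)) ^ (n + 1) := by
  have hi' : Integrable (expWeight (s.re : ℂ) h) := by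
    refine (integrable_norm_iff ?_).1 (hi.norm.congr (ae_of_all _ fun ω =>
      norm_expWeight_congr (by simp) h ω))
    have : expWeight (s.re : ℂ) h = fun ω => expWeight s h ω * Complex.exp ((s - s.re) * ω) := by
      funext ω
      rw [expWeight, expWeight, mul_assoc, ← Complex.exp_add]
      ring_nf
    rw [this]
    exact hi.aestronglyMeasurable.mul (Continuous.aestronglyMeasurable (by fun_prop))
  have h1 := (expWeight_selfConv hi' n).2
  have h2 : ∀ (k : ℝ → ℝ), ∫ ω, expWeight (s.re : ℂ) k ω
      = ((∫ ω, k ω * Real.exp (-s.re * ω) : ℝ) : ℂ) := by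
    intro k
    rw [← integral_complex_ofReal]
    refine integral_congr_ae (ae_of_all _ fun ω => ?_)
    simp [expWeight]
  rw [h2, h2] at h1
  have h3 : ∫ ω, selfConv h n ω * Real.exp (-s.re * ω)
      = (∫ ω, h ω * Real.exp (-s.re * ω)) ^ (n + 1) := by exact_mod_cast h1
  rw [← h3]
  refine integral_congr_ae (ae_of_all _ fun ω => ?_)
  simp only
  rw [norm_expWeight, abs_of_nonneg (selfConv_nonneg hh n ω)]

include hs

theorem summable_integral_norm_expWeight :
    Summable fun n => ∫ ω, ‖expWeight s (fun ω => a n * selfConv h n ω) ω‖ := by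
  refine hs.congr fun n => ?_
  rw [expWeight_const_mul]
  simp_rw [norm_mul]
  rw [integral_const_mul, integral_norm_expWeight_selfConv hh hi, Complex.norm_real,
    Real.norm_eq_abs]

omit hh hs in
theorem integrable_expWeight_term (n : ℕ) :
    Integrable (expWeight s (fun ω => a n * selfConv h n ω)) := by
  rw [expWeight_const_mul]
  exact (expWeight_selfConv hi n).1.const_mul _

theorem ae_summable_convSeries : ∀ᵐ ω, Summable fun n => a n * selfConv h n ω := by
  filter_upwards [ae_summable_norm_of_summable_integral_norm (integrable_expWeight_term hi)
    (summable_integral_norm_expWeight hh hi hs)] with ω hω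
  have h1 : Summable fun n => |a n * selfConv h n ω| := by
    refine (hω.mul_right (Real.exp (s.re * ω))).congr fun n => ?_
    rw [norm_expWeight, mul_assoc, ← Real.exp_add]
    simp
  exact h1.of_abs

omit hh hi hs in
theorem expWeight_convSeries_eq (ω : ℝ) : expWeight s (convSeries a h) ω
    = ∑' n, expWeight s (fun ω => a n * selfConv h n ω) ω := by
  simp only [expWeight, convSeries]
  rw [tsum_mul_right, Complex.ofReal_tsum]

theorem integrable_expWeight_convSeries : Integrable (expWeight s (convSeries a h)) := by
  refine (integrable_tsum_of_summable_integral_norm (integrable_expWeight_term hi)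
    (summable_integral_norm_expWeight hh hi hs)).congr (ae_of_all _ fun ω => ?_)
  exact (expWeight_convSeries_eq ω).symm

/-- The transform is multiplicative on convolutions, and summable L¹ norms allow termwise
integration. A power series in the convolution algebra thus becomes the numerical series at the
transform of h; index n carries the power n + 1. -/
theorem hasSum_integral_convSeries :
    HasSum (fun n => (a n : ℂ) * (∫ ω, expWeight s h ω) ^ (n + 1))
      (∫ ω, expWeight s (convSeries a h) ω) := by
  have h1 := hasSum_integral_of_summable_integral_norm (integrable_expWeight_term hi)
    (summable_integral_norm_expWeight hh hi hs)
  simp_rw [expWeight_convSeries_eq]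
  refine h1.congr_fun fun n => ?_
  rw [expWeight_const_mul, integral_const_mul, (expWeight_selfConv hi n).2]

end convSeries

/-! ### Fourier transforms of integrable functions -/

theorem integrable_fourier_kernel {p : ℝ → ℂ} (hp : Integrable p) (v : ℝ) :
    Integrable (fun x : ℝ => Complex.exp ((-2 * Real.pi * x * v : ℝ) * Complex.I) • p x) := by
  refine hp.bdd_mul (c := 1) (f := fun x : ℝ =>
    Complex.exp ((-2 * Real.pi * x * v : ℝ) * Complex.I))
    (Continuous.aestronglyMeasurable (by fun_prop)) (ae_of_all _ fun x => ?_)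
  rw [Complex.norm_exp_ofReal_mul_I]

theorem continuous_fourier {p : ℝ → ℂ} (hp : Integrable p) :
    Continuous (FourierTransform.fourier p) :=
  VectorFourier.fourierIntegral_continuous Real.continuous_fourierChar
    (L := innerₗ ℝ) continuous_inner hp

/-- Every smooth compactly supported function is the Fourier transform of a Schwartz function, and
the multiplication formula moves that transform onto h. -/
theorem ae_eq_zero_of_fourier_eq_zero {h : ℝ → ℂ} (hi : Integrable h)
    (h0 : ∀ v, FourierTransform.fourier h v = 0) : ∀ᵐ x, h x = 0 := by
  refine ae_eq_zero_of_integral_contDiff_smul_eq_zero hi.locallyIntegrable fun g hg hgs => ?_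
  have hgc : ContDiff ℝ (⊤ : ℕ∞) (fun x => (g x : ℂ)) := Complex.ofRealCLM.contDiff.comp hg
  have hgs' : HasCompactSupport (fun x => (g x : ℂ)) :=
    hgs.comp_left (g := ((↑) : ℝ → ℂ)) Complex.ofReal_zero
  let G : SchwartzMap ℝ ℂ := hgs'.toSchwartzMap hgc
  let P : SchwartzMap ℝ ℂ := FourierTransformInv.fourierInv G
  have hP : FourierTransform.fourier P = G := FourierTransform.fourier_fourierInv_eq G
  have hP' : ∀ x, FourierTransform.fourier (P : ℝ → ℂ) x = (g x : ℂ) := by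
    intro x
    rw [← SchwartzMap.fourier_coe, hP]
    rfl
  have hflip := VectorFourier.integral_fourierIntegral_smul_eq_flip (L := innerₗ ℝ)
    (μ := volume) (ν := volume) (f := h) (g := (P : ℝ → ℂ)) Real.continuous_fourierChar
    continuous_inner hi P.integrable
  have h1 : ∀ v, VectorFourier.fourierIntegral Real.fourierChar volume (innerₗ ℝ) h v = 0 := h0
  rw [flip_innerₗ] at hflip
  have h2 : ∀ x, VectorFourier.fourierIntegral Real.fourierChar volume (innerₗ ℝ)
      (P : ℝ → ℂ) x = (g x : ℂ) := hP'
  simp only [h1, h2, zero_smul, integral_zero] at hflip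
  rw [hflip]
  refine integral_congr_ae (ae_of_all _ fun x => ?_)
  simp [mul_comm]

theorem integral_expWeight_eq_fourier (h : ℝ → ℝ) (c t : ℝ) :
    ∫ ω, expWeight (c + t * Complex.I) h ω
      = FourierTransform.fourier (expWeight c h) (t / (2 * Real.pi)) := by
  rw [Real.fourier_real_eq_integral_exp_smul]
  refine integral_congr_ae (ae_of_all _ fun x => ?_)
  simp only [expWeight, smul_eq_mul]
  rw [mul_left_comm, ← Complex.exp_add]
  congr 2
  have : (Real.pi : ℂ) ≠ 0 := by simp [Real.pi_ne_zero]
  push_cast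
  field_simp
  ring

/-- Uniqueness of the Laplace transform on a vertical line. -/
theorem ae_eq_of_integral_expWeight_eq {h k : ℝ → ℝ} {c : ℝ} (hh : Integrable (expWeight c h))
    (hk : Integrable (expWeight c k))
    (heq : ∀ t : ℝ, ∫ ω, expWeight (c + t * Complex.I) h ω
      = ∫ ω, expWeight (c + t * Complex.I) k ω) : ∀ᵐ ω, h ω = k ω := by
  have h0 := ae_eq_zero_of_fourier_eq_zero (hh.sub hk) fun v => by
    have h1 := heq (2 * Real.pi * v)
    rw [integral_expWeight_eq_fourier, integral_expWeight_eq_fourier,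
      mul_div_cancel_left₀ _ (by positivity)] at h1
    rw [Real.fourier_real_eq_integral_exp_smul] at h1 ⊢
    rw [Real.fourier_real_eq_integral_exp_smul] at h1
    simp only [Pi.sub_apply, smul_sub]
    rw [integral_sub (integrable_fourier_kernel hh v) (integrable_fourier_kernel hk v), h1, sub_self]
  filter_upwards [h0] with ω hω
  simp only [Pi.sub_apply, expWeight, ← sub_mul, mul_eq_zero, Complex.exp_ne_zero, or_false] at hω
  exact_mod_cast sub_eq_zero.1 hω

/-- Dini's criterion for Fourier inversion at the origin. -/
theorem tendsto_integral_fourier_of_dini {h : ℝ → ℂ} (hi : Integrable h) {v : ℂ} {δ : ℝ}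
    (hδ : 0 < δ) (hd : IntegrableOn (fun u : ℝ => (h u - v) / u) (Ioo (-δ) δ)) :
    Tendsto (fun R : ℝ => ∫ t in (-R)..R, FourierTransform.fourier h t) atTop (𝓝 v) := by
  -- The Gaussian is its own Fourier transform and has value 1 at 0. Subtracting v G reduces the
  -- claim to limit value zero.
  let G : ℝ → ℂ := fun x => Complex.exp (-Real.pi * x ^ 2)
  have hGF : FourierTransform.fourier G = G := by
    have := fourier_gaussian_pi (b := 1) (by simp)
    simpa [G] using this
  have hGi : Integrable G := by
    have := integrable_cexp_neg_mul_sq (b := Real.pi) (by simpa using Real.pi_pos)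
    simpa [G] using this
  have hG1 : ∫ x, G x = 1 := by
    have := integral_gaussian_complex (b := Real.pi) (by simpa using Real.pi_pos)
    simpa [G, Real.pi_ne_zero] using this
  let p : ℝ → ℂ := fun u => h u - v * G u
  -- Dividing by u is harmless: near 0 by Dini's condition and the smoothness of G, away from 0
  -- because p is integrable.
  let q : ℝ → ℂ := fun u => p u / u
  have hpi : Integrable p := hi.sub (hGi.const_mul v)
  have hqm : AEStronglyMeasurable q :=
    hpi.aestronglyMeasurable.div₀ Complex.continuous_ofReal.aestronglyMeasurable
  have hq1 : IntegrableOn q (Ioo (-δ) δ) := by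
    have h2 : IntegrableOn (fun u : ℝ => v * ((1 - G u) / u)) (Ioo (-δ) δ) := by
      refine Integrable.const_mul ?_ v
      refine Measure.integrableOn_of_bounded (M := Real.pi * δ) measure_Ioo_lt_top.ne ?_ ?_
      · exact (Continuous.aestronglyMeasurable (by fun_prop)).div₀
          Complex.continuous_ofReal.aestronglyMeasurable
      · refine (ae_restrict_iff' measurableSet_Ioo).2 (ae_of_all _ fun u hu => ?_)
        have hu' : |u| ≤ δ := abs_le.2 ⟨hu.1.le, hu.2.le⟩
        have hG : G u = (Real.exp (-Real.pi * u ^ 2) : ℝ) := by simp [G]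
        have h3 : Real.exp (-Real.pi * u ^ 2) ≤ 1 :=
          Real.exp_le_one_iff.2 (by have := Real.pi_pos; nlinarith [sq_nonneg u])
        have h4 := Real.add_one_le_exp (-Real.pi * u ^ 2)
        rw [norm_div, hG, ← Complex.ofReal_one, ← Complex.ofReal_sub, Complex.norm_real,
          Complex.norm_real, Real.norm_of_nonneg (by linarith), Real.norm_eq_abs]
        refine div_le_of_le_mul₀ (abs_nonneg u) (by have := Real.pi_pos; positivity) ?_
        have h5 : u ^ 2 ≤ δ * |u| := by rw [← sq_abs]; nlinarith [abs_nonneg u]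
        have := Real.pi_pos
        nlinarith
    refine (hd.add h2).congr (ae_of_all _ fun u => ?_)
    simp only [q, p, Pi.add_apply]
    ring
  have hq2 : IntegrableOn q (Ioo (-δ) δ)ᶜ := by
    refine Integrable.mono' ((hpi.norm.const_mul (1 / δ)).integrableOn) hqm.restrict ?_
    refine (ae_restrict_iff' measurableSet_Ioo.compl).2 (ae_of_all _ fun u hu => ?_)
    have hu' : δ ≤ |u| := by
      by_contra hcon
      exact hu (abs_lt.1 (not_le.1 hcon))
    simp only [q]
    rw [norm_div, Complex.norm_real, Real.norm_eq_abs, one_div_mul_eq_div]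
    gcongr
  have hqi : Integrable q := by
    rw [← integrableOn_univ, ← union_compl_self (Ioo (-δ) δ)]
    exact hq1.union hq2
  have hqp : ∀ᵐ u : ℝ, (u : ℂ) * q u = p u := by
    have : ∀ᵐ u : ℝ, u ≠ 0 := by simp [ae_iff]
    filter_upwards [this] with u hu
    exact mul_div_cancel₀ _ (by exact_mod_cast hu)
  have hxq : Integrable (fun x : ℝ => x • q x) := by
    refine hpi.congr ?_
    filter_upwards [hqp] with u hu
    rw [Complex.real_smul, hu]
  -- Up to a constant, the transform of p is the derivative of the transform of q. The truncated
  -- integral is then a boundary difference, which vanishes in the limit by Riemann–Lebesgue.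
  have hder : ∀ w : ℝ, HasDerivAt (FourierTransform.fourier q)
      ((-2 * Real.pi * Complex.I) * FourierTransform.fourier p w) w := by
    intro w
    refine (Real.hasDerivAt_fourier hqi hxq w).congr_deriv ?_
    rw [Real.fourier_real_eq_integral_exp_smul, Real.fourier_real_eq_integral_exp_smul,
      ← integral_const_mul]
    refine integral_congr_ae ?_
    filter_upwards [hqp] with u hu
    rw [← hu]
    simp only [smul_eq_mul]
    ring
  have hpint : ∀ R : ℝ, ∫ t in (-R)..R, FourierTransform.fourier p t
      = (-2 * Real.pi * Complex.I)⁻¹ *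
        (FourierTransform.fourier q R - FourierTransform.fourier q (-R)) := by
    intro R
    rw [← intervalIntegral.integral_eq_sub_of_hasDerivAt (fun w _ => hder w)
      ((continuous_const.mul (continuous_fourier hpi)).intervalIntegrable _ _), intervalIntegral.integral_const_mul,
      inv_mul_cancel_left₀ (by simp [Real.pi_ne_zero])]
  have hRL := Real.zero_at_infty_fourier q
  have hp0 : Tendsto (fun R : ℝ => ∫ t in (-R)..R, FourierTransform.fourier p t) atTop (𝓝 0) := by
    simp_rw [hpint]
    have h1 := hRL.mono_left (atTop_le_cocompact (α := ℝ))
    have h2 := (hRL.mono_left (atBot_le_cocompact (α := ℝ))).comp tendsto_neg_atTop_atBot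
    simpa using (h1.sub h2).const_mul (-2 * Real.pi * Complex.I)⁻¹
  have hGlim : Tendsto (fun R : ℝ => ∫ t in (-R)..R, FourierTransform.fourier G t) atTop (𝓝 1) := by
    rw [hGF, ← hG1]
    exact intervalIntegral_tendsto_integral hGi tendsto_neg_atTop_atBot tendsto_id
  have hsum : ∀ t, FourierTransform.fourier h t
      = FourierTransform.fourier p t + v * FourierTransform.fourier G t := by
    intro t
    simp only [Real.fourier_real_eq_integral_exp_smul]
    rw [← integral_const_mul, ← integral_add (integrable_fourier_kernel hpi t)
      ((integrable_fourier_kernel hGi t).const_mul v)]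
    refine integral_congr_ae (ae_of_all _ fun x => ?_)
    simp only [p, smul_eq_mul]
    ring
  simp_rw [hsum]
  have : ∀ R : ℝ, ∫ t in (-R)..R, (FourierTransform.fourier p t
      + v * FourierTransform.fourier G t) = (∫ t in (-R)..R, FourierTransform.fourier p t)
      + v * ∫ t in (-R)..R, FourierTransform.fourier G t := by
    intro R
    rw [intervalIntegral.integral_add ((continuous_fourier hpi).intervalIntegrable _ _)
      (((continuous_fourier hGi).intervalIntegrable _ _).const_mul v),
      intervalIntegral.integral_const_mul]
  simp_rw [this]
  simpa using hp0.add (hGlim.const_mul v)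

/-- Dini's criterion for inversion of the Laplace transform on a vertical line. -/
theorem tendsto_integral_laplace_of_dini {k : ℝ → ℝ} {c ω₁ v : ℝ} (hi : Integrable (expWeight c k))
    {δ : ℝ} (hδ : 0 < δ)
    (hd : IntegrableOn (fun u : ℝ => (k (ω₁ + u) * Real.exp (-c * (ω₁ + u))
      - v * Real.exp (-c * ω₁)) / u) (Ioo (-δ) δ)) :
    Tendsto (fun T : ℝ => (2 * Real.pi : ℂ)⁻¹ * ∫ t in (-T)..T,
      Complex.exp ((c + t * Complex.I) * ω₁) * ∫ ω, expWeight (c + t * Complex.I) k ω)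
      atTop (𝓝 v) := by
  have h1 := tendsto_integral_fourier_of_dini (h := fun u => expWeight c k (ω₁ + u))
    (v := (v * Real.exp (-c * ω₁) : ℝ)) (hi.comp_add_left ω₁) hδ (by
      refine hd.ofReal.congr (ae_of_all _ fun u => ?_)
      simp [expWeight])
  have hF : ∀ w : ℝ, FourierTransform.fourier (fun u => expWeight c k (ω₁ + u)) w
      = Complex.exp (2 * Real.pi * w * ω₁ * Complex.I) * FourierTransform.fourier (expWeight c k) w := by
    intro w
    simp only [Real.fourier_real_eq_integral_exp_smul]
    rw [← integral_const_mul]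
    conv_rhs => rw [← integral_add_left_eq_self _ ω₁]
    refine integral_congr_ae (ae_of_all _ fun x => ?_)
    simp only [smul_eq_mul]
    rw [← mul_assoc, ← Complex.exp_add]
    push_cast
    ring_nf
  have hR : Tendsto (fun T : ℝ => T / (2 * Real.pi)) atTop atTop :=
    tendsto_id.atTop_div_const (by positivity)
  have h2 := (h1.comp hR).const_mul (Complex.exp (c * ω₁))
  have hv : Complex.exp (c * ω₁) * ((v * Real.exp (-c * ω₁) : ℝ) : ℂ) = v := by
    push_cast
    rw [mul_left_comm, ← Complex.exp_add]
    simp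
  rw [hv] at h2
  refine h2.congr fun T => ?_
  simp only [Function.comp]
  have hsub := intervalIntegral.integral_comp_div (a := -T) (b := T)
    (fun w => FourierTransform.fourier (fun u => expWeight c k (ω₁ + u)) w)
    (show (2 * Real.pi) ≠ 0 by positivity)
  have h3 : ∫ t in (-T)..T, Complex.exp ((c + t * Complex.I) * ω₁)
      * ∫ ω, expWeight (c + t * Complex.I) k ω
      = Complex.exp (c * ω₁) * ∫ t in (-T)..T,
        FourierTransform.fourier (fun u => expWeight c k (ω₁ + u)) (t / (2 * Real.pi)) := by
    rw [← intervalIntegral.integral_const_mul]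
    refine intervalIntegral.integral_congr fun t _ => ?_
    rw [integral_expWeight_eq_fourier, hF, ← mul_assoc, ← Complex.exp_add]
    congr 2
    have : (Real.pi : ℂ) ≠ 0 := by simp [Real.pi_ne_zero]
    push_cast
    field_simp
  rw [h3, hsub, Complex.real_smul, neg_div]
  have : (Real.pi : ℂ) ≠ 0 := by simp [Real.pi_ne_zero]
  push_cast
  field_simp

/-- The Riemann–Lebesgue lemma, uniformly in a vertical strip. -/
theorem eventually_norm_integral_expWeight_le {h : ℝ → ℝ} {c₀ c C : ℝ}
    (h0 : ∀ ω ≤ 0, h ω = 0) (hi : Integrable (expWeight c₀ h)) (hc : c₀ ≤ c) {ε : ℝ} (hε : 0 < ε) :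
    ∀ᶠ T : ℝ in atTop, ∀ t : ℝ, T ≤ |t| → ∀ σ ∈ Icc c C,
      ‖∫ ω, expWeight (σ + t * Complex.I) h ω‖ ≤ ε := by
  have hm : AEStronglyMeasurable h := by
    have h1 : AEStronglyMeasurable (fun ω : ℝ => (expWeight c₀ h ω * Complex.exp (c₀ * ω)).re) :=
      Complex.continuous_re.comp_aestronglyMeasurable
        (hi.aestronglyMeasurable.mul (Continuous.aestronglyMeasurable (by fun_prop)))
    refine h1.congr (ae_of_all _ fun ω => ?_)
    simp only [expWeight]
    rw [mul_assoc, ← Complex.exp_add]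
    simp
  have hmw : ∀ s : ℂ, AEStronglyMeasurable (expWeight s h) := fun s =>
    (Complex.continuous_ofReal.comp_aestronglyMeasurable hm).mul
      (Continuous.aestronglyMeasurable (by fun_prop))
  have hle : ∀ σ : ℝ, c₀ ≤ σ → ∀ ω : ℝ, |h ω| * Real.exp (-σ * ω) ≤ ‖expWeight c₀ h ω‖ := by
    intro σ hσ ω
    rw [norm_expWeight, Complex.ofReal_re]
    rcases le_or_gt ω 0 with hω | hω
    · simp [h0 ω hω]
    · gcongr
  have hint : ∀ s : ℂ, c₀ ≤ s.re → Integrable (expWeight s h) := fun s hs =>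
    Integrable.mono' hi.norm (hmw s) (ae_of_all _ fun ω => by
      rw [norm_expWeight]; exact hle _ hs ω)
  -- Compactness reduces uniformity to a neighbourhood of each abscissa σ₀. There the weighted
  -- densities are L¹-close to the one at σ₀, for which the ordinary Riemann–Lebesgue lemma holds.
  refine (isCompact_Icc (a := c) (b := C)).induction_on (p := fun A : Set ℝ => ∀ᶠ T : ℝ in atTop, ∀ t : ℝ, T ≤ |t| →
    ∀ σ ∈ A, ‖∫ ω, expWeight (σ + t * Complex.I) h ω‖ ≤ ε) ?_ ?_ ?_ ?_
  · simp
  · intro A B hAB hB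
    filter_upwards [hB] with T hT t ht σ hσ using hT t ht σ (hAB hσ)
  · intro A B hA hB
    filter_upwards [hA, hB] with T hTA hTB t ht σ hσ
    exact hσ.elim (hTA t ht σ) (hTB t ht σ)
  · intro σ₀ hσ₀
    have hdist : Tendsto (fun σ : ℝ => ∫ ω, |h ω| * |Real.exp (-σ * ω) - Real.exp (-σ₀ * ω)|)
        (𝓝[Icc c C] σ₀) (𝓝 (∫ ω : ℝ, (0 : ℝ))) := by
      refine tendsto_integral_filter_of_dominated_convergence (fun ω => 2 * ‖expWeight c₀ h ω‖)
        (Eventually.of_forall fun σ => ?_) ?_ (hi.norm.const_mul 2) (ae_of_all _ fun ω => ?_)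
      · exact hm.norm.mul (Continuous.aestronglyMeasurable (by fun_prop))
      · filter_upwards [self_mem_nhdsWithin] with σ hσ
        refine ae_of_all _ fun ω => ?_
        rw [Real.norm_of_nonneg (by positivity)]
        have h1 := hle σ (hc.trans hσ.1) ω
        have h2 := hle σ₀ (hc.trans hσ₀.1) ω
        calc |h ω| * |Real.exp (-σ * ω) - Real.exp (-σ₀ * ω)|
            ≤ |h ω| * (Real.exp (-σ * ω) + Real.exp (-σ₀ * ω)) := by
              gcongr
              refine (abs_sub _ _).trans ?_
              rw [Real.abs_exp, Real.abs_exp]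
          _ ≤ _ := by linarith
      · have : Continuous fun σ : ℝ => |h ω| * |Real.exp (-σ * ω) - Real.exp (-σ₀ * ω)| := by
          fun_prop
        have h1 := this.tendsto σ₀
        simp only [sub_self, abs_zero, mul_zero] at h1
        exact h1.mono_left nhdsWithin_le_nhds
    rw [integral_zero] at hdist
    refine ⟨{σ | ∫ ω, |h ω| * |Real.exp (-σ * ω) - Real.exp (-σ₀ * ω)| < ε / 2} ∩ Icc c C,
      inter_mem (hdist.eventually (gt_mem_nhds (by positivity))) self_mem_nhdsWithin, ?_⟩
    have hRL : Tendsto (fun t : ℝ => ‖∫ ω, expWeight (σ₀ + t * Complex.I) h ω‖)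
        (cocompact ℝ) (𝓝 0) := by
      simp_rw [integral_expWeight_eq_fourier]
      have h1 := Real.zero_at_infty_fourier (expWeight σ₀ h)
      have h2 : Tendsto (fun t : ℝ => t / (2 * Real.pi)) (cocompact ℝ) (cocompact ℝ) := by
        have := (Homeomorph.mulRight₀ (2 * Real.pi)⁻¹ (by positivity)).isClosedEmbedding.tendsto_cocompact
        simpa [div_eq_mul_inv] using this
      simpa using (h1.comp h2).norm
    have hev := hRL.eventually (gt_mem_nhds (show (0 : ℝ) < ε / 2 by positivity))
    rw [cocompact_eq_atBot_atTop, eventually_sup, eventually_atBot, eventually_atTop] at hev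
    obtain ⟨⟨A, hA⟩, ⟨B, hB⟩⟩ := hev
    filter_upwards [eventually_ge_atTop (max (-A) B)] with T hT t ht σ hσ
    have hT' := max_le_iff.1 hT
    have h1 : ‖∫ ω, expWeight (σ₀ + t * Complex.I) h ω‖ < ε / 2 := by
      rcases le_total 0 t with h0 | h0
      · rw [abs_of_nonneg h0] at ht; exact hB t (by linarith)
      · rw [abs_of_nonpos h0] at ht; exact hA t (by linarith)
    have hre : ∀ σ : ℝ, (σ + t * Complex.I : ℂ).re = σ := fun σ => by simp
    have h2 : ‖(∫ ω, expWeight (σ + t * Complex.I) h ω)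
        - ∫ ω, expWeight (σ₀ + t * Complex.I) h ω‖
        ≤ ∫ ω, |h ω| * |Real.exp (-σ * ω) - Real.exp (-σ₀ * ω)| := by
      rw [← integral_sub (hint _ (by rw [hre]; exact hc.trans hσ.2.1))
        (hint _ (by rw [hre]; exact hc.trans hσ₀.1))]
      refine (norm_integral_le_integral_norm _).trans (le_of_eq ?_)
      refine integral_congr_ae (ae_of_all _ fun ω => ?_)
      have h3 : ∀ σ : ℝ, Complex.exp (-(σ + t * Complex.I) * ω)
          = (Real.exp (-σ * ω) : ℝ) * Complex.exp ((-t * ω : ℝ) * Complex.I) := by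
        intro σ
        push_cast
        rw [← Complex.exp_add]
        ring_nf
      simp only [expWeight]
      rw [h3, h3, ← mul_sub, ← sub_mul, norm_mul, norm_mul, Complex.norm_exp_ofReal_mul_I, mul_one,
        ← Complex.ofReal_sub, Complex.norm_real, Complex.norm_real, Real.norm_eq_abs,
        Real.norm_eq_abs]
    have h4 : (∫ ω, |h ω| * |Real.exp (-σ * ω) - Real.exp (-σ₀ * ω)|) < ε / 2 := hσ.1
    have h5 := norm_add_le ((∫ ω, expWeight (σ + t * Complex.I) h ω)
        - ∫ ω, expWeight (σ₀ + t * Complex.I) h ω) (∫ ω, expWeight (σ₀ + t * Complex.I) h ω)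
    rw [sub_add_cancel] at h5
    linarith

/-! ### Multiphoton spectra -/

theorem expWeight_cut (s : ℂ) (g : ℝ → ℝ) (U : EReal) :
    expWeight s (cut g U)
      = (window U).indicator fun ω : ℝ => (g ω : ℂ) * Complex.exp (-s * ω) := by
  funext ω
  by_cases h : ω ∈ window U <;> simp [expWeight, cut, h]

theorem integral_expWeight_cut (s : ℂ) (g : ℝ → ℝ) (U : EReal) :
    ∫ ω, expWeight s (cut g U) ω
      = ∫ ω in window U, (g ω : ℂ) * Complex.exp (-s * ω) := by
  rw [expWeight_cut, integral_indicator (measurableSet_window U)]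

theorem logArg_eq_expWeight (g : ℝ → ℝ) (U : EReal) (s : ℂ) :
    logArg g U s = (∫ ω, expWeight s (cut g U) ω) + nonEmission g := by
  rw [logArg, integral_expWeight_cut]

theorem integrable_expWeight_cut {g : ℝ → ℝ} {U : EReal} {c₀ : ℝ}
    (h : IntegrableOn (fun ω : ℝ => g ω * Real.exp (-c₀ * ω)) (window U)) {s : ℂ}
    (hs : c₀ ≤ s.re) : Integrable (expWeight s (cut g U)) := by
  rw [expWeight_cut, integrable_indicator_iff (measurableSet_window U)]
  exact integrable_laplace (measurableSet_window U) (window_subset U) h hs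

theorem integrableOn_window_exp_zero {g : ℝ → ℝ} (hg : IntegrableOn g (Ioi 0)) (U : EReal) :
    IntegrableOn (fun ω : ℝ => g ω * Real.exp (-(0 : ℝ) * ω)) (window U) := by
  simpa using hg.mono_set (window_subset U)

theorem cut_nonneg {g : ℝ → ℝ} (hg : ∀ ω : ℝ, 0 < ω → 0 ≤ g ω) (U : EReal) (ω : ℝ) :
    0 ≤ cut g U ω :=
  indicator_nonneg (fun ω (hω : ω ∈ window U) => hg ω hω.1) ω

theorem cut_eq_zero (g : ℝ → ℝ) (U : EReal) : ∀ ω ≤ 0, cut g U ω = 0 := by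
  intro ω hω
  simp [cut, indicator, window, not_lt.2 hω]

theorem cut_top_of_pos (g : ℝ → ℝ) {ω : ℝ} (hω : 0 < ω) : cut g ⊤ ω = g ω := by
  simp [cut, window_top, hω]

theorem norm_integral_expWeight_le {h : ℝ → ℝ} (hh : ∀ ω, 0 ≤ h ω) (h0 : ∀ ω ≤ 0, h ω = 0)
    {s : ℂ} {c : ℝ} (hi : Integrable (expWeight c h)) (hs : c ≤ s.re) :
    ‖∫ ω, expWeight s h ω‖ ≤ ∫ ω, h ω * Real.exp (-c * ω) := by
  have hn : ∀ ω, ‖expWeight c h ω‖ = h ω * Real.exp (-c * ω) := fun ω => by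
    rw [norm_expWeight, abs_of_nonneg (hh ω), Complex.ofReal_re]
  refine norm_integral_le_of_norm_le (hi.norm.congr (ae_of_all _ hn)) (ae_of_all _ fun ω => ?_)
  rw [norm_expWeight, abs_of_nonneg (hh ω)]
  rcases le_or_gt ω 0 with hω | hω
  · simp [h0 ω hω]
  · have := hh ω
    gcongr

/-- Laplace integrals of integrable densities tend to zero along the real axis. -/
theorem tendsto_integral_mul_exp_neg {g : ℝ → ℝ} (hg : IntegrableOn g (Ioi 0)) :
    Tendsto (fun c : ℝ => ∫ ω, cut g ⊤ ω * Real.exp (-c * ω)) atTop (𝓝 0) := by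
  have hi : Integrable (cut g ⊤) := by
    rw [cut, window_top, integrable_indicator_iff measurableSet_Ioi]; exact hg
  have h : Tendsto (fun c : ℝ => ∫ ω, cut g ⊤ ω * Real.exp (-c * ω)) atTop
      (𝓝 (∫ ω : ℝ, (0 : ℝ))) := by
    refine tendsto_integral_filter_of_dominated_convergence (fun ω => ‖cut g ⊤ ω‖) ?_ ?_ hi.norm
      (ae_of_all _ fun ω => ?_)
    · exact Eventually.of_forall fun c =>
        hi.aestronglyMeasurable.mul (Continuous.aestronglyMeasurable (by fun_prop))
    · filter_upwards [eventually_ge_atTop 0] with c hc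
      refine ae_of_all _ fun ω => ?_
      rcases le_or_gt ω 0 with hω | hω
      · simp [cut_eq_zero g ⊤ ω hω]
      · rw [norm_mul, Real.norm_of_nonneg (Real.exp_pos _).le]
        exact mul_le_of_le_one_right (norm_nonneg _) (Real.exp_le_one_iff.2 (by nlinarith))
    · rcases le_or_gt ω 0 with hω | hω
      · simp [cut_eq_zero g ⊤ ω hω]
      · have : Tendsto (fun c : ℝ => Real.exp (-(c * ω))) atTop (𝓝 0) :=
          Real.tendsto_exp_neg_atTop_nhds_zero.comp (tendsto_id.atTop_mul_const hω)
        simpa using this.const_mul (cut g ⊤ ω)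
  simpa using h

section multiphoton

variable {f : ℝ → ℝ} (hf : IsSpectrum f) (hfi : IntegrableOn f (Ioi 0))

theorem multiphotonSpectrum_eq (f : ℝ → ℝ) : multiphotonSpectrum f = fun ω =>
    Real.exp (-photonNumber f) *
      convSeries (fun n => 1 / ((n + 1).factorial : ℝ)) (cut f ⊤) ω := rfl

theorem summable_inv_factorial_succ (r : ℝ) :
    Summable fun n : ℕ => |1 / ((n + 1).factorial : ℝ)| * r ^ (n + 1) := by
  have := (summable_nat_add_iff 1).2 (Real.summable_pow_div_factorial r)
  refine this.congr fun n => ?_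
  rw [abs_of_nonneg (by positivity)]
  ring

include hf

theorem multiphotonSpectrum_nonneg (ω : ℝ) : 0 ≤ multiphotonSpectrum f ω :=
  mul_nonneg (Real.exp_pos _).le (tsum_nonneg fun n =>
    mul_nonneg (by positivity) (selfConv_nonneg (cut_nonneg hf.nonneg ⊤) n ω))

omit hf in
theorem cut_multiphotonSpectrum (f : ℝ → ℝ) :
    cut (multiphotonSpectrum f) ⊤ = multiphotonSpectrum f := by
  funext ω
  rcases le_or_gt ω 0 with hω | hω
  · rw [cut_eq_zero _ _ ω hω, multiphotonSpectrum]
    simp [selfConv_eq_zero (cut_eq_zero f ⊤) _ hω]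
  · exact cut_top_of_pos _ hω

include hfi

theorem integrable_expWeight_multiphotonSpectrum {s : ℂ} (hs : 0 ≤ s.re) :
    Integrable (expWeight s (multiphotonSpectrum f)) := by
  have hi := integrable_expWeight_cut (integrableOn_window_exp_zero hfi ⊤) hs
  rw [multiphotonSpectrum_eq, expWeight_const_mul]
  exact (integrable_expWeight_convSeries (cut_nonneg hf.nonneg ⊤) hi
    (summable_inv_factorial_succ _)).const_mul _

/-- At least one photon is emitted, so the exponential series appears without its constant term. -/
theorem integral_expWeight_multiphotonSpectrum {s : ℂ} (hs : 0 ≤ s.re) :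
    ∫ ω, expWeight s (multiphotonSpectrum f) ω = Real.exp (-photonNumber f)
      * (Complex.exp (∫ ω, expWeight s (cut f ⊤) ω) - 1) := by
  have hi := integrable_expWeight_cut (integrableOn_window_exp_zero hfi ⊤) hs
  rw [multiphotonSpectrum_eq, expWeight_const_mul, integral_const_mul]
  congr 1
  have h1 := hasSum_integral_convSeries (cut_nonneg hf.nonneg ⊤) hi
    (summable_inv_factorial_succ _)
  set z := ∫ ω, expWeight s (cut f ⊤) ω
  have h2 : HasSum (fun n : ℕ => z ^ n / (n.factorial : ℂ)) (Complex.exp z) := by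
    rw [Complex.exp_eq_exp_ℂ]
    exact NormedSpace.expSeries_div_hasSum_exp z
  have h3 := (hasSum_nat_add_iff' 1).2 h2
  refine h1.unique ?_
  simp only [Finset.range_one, Finset.sum_singleton, pow_zero, Nat.factorial_zero, Nat.cast_one,
    div_one] at h3
  refine h3.congr_fun fun n => ?_
  push_cast
  ring

theorem integrableOn_multiphotonSpectrum : IntegrableOn (multiphotonSpectrum f) (Ioi 0) := by
  have h := (integrable_expWeight_multiphotonSpectrum hf hfi (s := 0) (by simp)).re
  refine Integrable.integrableOn (h.congr (ae_of_all _ fun ω => ?_))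
  simp [expWeight]

omit hf hfi in
theorem integral_expWeight_zero_cut_top (g : ℝ → ℝ) :
    ∫ ω, expWeight 0 (cut g ⊤) ω = ((∫ ω in Ioi (0 : ℝ), g ω : ℝ) : ℂ) := by
  rw [integral_expWeight_cut, window_top, ← integral_complex_ofReal]
  simp

theorem nonEmission_multiphotonSpectrum :
    nonEmission (multiphotonSpectrum f) = Real.exp (-photonNumber f) := by
  have h := integral_expWeight_multiphotonSpectrum hf hfi (s := 0) (by simp)
  rw [← cut_multiphotonSpectrum, integral_expWeight_zero_cut_top,
    integral_expWeight_zero_cut_top] at h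
  have h' : ∫ ω in Ioi (0 : ℝ), multiphotonSpectrum f ω
      = Real.exp (-photonNumber f) * (Real.exp (photonNumber f) - 1) := by
    rw [photonNumber]; exact_mod_cast h
  rw [nonEmission, h', mul_sub, ← Real.exp_add]
  simp

omit hf in
theorem levyExponent_eq {s : ℂ} (hs : 0 ≤ s.re) :
    levyExponent f s = (∫ ω, expWeight s (cut f ⊤) ω) - photonNumber f := by
  have hi := integrable_laplace (measurableSet_window ⊤) (window_subset ⊤)
    (integrableOn_window_exp_zero hfi ⊤) hs
  rw [integral_expWeight_cut, photonNumber, levyExponent, window_top] at *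
  have hfi' : IntegrableOn (fun ω => (f ω : ℂ)) (Ioi 0) := hfi.ofReal
  rw [← integral_complex_ofReal, ← integral_sub hi hfi']
  refine integral_congr_ae (ae_of_all _ fun ω => ?_)
  simp only
  ring

/-- The atom e^{-w₁} supplies the missing zero-photon term of the exponential series. -/
theorem logArg_multiphotonSpectrum {s : ℂ} (hs : 0 ≤ s.re) :
    logArg (multiphotonSpectrum f) ⊤ s = Complex.exp (levyExponent f s) := by
  rw [logArg_eq_expWeight, cut_multiphotonSpectrum, nonEmission_multiphotonSpectrum hf hfi,
    integral_expWeight_multiphotonSpectrum hf hfi hs, levyExponent_eq hfi hs, Complex.exp_sub,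
    Real.exp_neg]
  push_cast
  field_simp
  ring

theorem isLevyPair_multiphotonSpectrum : IsLevyPair f (multiphotonSpectrum f) where
  spectrum := hf
  integrable_min := by
    refine Integrable.mono' hfi ((measurable_const.min measurable_id).mul
      hf.measurable).aestronglyMeasurable ?_
    refine (ae_restrict_iff' measurableSet_Ioi).2 (ae_of_all _ fun ω hω => ?_)
    have hω : 0 < ω := hω
    have hfω := hf.nonneg ω hω
    have hm : 0 ≤ min 1 ω := le_min zero_le_one hω.le
    rw [norm_mul, Real.norm_of_nonneg hm, Real.norm_of_nonneg hfω]
    exact mul_le_of_le_one_left hfω (min_le_left _ _)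
  nonneg := fun ω _ => multiphotonSpectrum_nonneg hf ω
  integrable := integrableOn_multiphotonSpectrum hf hfi
  nonEmission_nonneg := by
    rw [nonEmission_multiphotonSpectrum hf hfi]; exact (Real.exp_pos _).le
  exp_eq := fun s hs => (logArg_multiphotonSpectrum hf hfi hs.le).symm

end multiphoton

theorem IsLevyPair.singularitiesLeftOf_top {f g : ℝ → ℝ} (h : IsLevyPair f g) :
    SingularitiesLeftOf g ⊤ 0 where
  integrable := integrableOn_window_exp_zero h.integrable ⊤
  ne_zero := fun s hs => by rw [← h.exp_eq s hs]; exact Complex.exp_ne_zero _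

/-- Far to the right the emission part of the logarithm's argument is small. -/
theorem exists_integral_lt {g : ℝ → ℝ} (hg : IntegrableOn g (Ioi 0)) {ε : ℝ} (hε : 0 < ε) (b : ℝ) :
    ∃ C : ℝ, b ≤ C ∧ ∫ ω, cut g ⊤ ω * Real.exp (-C * ω) < ε := by
  have := ((tendsto_integral_mul_exp_neg hg).eventually (gt_mem_nhds hε)).and
    (eventually_ge_atTop b)
  obtain ⟨C, h1, h2⟩ := this.exists
  exact ⟨C, h2, h1⟩

theorem integral_cut_le {g : ℝ → ℝ} (hg0 : ∀ ω : ℝ, 0 < ω → 0 ≤ g ω) (hg : IntegrableOn g (Ioi 0))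
    (U : EReal) {c : ℝ} (hc : 0 ≤ c) :
    ∫ ω, cut g U ω * Real.exp (-c * ω) ≤ ∫ ω, cut g ⊤ ω * Real.exp (-c * ω) := by
  have hint : ∀ U, Integrable (fun ω => cut g U ω * Real.exp (-c * ω)) := by
    intro U
    have := integrable_expWeight_cut (integrableOn_window_exp_zero hg U) (s := c) (by simpa using hc)
    refine this.norm.congr (ae_of_all _ fun ω => ?_)
    simp only
    rw [norm_expWeight, abs_of_nonneg (cut_nonneg hg0 U ω), Complex.ofReal_re]
  refine integral_mono (hint U) (hint ⊤) fun ω => ?_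
  refine mul_le_mul_of_nonneg_right ?_ (Real.exp_pos _).le
  by_cases hω : ω ∈ window U
  · rw [cut_top_of_pos g hω.1, cut, indicator_of_mem hω]
  · rw [cut, indicator_of_notMem hω]
    exact cut_nonneg hg0 ⊤ ω

/-! ### The logarithmic series -/

/-- The coefficients of `ln (1 + z / W₀)`, starting at first order. -/
noncomputable def logCoeff (W₀ : ℝ) (n : ℕ) : ℝ := (-1) ^ n / (((n : ℝ) + 1) * W₀ ^ (n + 1))

theorem summable_logCoeff {W₀ r : ℝ} (hr : 0 ≤ r) (hrW : r < W₀) :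
    Summable fun n : ℕ => |logCoeff W₀ n| * r ^ (n + 1) := by
  have hW : 0 < W₀ := hr.trans_lt hrW
  have hg : Summable fun n : ℕ => (r / W₀) ^ (n + 1) :=
    (summable_nat_add_iff 1).2 (summable_geometric_of_lt_one (by positivity)
      ((div_lt_one hW).2 hrW))
  refine Summable.of_nonneg_of_le (fun n => by positivity) (fun n => ?_) hg
  rw [logCoeff, abs_div, abs_pow, abs_neg, abs_one, one_pow, abs_of_pos (by positivity), div_pow,
    div_mul_eq_mul_div, one_mul]
  gcongr
  have : 0 < W₀ ^ (n + 1) := by positivity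
  nlinarith [(Nat.cast_nonneg n : (0 : ℝ) ≤ n)]

theorem hasSum_logCoeff {W₀ : ℝ} {z : ℂ} (hz : ‖z‖ < W₀) :
    HasSum (fun n : ℕ => (logCoeff W₀ n : ℂ) * z ^ (n + 1)) (Complex.log (1 + z / W₀)) := by
  have hW : 0 < W₀ := (norm_nonneg z).trans_lt hz
  have hz1 : ‖z / (W₀ : ℂ)‖ < 1 := by
    rw [norm_div, Complex.norm_real, Real.norm_of_nonneg hW.le]
    exact (div_lt_one hW).2 hz
  have h := (hasSum_nat_add_iff' 1).2 (Complex.hasSum_taylorSeries_log hz1)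
  simp only [Finset.range_one, Finset.sum_singleton, Nat.cast_zero, div_zero, sub_zero] at h
  refine h.congr_fun fun n => ?_
  have : (W₀ : ℂ) ≠ 0 := by exact_mod_cast hW.ne'
  have hn : (n : ℂ) + 1 ≠ 0 := by exact_mod_cast n.succ_ne_zero
  rw [logCoeff]
  push_cast
  rw [div_pow]
  field_simp
  ring

section log

variable {g : ℝ → ℝ} (hg0 : ∀ ω : ℝ, 0 < ω → 0 ≤ g ω) (hg : IntegrableOn g (Ioi 0))
include hg0 hg

theorem norm_integral_expWeight_cut_lt {W₀ C : ℝ} (hC : 0 ≤ C)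
    (hlt : ∫ ω, cut g ⊤ ω * Real.exp (-C * ω) < W₀) (U : EReal) {s : ℂ} (hs : C ≤ s.re) :
    ‖∫ ω, expWeight s (cut g U) ω‖ < W₀ :=
  ((norm_integral_expWeight_le (cut_nonneg hg0 U) (cut_eq_zero g U)
    (integrable_expWeight_cut (integrableOn_window_exp_zero hg U) (by simpa using hC)) hs).trans
    (integral_cut_le hg0 hg U hC)).trans_lt hlt

/-- Far enough to the right the emission integral is smaller in modulus than the positive W₀, so the
sum cannot vanish. -/
theorem exists_singularitiesLeftOf (hW : 0 < nonEmission g) (U : EReal) :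
    ∃ c₀ : ℝ, SingularitiesLeftOf g U c₀ := by
  obtain ⟨C, hC, hlt⟩ := exists_integral_lt hg hW 0
  refine ⟨C, (integrableOn_mul_exp_neg hg hC).mono_set (window_subset U), fun s hs h0 => ?_⟩
  have h1 := norm_integral_expWeight_cut_lt hg0 hg hC hlt U hs.le
  rw [logArg_eq_expWeight] at h0
  rw [eq_neg_of_add_eq_zero_left h0, norm_neg, Complex.norm_real, Real.norm_of_nonneg hW.le] at h1
  exact lt_irrefl _ h1

/-- Where the weighted mass of g is below W₀, the Taylor series of the logarithm converges
absolutely in the convolution algebra. It defines a density whose transform is the principal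
logarithm. -/
theorem convSeries_logCoeff_laplace {W₀ C : ℝ} (hC : 0 ≤ C)
    (hlt : ∫ ω, cut g ⊤ ω * Real.exp (-C * ω) < W₀) (U : EReal) {s : ℂ} (hs : s.re = C) :
    Integrable (expWeight s (convSeries (logCoeff W₀) (cut g U))) ∧
    (∀ᵐ ω, Summable fun n => logCoeff W₀ n * selfConv (cut g U) n ω) ∧
    ∫ ω, expWeight s (convSeries (logCoeff W₀) (cut g U)) ω
      = Complex.log (1 + (∫ ω, expWeight s (cut g U) ω) / W₀) := by
  have hi := integrable_expWeight_cut (integrableOn_window_exp_zero hg U) (s := s)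
    (by rw [hs]; exact hC)
  have hsum := summable_logCoeff (W₀ := W₀) (r := ∫ ω, cut g U ω * Real.exp (-s.re * ω))
    (integral_nonneg fun ω => mul_nonneg (cut_nonneg hg0 U ω) (Real.exp_pos _).le)
    (by rw [hs]; exact (integral_cut_le hg0 hg U hC).trans_lt hlt)
  exact ⟨integrable_expWeight_convSeries (cut_nonneg hg0 U) hi hsum,
    ae_summable_convSeries (cut_nonneg hg0 U) hi hsum,
    (hasSum_integral_convSeries (cut_nonneg hg0 U) hi hsum).unique
      (hasSum_logCoeff (norm_integral_expWeight_cut_lt hg0 hg hC hlt U hs.ge))⟩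

end log

theorem convSeries_cut_eq (a : ℕ → ℝ) (g : ℝ → ℝ) {U : EReal} {ω : ℝ} (hω : (ω : EReal) < U) :
    convSeries a (cut g U) ω = convSeries a (cut g ⊤) ω := by
  simp only [convSeries, selfConv_cut_eq g U _ hω]

/-! ### Branches of the logarithm with a positive atom -/

section branch

variable {g : ℝ → ℝ} {U : EReal} {c₀ : ℝ} {L : ℂ → ℂ} (hU : SingularitiesLeftOf g U c₀)
  (hL : IsLogBranch (logArg g U) c₀ L) (hW : 0 < nonEmission g)
include hU hL hW

/-- Where the emission part is smaller than W₀, 1 + G/W₀ stays in the disc of radius 1 about 1. Both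
sides are then holomorphic logarithms of the same function, and one point of agreement on a
connected set fixes them. -/
theorem isLogBranch_eq_log_of_eq {S : Set ℂ} (hS : IsOpen S) (hS' : IsPreconnected S)
    (hSc : S ⊆ {s : ℂ | c₀ < s.re})
    (hlt : ∀ s ∈ S, ‖∫ ω, expWeight s (cut g U) ω‖ < nonEmission g) {s₀ : ℂ} (hs₀ : s₀ ∈ S)
    (h0 : L s₀ - Real.log (nonEmission g)
      = Complex.log (1 + (∫ ω, expWeight s₀ (cut g U) ω) / nonEmission g)) {s : ℂ} (hs : s ∈ S) :
    L s - Real.log (nonEmission g)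
      = Complex.log (1 + (∫ ω, expWeight s (cut g U) ω) / nonEmission g) := by
  have hW' : (nonEmission g : ℂ) ≠ 0 := by exact_mod_cast hW.ne'
  have hz : ∀ s ∈ S, ‖(∫ ω, expWeight s (cut g U) ω) / (nonEmission g : ℂ)‖ < 1 := by
    intro s hs
    rw [norm_div, Complex.norm_real, Real.norm_of_nonneg hW.le]
    exact (div_lt_one hW).2 (hlt s hs)
  refine eqOn_of_exp_eq (F := fun s => L s - Real.log (nonEmission g))
    (G := fun s => Complex.log (1 + (∫ ω, expWeight s (cut g U) ω) / nonEmission g)) hS hS'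
    ((hL.differentiableOn.mono hSc).sub_const _) ?_ ?_ hs₀ h0 hs
  · have hd : DifferentiableOn ℂ (fun s => ∫ ω, expWeight s (cut g U) ω) S := by
      have := ((differentiableOn_logArg hU.integrable).mono hSc).sub_const (nonEmission g : ℂ)
      simpa [logArg_eq_expWeight] using this
    exact ((hd.div_const _).const_add 1).clog fun s hs =>
      Complex.mem_slitPlane_of_norm_lt_one (hz s hs)
  · intro s hs
    have hne : 1 + (∫ ω, expWeight s (cut g U) ω) / (nonEmission g : ℂ) ≠ 0 :=
      Complex.slitPlane_ne_zero (Complex.mem_slitPlane_of_norm_lt_one (hz s hs))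
    rw [Complex.exp_log hne, Complex.exp_sub, hL.exp_eq s (hSc hs), logArg_eq_expWeight,
      ← Complex.ofReal_exp, Real.exp_log hW]
    field_simp
    ring

/-- Far to the right, and far up and down in vertical strips, the branch is given by the principal
value of the logarithm. -/
theorem isLogBranch_sub_log_eq (hg0 : ∀ ω : ℝ, 0 < ω → 0 ≤ g ω) (hg : IntegrableOn g (Ioi 0))
    {C : ℝ} (hC : 0 ≤ C) (hCc : c₀ ≤ C)
    (hlt : ∫ ω, cut g ⊤ ω * Real.exp (-C * ω) < nonEmission g) {c : ℝ} (hc : c₀ < c) :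
    ∃ T₀ : ℝ, ∀ s : ℂ, (C < s.re ∨ (c ≤ s.re ∧ T₀ < |s.im|)) →
      L s - Real.log (nonEmission g)
        = Complex.log (1 + (∫ ω, expWeight s (cut g U) ω) / nonEmission g) := by
  have hright := fun (s : ℂ) (hs : C ≤ s.re) => norm_integral_expWeight_cut_lt hg0 hg hC hlt U hs
  have h1 : ∀ s : ℂ, C < s.re → L s - Real.log (nonEmission g)
      = Complex.log (1 + (∫ ω, expWeight s (cut g U) ω) / nonEmission g) := by
    intro s hs
    refine isLogBranch_eq_log_of_eq hU hL hW (isOpen_re_gt C) (convex_re_gt C).isPreconnected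
      (fun s hs => lt_of_le_of_lt hCc hs) (fun s hs => hright s (le_of_lt hs))
      (s₀ := ((C + 1 : ℝ) : ℂ)) (by simp) ?_ hs
    have hx : c₀ < C + 1 := by linarith
    have hr := logArg_ofReal g U (C + 1)
    obtain ⟨hpos, hval⟩ := isLogBranch_ofReal hL hx hr
    set R := ∫ ω in window U, g ω * Real.exp (-(C + 1) * ω)
    have hz : ∫ ω, expWeight ((C + 1 : ℝ) : ℂ) (cut g U) ω = (R : ℂ) := by
      have := logArg_eq_expWeight g U ((C + 1 : ℝ) : ℂ)
      rw [hr] at this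
      push_cast at this ⊢
      linear_combination -this
    have hq : (1 : ℂ) + R / nonEmission g = ((R + nonEmission g) / nonEmission g : ℝ) := by
      have : (nonEmission g : ℂ) ≠ 0 := by exact_mod_cast hW.ne'
      push_cast
      field_simp
      ring
    rw [hz, hq, hval, ← Complex.ofReal_log (by positivity), Real.log_div hpos.ne' hW.ne']
    push_cast
    rfl
  -- Strictly between c₀ and c, so that the open half-plane Re s > c' contains the closed one Re s ≥
  -- c.
  set c' := (c₀ + c) / 2 with hc'
  obtain ⟨T, hT⟩ := eventually_atTop.1 ((eventually_norm_integral_expWeight_le (c := c')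
    (C := C) (cut_eq_zero g U) (integrable_expWeight_cut hU.integrable (s := c₀) (by simp))
    (by linarith) (half_pos hW)).and (eventually_ge_atTop 0))
  obtain ⟨hRL, hT0⟩ := hT T le_rfl
  have hsmall : ∀ s : ℂ, c' ≤ s.re → T ≤ |s.im| →
      ‖∫ ω, expWeight s (cut g U) ω‖ < nonEmission g := by
    intro s hs hsT
    rcases le_total C s.re with h | h
    · exact hright s h
    · have := hRL s.im hsT s.re ⟨hs, h⟩
      rw [Complex.re_add_im] at this
      linarith
  refine ⟨T, fun s hs => ?_⟩
  rcases hs with hs | ⟨hsc, hsT⟩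
  · exact h1 s hs
  -- The upper and the lower region are convex and each meets Re s > C, where the identity is known.
  -- A point of that overlap serves as base point.
  rcases lt_abs.1 hsT with him | him
  · have hS : IsOpen ({s : ℂ | c' < s.re} ∩ {s : ℂ | T < s.im}) :=
      (isOpen_re_gt c').inter (isOpen_lt continuous_const Complex.continuous_im)
    refine isLogBranch_eq_log_of_eq hU hL hW hS
      ((convex_re_gt c').inter (convex_halfSpace_im_gt T)).isPreconnected
      (fun s hs => lt_trans (by linarith : c₀ < c') hs.1)
      (fun s hs => hsmall s (le_of_lt hs.1) (le_trans (le_of_lt hs.2) (le_abs_self _)))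
      (s₀ := ((max C c' + 1 : ℝ) : ℂ) + (T + 1 : ℝ) * Complex.I) ?_ (h1 _ ?_)
      ⟨by show c' < s.re; linarith, him⟩
    · constructor
      · show c' < _
        simp only [Complex.add_re, Complex.ofReal_re, Complex.mul_re, Complex.I_re, mul_zero,
          Complex.ofReal_im, Complex.I_im, mul_one, sub_self, add_zero]
        linarith [le_max_right C c']
      · show T < _
        simp
    · simp only [Complex.add_re, Complex.ofReal_re, Complex.mul_re, Complex.I_re, mul_zero,
        Complex.ofReal_im, Complex.I_im, mul_one, sub_self, add_zero]
      linarith [le_max_left C c']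
  · have hS : IsOpen ({s : ℂ | c' < s.re} ∩ {s : ℂ | s.im < -T}) :=
      (isOpen_re_gt c').inter (isOpen_lt Complex.continuous_im continuous_const)
    refine isLogBranch_eq_log_of_eq hU hL hW hS
      ((convex_re_gt c').inter (convex_halfSpace_im_lt (-T))).isPreconnected
      (fun s hs => lt_trans (by linarith : c₀ < c') hs.1)
      (fun s hs => hsmall s (le_of_lt hs.1) (le_abs.2 (Or.inr (le_neg_of_le_neg (le_of_lt hs.2)))))
      (s₀ := ((max C c' + 1 : ℝ) : ℂ) + (-(T + 1) : ℝ) * Complex.I) ?_ (h1 _ ?_)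
      ⟨by show c' < s.re; linarith, by show s.im < -T; linarith⟩
    · constructor
      · show c' < _
        simp only [Complex.add_re, Complex.ofReal_re, Complex.mul_re, Complex.I_re, mul_zero,
          Complex.ofReal_im, Complex.I_im, mul_one, sub_self, add_zero]
        linarith [le_max_right C c']
      · show _ < -T
        simp
    · simp only [Complex.add_re, Complex.ofReal_re, Complex.mul_re, Complex.I_re, mul_zero,
        Complex.ofReal_im, Complex.I_im, mul_one, sub_self, add_zero]
      linarith [le_max_left C c']

/-- The branch tends to its value at infinity, uniformly in vertical strips. -/
theorem eventually_norm_isLogBranch_sub_log_le (hg0 : ∀ ω : ℝ, 0 < ω → 0 ≤ g ω)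
    (hg : IntegrableOn g (Ioi 0)) {c C : ℝ} (hc : c₀ < c) {ε : ℝ} (hε : 0 < ε) :
    ∀ᶠ T : ℝ in atTop, ∀ t : ℝ, T ≤ |t| → ∀ σ ∈ Icc c C,
      ‖L (σ + t * Complex.I) - Real.log (nonEmission g)‖ ≤ ε := by
  obtain ⟨C₁, hC₁, hlt⟩ := exists_integral_lt hg hW (max c₀ 0)
  obtain ⟨T₀, hT₀⟩ := isLogBranch_sub_log_eq hU hL hW hg0 hg ((le_max_right _ _).trans hC₁)
    ((le_max_left _ _).trans hC₁) hlt hc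
  -- Then z/W₀ has modulus at most 1/2 and at most ε/2, and ‖log(1 + x)‖ ≤ (3/2)‖x‖ for ‖x‖ ≤ 1/2
  -- gives less than ε.
  set η := min (1 / 2) (ε / 2) * nonEmission g with hη
  have hη0 : 0 < η := by positivity
  filter_upwards [eventually_gt_atTop T₀, eventually_norm_integral_expWeight_le (c := c) (C := C)
    (cut_eq_zero g U) (integrable_expWeight_cut hU.integrable (s := c₀) (by simp)) hc.le hη0]
    with T hT hRL t ht σ hσ
  have hz := hRL t ht σ hσ
  rw [hT₀ _ (Or.inr ⟨by simpa using hσ.1, by simpa using hT.trans_le ht⟩)]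
  set z := ∫ ω, expWeight (σ + t * Complex.I) (cut g U) ω
  have hz' : ‖z / (nonEmission g : ℂ)‖ ≤ min (1 / 2) (ε / 2) := by
    rw [norm_div, Complex.norm_real, Real.norm_of_nonneg hW.le, div_le_iff₀ hW]
    exact hz
  have h1 := hz'.trans (min_le_left _ _)
  have h2 := hz'.trans (min_le_right _ _)
  have := Complex.norm_log_one_add_half_le_self h1
  linarith

end branch

/-! ### Reconstruction of an integrable single-photon spectrum -/

theorem abs_exp_sub_exp_le {C a b : ℝ} (hC : 0 ≤ C) (ha : 0 ≤ a) (hb : 0 ≤ b) :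
    |Real.exp (-C * a) - Real.exp (-C * b)| ≤ C * |a - b| := by
  wlog hab : b ≤ a generalizing a b
  · rw [abs_sub_comm, abs_sub_comm a b]
    exact this hb ha (le_of_not_ge hab)
  have h1 : Real.exp (-C * a) = Real.exp (-C * b) * Real.exp (-C * (a - b)) := by
    rw [← Real.exp_add]; ring_nf
  have h2 := Real.add_one_le_exp (-C * (a - b))
  have h3 : Real.exp (-C * b) ≤ 1 := Real.exp_le_one_iff.2 (by nlinarith)
  have h4 : Real.exp (-C * (a - b)) ≤ 1 :=
    Real.exp_le_one_iff.2 (by nlinarith [mul_nonneg hC (sub_nonneg.2 hab)])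
  rw [abs_of_nonneg (sub_nonneg.2 hab), h1, abs_of_nonpos (by nlinarith [Real.exp_pos (-C * b)])]
  nlinarith [Real.exp_pos (-C * b), mul_nonneg hC (sub_nonneg.2 hab)]

section finite

variable {f : ℝ → ℝ} (hf : IsSpectrum f) (hfi : IntegrableOn f (Ioi 0))
include hf hfi

/-- The logarithmic series in the convolution algebra recovers the single-photon spectrum. -/
theorem convSeries_logCoeff_ae_eq :
    (∀ᵐ ω, convSeries (logCoeff (nonEmission (multiphotonSpectrum f)))
      (cut (multiphotonSpectrum f) ⊤) ω = cut f ⊤ ω) ∧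
    ∀ᵐ ω, Summable fun n => logCoeff (nonEmission (multiphotonSpectrum f)) n
      * selfConv (cut (multiphotonSpectrum f) ⊤) n ω := by
  set g := multiphotonSpectrum f with hgdef
  have hg0 : ∀ ω : ℝ, 0 < ω → 0 ≤ g ω := fun ω _ => multiphotonSpectrum_nonneg hf ω
  have hg : IntegrableOn g (Ioi 0) := integrableOn_multiphotonSpectrum hf hfi
  have hWeq : nonEmission g = Real.exp (-photonNumber f) := nonEmission_multiphotonSpectrum hf hfi
  have hW : 0 < nonEmission g := by rw [hWeq]; exact Real.exp_pos _
  obtain ⟨C, ⟨hlt, hltf⟩, hC⟩ := ((((tendsto_integral_mul_exp_neg hg).eventually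
    (gt_mem_nhds hW)).and ((tendsto_integral_mul_exp_neg hfi).eventually
    (gt_mem_nhds one_pos))).and (eventually_ge_atTop 0)).exists
  have hre : ∀ t : ℝ, (C + t * Complex.I : ℂ).re = C := fun t => by simp
  refine ⟨ae_eq_of_integral_expWeight_eq (c := C)
    (convSeries_logCoeff_laplace hg0 hg hC hlt ⊤ (Complex.ofReal_re C)).1
    (integrable_expWeight_cut (integrableOn_window_exp_zero hfi ⊤) (by simpa using hC))
    fun t => ?_, (convSeries_logCoeff_laplace hg0 hg hC hlt ⊤ (Complex.ofReal_re C)).2.1⟩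
  rw [(convSeries_logCoeff_laplace hg0 hg hC hlt ⊤ (hre t)).2.2]
  have hs0 : 0 ≤ (C + t * Complex.I : ℂ).re := by rw [hre]; exact hC
  have hgz := integral_expWeight_multiphotonSpectrum hf hfi hs0
  have hfz : ‖∫ ω, expWeight (C + t * Complex.I) (cut f ⊤) ω‖ < 1 :=
    norm_integral_expWeight_cut_lt hf.nonneg hfi hC hltf ⊤ (hre t).ge
  set z := ∫ ω, expWeight (C + t * Complex.I) (cut f ⊤) ω
  have hne : (Real.exp (-photonNumber f) : ℂ) ≠ 0 := by exact_mod_cast (Real.exp_pos _).ne'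
  have h1 : 1 + (∫ ω, expWeight (C + t * Complex.I) (cut g ⊤) ω) / (nonEmission g : ℂ)
      = Complex.exp z := by
    rw [hgdef, cut_multiphotonSpectrum, hgz, ← hgdef, hWeq, mul_div_cancel_left₀ _ hne]
    ring
  rw [h1]
  -- The choice of C also makes the transform of f smaller than 1 in modulus. Its imaginary part
  -- stays within (-π, π), and log(exp z) = z without a branch correction.
  have him := abs_le.1 ((Complex.abs_im_le_norm z).trans hfz.le)
  have := Real.pi_gt_three
  exact Complex.log_exp (by linarith) (by linarith)

/-- Cutting at U > ω₁ leaves every term at ω₁ unchanged, so the exceptional null set found for U = ∞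
serves all U at once. -/
theorem ae_hasSum_selfConv : ∀ᵐ ω₁ : ℝ ∂(volume.restrict (Ioi (0 : ℝ))), ∀ U : EReal,
    (ω₁ : EReal) < U → HasSum (fun n : ℕ => (-1 : ℝ) ^ n
      / (((n : ℝ) + 1) * nonEmission (multiphotonSpectrum f) ^ (n + 1))
      * selfConv (cut (multiphotonSpectrum f) U) n ω₁) (f ω₁) := by
  obtain ⟨h1, h2⟩ := convSeries_logCoeff_ae_eq hf hfi
  rw [ae_restrict_iff' measurableSet_Ioi]
  filter_upwards [h1, h2] with ω h1 h2 hω U hU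
  simp only [selfConv_cut_eq _ U _ hU]
  rw [← cut_top_of_pos f hω, ← h1]
  exact h2.hasSum

/-- Pointwise inversion at points satisfying Dini's condition. -/
theorem tendsto_contourIntegral_sub_log {U : EReal} {c₀ : ℝ}
    (hU : SingularitiesLeftOf (multiphotonSpectrum f) U c₀) {L : ℂ → ℂ}
    (hL : IsLogBranch (logArg (multiphotonSpectrum f) U) c₀ L) {c : ℝ} (hc : c₀ < c) {ω₁ : ℝ}
    (hω₁ : 0 < ω₁) (hω₁U : (ω₁ : EReal) < U) (hD : DiniAt f ω₁) :
    Tendsto (fun T : ℝ => contourIntegral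
      (fun s : ℂ => L s - (Real.log (nonEmission (multiphotonSpectrum f)) : ℂ)) c T ω₁)
      atTop (𝓝 (f ω₁ : ℂ)) := by
  have hae := (convSeries_logCoeff_ae_eq hf hfi).1
  set g := multiphotonSpectrum f with hgdef
  have hg0 : ∀ ω : ℝ, 0 < ω → 0 ≤ g ω := fun ω _ => multiphotonSpectrum_nonneg hf ω
  have hg : IntegrableOn g (Ioi 0) := integrableOn_multiphotonSpectrum hf hfi
  have hW : 0 < nonEmission g := by
    rw [nonEmission_multiphotonSpectrum hf hfi]; exact Real.exp_pos _
  obtain ⟨C₁, hC₁, hlt₁⟩ := exists_integral_lt hg hW (max c₀ 0)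
  have hC₁0 : 0 ≤ C₁ := (le_max_right _ _).trans hC₁
  have hC₁c : c₀ ≤ C₁ := (le_max_left _ _).trans hC₁
  obtain ⟨T₀, hT₀⟩ := isLogBranch_sub_log_eq hU hL hW hg0 hg hC₁0 hC₁c hlt₁ hc
  set C := max c C₁ + 1 with hCdef
  have hcC : c ≤ C := by linarith [le_max_left c C₁]
  have hC₁C : C₁ < C := by linarith [le_max_right c C₁]
  have hC0 : 0 ≤ C := hC₁0.trans hC₁C.le
  have hlt : ∫ ω, cut g ⊤ ω * Real.exp (-C * ω) < nonEmission g := by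
    have hint : ∀ c : ℝ, 0 ≤ c → Integrable (fun ω => cut g ⊤ ω * Real.exp (-c * ω)) := by
      intro c hc
      refine (integrable_expWeight_cut (integrableOn_window_exp_zero hg ⊤) (s := c)
        (by simpa using hc)).norm.congr (ae_of_all _ fun ω => ?_)
      simp only
      rw [norm_expWeight, abs_of_nonneg (cut_nonneg hg0 ⊤ ω), Complex.ofReal_re]
    refine lt_of_le_of_lt (integral_mono (hint C hC0) (hint C₁ hC₁0) fun ω => ?_) hlt₁
    rcases le_or_gt ω 0 with hω | hω
    · simp [cut_eq_zero g ⊤ ω hω]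
    · have := cut_nonneg hg0 ⊤ ω
      simp only
      gcongr
  -- moving the contour to `Re s = C`
  let F : ℂ → ℂ := fun s => Complex.exp (s * ω₁) * (L s - (Real.log (nonEmission g) : ℂ))
  have hFd : DifferentiableOn ℂ F {s : ℂ | c₀ < s.re} :=
    DifferentiableOn.mul (by fun_prop) (hL.differentiableOn.sub_const _)
  have hshift := tendsto_contour_shift hFd hc hcC (by
    intro ε hε
    have hB : 0 < Real.exp (C * ω₁) := Real.exp_pos _
    filter_upwards [eventually_norm_isLogBranch_sub_log_le hU hL hW hg0 hg hc (C := C)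
      (show 0 < ε / Real.exp (C * ω₁) by positivity), eventually_ge_atTop 0] with T hT hT0 σ hσ
    have key : ∀ t : ℝ, T ≤ |t| → ‖F (σ + t * Complex.I)‖ ≤ ε := by
      intro t ht
      have h1 := hT t ht σ hσ
      have h2 : ‖Complex.exp ((σ + t * Complex.I) * ω₁)‖ ≤ Real.exp (C * ω₁) := by
        rw [Complex.norm_exp]
        simp only [Complex.mul_re, Complex.add_re, Complex.ofReal_re, Complex.I_re, mul_zero,
          Complex.ofReal_im, Complex.I_im, mul_one, sub_self, add_zero, sub_zero]
        have := hσ.2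
        gcongr
      simp only [F, norm_mul]
      calc _ ≤ Real.exp (C * ω₁) * (ε / Real.exp (C * ω₁)) := by gcongr
        _ = ε := by field_simp
    exact ⟨key T (le_abs_self T), key (-T) (by rw [abs_neg]; exact le_abs_self T)⟩)
  -- inversion on `Re s = C`
  have hre : ∀ t : ℝ, (C + t * Complex.I : ℂ).re = C := fun t => by simp
  have hk := convSeries_logCoeff_laplace hg0 hg hC0 hlt U (Complex.ofReal_re C)
  set k := convSeries (logCoeff (nonEmission g)) (cut g U) with hkdef
  obtain ⟨δ, hδ, hδi⟩ := hD
  obtain ⟨V, hV, hVU⟩ := EReal.lt_iff_exists_real_btwn.1 hω₁U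
  have hV : ω₁ < V := by exact_mod_cast hV
  -- Keeps ω₁ + u inside (0, V) with V < U, where the logarithmic series k equals f almost
  -- everywhere.
  set δ' := min δ (min ω₁ (V - ω₁)) with hδ'
  have hδ'0 : 0 < δ' := lt_min hδ (lt_min hω₁ (by linarith))
  have hkf : ∀ᵐ u : ℝ, u ∈ Ioo (-δ') δ' → k (ω₁ + u) = f (ω₁ + u) := by
    have h1 := (measurePreserving_add_left volume ω₁).quasiMeasurePreserving.ae hae
    filter_upwards [h1] with u hu hmem
    have h2 : δ' ≤ ω₁ := (min_le_right _ _).trans (min_le_left _ _)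
    have h3 : δ' ≤ V - ω₁ := (min_le_right _ _).trans (min_le_right _ _)
    have h4 : 0 < ω₁ + u := by linarith [hmem.1]
    have h5 : ((ω₁ + u : ℝ) : EReal) < U := lt_trans
      (by exact_mod_cast (by linarith [hmem.2] : ω₁ + u < V)) hVU
    rw [hkdef, convSeries_cut_eq _ _ h5, hu, cut_top_of_pos f h4]
  have hpos : ∀ u ∈ Ioo (-δ') δ', 0 ≤ ω₁ + u := by
    intro u hu
    have h2 : δ' ≤ ω₁ := (min_le_right _ _).trans (min_le_left _ _)
    linarith [hu.1]
  have hd : IntegrableOn (fun u : ℝ => (k (ω₁ + u) * Real.exp (-C * (ω₁ + u))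
      - f ω₁ * Real.exp (-C * ω₁)) / u) (Ioo (-δ') δ') := by
    -- Dini's condition passes to the weighted density: the difference splits into the increment of
    -- f times a bounded weight, and f ω₁ times a Lipschitz increment of the exponential.
    have h1 : IntegrableOn (fun u : ℝ => Real.exp (-C * (ω₁ + u)) * ((f (ω₁ + u) - f ω₁) / u))
        (Ioo (-δ') δ') := by
      refine Integrable.bdd_mul (c := 1) (hδi.mono_set ?_)
        (Continuous.aestronglyMeasurable (by fun_prop)) ?_
      · exact Ioo_subset_Ioo (neg_le_neg (min_le_left _ _)) (min_le_left _ _)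
      · refine (ae_restrict_iff' measurableSet_Ioo).2 (ae_of_all _ fun u hu => ?_)
        rw [Real.norm_of_nonneg (Real.exp_pos _).le]
        exact Real.exp_le_one_iff.2 (by nlinarith [hpos u hu])
    have h2 : IntegrableOn (fun u : ℝ => f ω₁ *
        ((Real.exp (-C * (ω₁ + u)) - Real.exp (-C * ω₁)) / u)) (Ioo (-δ') δ') := by
      refine Integrable.const_mul ?_ _
      refine Measure.integrableOn_of_bounded (M := C) measure_Ioo_lt_top.ne ?_ ?_
      · exact (Continuous.aestronglyMeasurable (by fun_prop)).div₀
          measurable_id.aestronglyMeasurable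
      · refine (ae_restrict_iff' measurableSet_Ioo).2 (ae_of_all _ fun u hu => ?_)
        rw [norm_div, Real.norm_eq_abs, Real.norm_eq_abs]
        refine div_le_of_le_mul₀ (abs_nonneg u) hC0 ?_
        simpa using abs_exp_sub_exp_le hC0 (hpos u hu) hω₁.le
    refine (h1.add h2).congr ?_
    rw [EventuallyEq, ae_restrict_iff' measurableSet_Ioo]
    filter_upwards [hkf] with u hu hmem
    rw [hu hmem]
    simp only [Pi.add_apply]
    ring
  have hDini := tendsto_integral_laplace_of_dini hk.1 hδ'0 hd
  have hval : ∀ t : ℝ, Complex.exp ((C + t * Complex.I) * ω₁)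
      * ∫ ω, expWeight (C + t * Complex.I) k ω = F (C + t * Complex.I) := by
    intro t
    simp only [F]
    rw [(convSeries_logCoeff_laplace hg0 hg hC0 hlt U (hre t)).2.2,
      hT₀ _ (Or.inl (by rw [hre]; exact hC₁C))]
  simp_rw [hval] at hDini
  have hsum := (hshift.const_mul (2 * Real.pi : ℂ)⁻¹).add hDini
  rw [mul_zero, zero_add] at hsum
  refine hsum.congr fun T => ?_
  rw [contourIntegral, intervalIntegral.integral_mul_const]
  have hI : (2 * (Real.pi : ℂ) * Complex.I)⁻¹ * Complex.I = (2 * (Real.pi : ℂ))⁻¹ := by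
    field_simp
  rw [← mul_add, sub_add_cancel]
  change _ = _ * ((∫ t in (-T)..T, F (c + t * Complex.I)) * Complex.I)
  linear_combination (-∫ t in (-T)..T, F (c + t * Complex.I)) * hI

/-- Inversion in the sense of distributions, with the atom at zero energy. -/
theorem tendsto_integral_mul_contourIntegral_sub_log {U : EReal} {c₀ : ℝ} (hU0 : 0 < U)
    (hU : SingularitiesLeftOf (multiphotonSpectrum f) U c₀) {L : ℂ → ℂ}
    (hL : IsLogBranch (logArg (multiphotonSpectrum f) U) c₀ L) {c : ℝ} (hc : c₀ < c) {φ : ℝ → ℂ}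
    (hφ : ContDiff ℝ (⊤ : ℕ∞) φ) (hs : HasCompactSupport φ)
    (hsU : tsupport φ ⊆ {ω : ℝ | (ω : EReal) < U}) :
    Tendsto (fun T : ℝ => (∫ ω : ℝ, φ ω * contourIntegral L c T ω)
      - (Real.log (nonEmission (multiphotonSpectrum f)) : ℂ) * φ 0)
      atTop (𝓝 (∫ ω in Ioi (0 : ℝ), φ ω * (f ω : ℂ))) := by
  have h := (tendsto_integral_mul_contourIntegral (isLevyPair_multiphotonSpectrum hf hfi) hU hL hU0
    hc hφ hs hsU).sub_const ((Real.log (nonEmission (multiphotonSpectrum f)) : ℂ) * φ 0)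
  convert h using 2
  -- The term -w₁ φ(0) in the inversion of the exponent equals ln W₀ φ(0), so subtracting the delta
  -- term leaves f alone.
  rw [nonEmission_multiphotonSpectrum hf hfi, Real.log_exp, photonNumber]
  have hfi' : IntegrableOn (fun ω => (f ω : ℂ)) (Ioi 0) := hfi.ofReal
  obtain ⟨B, hB⟩ := hφ.continuous.bounded_above_of_compact_support hs
  have h1 : IntegrableOn (fun ω => φ ω * (f ω : ℂ)) (Ioi 0) :=
    hfi'.bdd_mul (c := B) hφ.continuous.aestronglyMeasurable (ae_of_all _ hB)
  have h2 : ∫ ω in Ioi (0 : ℝ), (f ω : ℂ) * (φ ω - φ 0)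
      = (∫ ω in Ioi (0 : ℝ), φ ω * (f ω : ℂ)) - (∫ ω in Ioi (0 : ℝ), (f ω : ℂ)) * φ 0 := by
    rw [← integral_mul_const, ← integral_sub h1 (hfi'.mul_const _)]
    refine integral_congr_ae (ae_of_all _ fun ω => ?_)
    simp only
    ring
  rw [h2, integral_complex_ofReal]
  push_cast
  ring

end finite

/-! ### Removal of the infrared cutoff -/

theorem isSpectrum_infraredCut {f : ℝ → ℝ} (hf : IsSpectrum f) (ε : ℝ) :
    IsSpectrum (infraredCut f ε) where
  measurable := hf.measurable.indicator measurableSet_Ioi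
  nonneg := fun ω hω => by
    by_cases h : ω ∈ Ioi ε <;> simp [infraredCut, h, hf.nonneg ω hω]

section infrared

variable {f : ℝ → ℝ} (hf : IsSpectrum f)
  (hmin : IntegrableOn (fun ω : ℝ => min 1 ω * f ω) (Ioi 0))
include hf hmin

theorem integrableOn_infraredCut {ε : ℝ} (hε : 0 < ε) : IntegrableOn (infraredCut f ε) (Ioi 0) := by
  have hm : 0 < min 1 ε := lt_min one_pos hε
  refine Integrable.mono' (hmin.const_mul (1 / min 1 ε))
    (isSpectrum_infraredCut hf ε).measurable.aestronglyMeasurable ?_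
  refine (ae_restrict_iff' measurableSet_Ioi).2 (ae_of_all _ fun ω hω => ?_)
  have hω : 0 < ω := hω
  have hfω := hf.nonneg ω hω
  have hmω : 0 < min 1 ω := lt_min one_pos hω
  by_cases h : ω ∈ Ioi ε
  · rw [infraredCut, indicator_of_mem h, Real.norm_of_nonneg hfω, one_div_mul_eq_div,
      le_div_iff₀ hm, mul_comm]
    have h : ε < ω := h
    gcongr
  · rw [infraredCut, indicator_of_notMem h, norm_zero]
    positivity

theorem tendsto_levyExponent_infraredCut {s : ℂ} (hs : 0 ≤ s.re) :
    Tendsto (fun ε : ℝ => levyExponent (infraredCut f ε) s) (𝓝[>] 0) (𝓝 (levyExponent f s)) := by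
  refine tendsto_integral_filter_of_dominated_convergence
    (fun ω => (2 + 2 * ‖s‖) * (min 1 ω * f ω)) ?_ ?_ (hmin.const_mul _) ?_
  · exact Eventually.of_forall fun ε => (Complex.measurable_ofReal.comp
      (isSpectrum_infraredCut hf ε).measurable).aestronglyMeasurable.mul
      (Continuous.aestronglyMeasurable (by fun_prop))
  · refine Eventually.of_forall fun ε => ?_
    refine (ae_restrict_iff' measurableSet_Ioi).2 (ae_of_all _ fun ω hω => ?_)
    have hω : 0 < ω := hω
    have h1 := norm_exp_sub_one_le_min hs hω
    have h2 : ‖((infraredCut f ε ω : ℝ) : ℂ)‖ ≤ f ω := by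
      rw [Complex.norm_real, Real.norm_of_nonneg ((isSpectrum_infraredCut hf ε).nonneg ω hω)]
      exact indicator_le_self' (fun _ _ => hf.nonneg ω hω) ω
    rw [norm_mul]
    have := hf.nonneg ω hω
    calc _ ≤ f ω * ((2 + 2 * ‖s‖) * min 1 ω) := by gcongr
      _ = _ := by ring
  · refine (ae_restrict_iff' measurableSet_Ioi).2 (ae_of_all _ fun ω hω => ?_)
    refine tendsto_const_nhds.congr' ?_
    filter_upwards [mem_nhdsWithin_of_mem_nhds (Iio_mem_nhds hω)] with ε hε
    rw [infraredCut, indicator_of_mem (show ω ∈ Ioi ε from hε)]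

variable {g : ℝ → ℝ} (hg : IsInfraredLimit f g)
include hg

/-- Testing the weak convergence with the constant 1: each regularised law has total mass 1, so g
has as well. -/
theorem nonEmission_eq_zero_of_isInfraredLimit : nonEmission g = 0 := by
  have h := hg.tendsto (BoundedContinuousFunction.const ℝ 1)
  simp only [BoundedContinuousFunction.const_apply, mul_one, one_mul] at h
  have h1 : Tendsto (fun ε : ℝ => Real.exp (-photonNumber (infraredCut f ε))
      + ∫ ω in Ioi (0 : ℝ), multiphotonSpectrum (infraredCut f ε) ω) (𝓝[>] 0) (𝓝 1) := by
    refine tendsto_const_nhds.congr' ?_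
    filter_upwards [self_mem_nhdsWithin] with ε hε
    rw [← nonEmission_multiphotonSpectrum (isSpectrum_infraredCut hf ε)
      (integrableOn_infraredCut hf hmin hε), nonEmission]
    ring
  rw [nonEmission, tendsto_nhds_unique h h1, sub_self]

/-- Weak convergence gives convergence of the integrals of `e^{-sω}` after a real-linear
projection. -/
theorem tendsto_logArg_infraredCut {s : ℂ} (hs : 0 ≤ s.re) (p : ℂ →L[ℝ] ℝ) :
    Tendsto (fun ε : ℝ => p (logArg (multiphotonSpectrum (infraredCut f ε)) ⊤ s)) (𝓝[>] 0)
      (𝓝 (p (logArg g ⊤ s))) := by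
  -- Weak convergence is tested with real bounded continuous functions on all of ℝ. The projection p
  -- makes e^{-sω} real, and max(ω, 0) keeps it bounded for negative ω.
  have hbound : ∀ ω : ℝ, ‖p (Complex.exp (-s * (max ω 0 : ℝ)))‖ ≤ ‖p‖ * 1 := by
    intro ω
    refine p.le_opNorm_of_le ?_
    rw [norm_cexp_neg_mul]
    exact Real.exp_le_one_iff.2 (by nlinarith [le_max_right ω 0])
  let φ : ℝ →ᵇ ℝ := BoundedContinuousFunction.ofNormedAddCommGroup
    (fun ω : ℝ => p (Complex.exp (-s * (max ω 0 : ℝ)))) (by fun_prop) _ hbound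
  have hφ : ∀ k : ℝ → ℝ, IntegrableOn k (Ioi 0) → (∫ ω in Ioi (0 : ℝ), φ ω * k ω)
      = p (∫ ω in window ⊤, (k ω : ℂ) * Complex.exp (-s * ω)) := by
    intro k hk
    rw [← p.integral_comp_comm (integrable_laplace (measurableSet_window ⊤) (window_subset ⊤)
      (integrableOn_window_exp_zero hk ⊤) hs), window_top]
    refine setIntegral_congr_fun measurableSet_Ioi fun ω hω => ?_
    have hω : 0 < ω := hω
    show p (Complex.exp (-s * (max ω 0 : ℝ))) * k ω = _
    rw [max_eq_left hω.le, ← Complex.real_smul, p.map_smul, smul_eq_mul, mul_comm]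
  have hφ0 : φ 0 = p 1 := by
    show p (Complex.exp (-s * (max (0 : ℝ) 0 : ℝ))) = _
    simp
  have h := hg.tendsto φ
  rw [hφ g hg.integrable] at h
  have hlim : logArg g ⊤ s = ∫ ω in window ⊤, (g ω : ℂ) * Complex.exp (-s * ω) := by
    rw [logArg, nonEmission_eq_zero_of_isInfraredLimit hf hmin hg, Complex.ofReal_zero, add_zero]
  rw [hlim]
  refine h.congr' ?_
  filter_upwards [self_mem_nhdsWithin] with ε hε
  have hfε := isSpectrum_infraredCut hf ε
  have hiε := integrableOn_infraredCut hf hmin hε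
  rw [hφ _ (integrableOn_multiphotonSpectrum hfε hiε), hφ0, logArg, map_add, add_comm,
    nonEmission_multiphotonSpectrum hfε hiε, ← mul_one (Complex.ofReal _), ← Complex.real_smul,
    p.map_smul, smul_eq_mul]

/-- The regularised transforms converge to exp E by dominated convergence and to the transform of g
by weak convergence, one real component at a time. Limits are unique. -/
theorem isLevyPair_of_isInfraredLimit : IsLevyPair f g where
  spectrum := hf
  integrable_min := hmin
  nonneg := hg.nonneg
  integrable := hg.integrable
  nonEmission_nonneg := (nonEmission_eq_zero_of_isInfraredLimit hf hmin hg).ge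
  exp_eq := fun s hs => by
    have h1 : Tendsto (fun ε : ℝ => logArg (multiphotonSpectrum (infraredCut f ε)) ⊤ s) (𝓝[>] 0)
        (𝓝 (Complex.exp (levyExponent f s))) := by
      refine (tendsto_levyExponent_infraredCut hf hmin hs.le).cexp.congr' ?_
      filter_upwards [self_mem_nhdsWithin] with ε hε
      exact (logArg_multiphotonSpectrum (isSpectrum_infraredCut hf ε)
        (integrableOn_infraredCut hf hmin hε) hs.le).symm
    have key : ∀ p : ℂ →L[ℝ] ℝ, p (Complex.exp (levyExponent f s)) = p (logArg g ⊤ s) := fun p =>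
      tendsto_nhds_unique ((p.continuous.tendsto _).comp h1)
        (tendsto_logArg_infraredCut hf hmin hg hs.le p)
    exact Complex.ext (key Complex.reCLM) (key Complex.imCLM)

end infrared

/-! ### The reconstruction theorem -/

theorem mainTheorem4 :
    -- infrared-finite single-photon spectrum
    (∀ f : ℝ → ℝ, IsSpectrum f → IntegrableOn f (Ioi 0) →
      ∀ g : ℝ → ℝ, g = multiphotonSpectrum f →
      ∀ W₀ : ℝ, W₀ = nonEmission g →
        W₀ = Real.exp (-photonNumber f) ∧
        -- contours to the right of all singularities exist
        SingularitiesLeftOf g ⊤ 0 ∧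
        (∀ U : EReal, 0 < U → ∃ c₀ : ℝ, SingularitiesLeftOf g U c₀) ∧
        -- contour integral representations, with any upper limit `U`
        (∀ (U : EReal) (c₀ : ℝ), 0 < U → SingularitiesLeftOf g U c₀ →
          (∃ L : ℂ → ℂ,
            IsLogBranch (logArg g U) c₀ L) ∧
          ∀ L : ℂ → ℂ,
            IsLogBranch (logArg g U) c₀ L →
            ∀ c : ℝ, c₀ < c →
              -- as distributions on `(-∞, U)`, with the delta term
              (∀ φ : ℝ → ℂ, ContDiff ℝ (⊤ : ℕ∞) φ → HasCompactSupport φ →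
                tsupport φ ⊆ {ω : ℝ | (ω : EReal) < U} →
                Tendsto
                  (fun T : ℝ =>
                    (∫ ω : ℝ, φ ω * contourIntegral L c T ω)
                      - (Real.log W₀ : ℂ) * φ 0)
                  atTop (𝓝 (∫ ω in Ioi (0 : ℝ), φ ω * (f ω : ℂ)))) ∧
              -- pointwise for `0 < ω₁ < U`, the delta term being subtracted under the integral
              (∀ ω₁ : ℝ, 0 < ω₁ → (ω₁ : EReal) < U → DiniAt f ω₁ →
                Tendsto
                  (fun T : ℝ =>
                    contourIntegral
                      (fun s : ℂ => L s - (Real.log W₀ : ℂ)) c T ω₁)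
                  atTop (𝓝 (f ω₁ : ℂ)))) ∧
        -- power series, with any upper limit `U > ω₁`
        (∀ᵐ ω₁ : ℝ ∂(volume.restrict (Ioi (0 : ℝ))), ∀ U : EReal, (ω₁ : EReal) < U →
          HasSum
            (fun n : ℕ => (-1 : ℝ) ^ n / (((n : ℝ) + 1) * W₀ ^ (n + 1))
              * selfConv (cut g U) n ω₁)
            (f ω₁))) ∧
    -- infrared-divergent single-photon spectrum
    (∀ f : ℝ → ℝ, IsSpectrum f →
      IntegrableOn (fun ω : ℝ => min 1 ω * f ω) (Ioi 0) → ¬ IntegrableOn f (Ioi 0) →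
      ∀ g : ℝ → ℝ, IsInfraredLimit f g →
        nonEmission g = 0 ∧
        SingularitiesLeftOf g ⊤ 0 ∧
        (∀ (U : EReal) (c₀ : ℝ), 0 < U → SingularitiesLeftOf g U c₀ →
          (∃ L : ℂ → ℂ,
            IsLogBranch (logArg g U) c₀ L) ∧
          ∀ L : ℂ → ℂ,
            IsLogBranch (logArg g U) c₀ L →
            ∀ c : ℝ, c₀ < c →
              -- as distributions on `(0, U)`, where the delta term does not contribute
              ∀ φ : ℝ → ℂ, ContDiff ℝ (⊤ : ℕ∞) φ → HasCompactSupport φ →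
                tsupport φ ⊆ window U →
                Tendsto
                  (fun T : ℝ =>
                    ∫ ω : ℝ, φ ω * contourIntegral L c T ω)
                  atTop (𝓝 (∫ ω in Ioi (0 : ℝ), φ ω * (f ω : ℂ))))) := by
  refine ⟨?_, ?_⟩
  · rintro f hf hfi g rfl W₀ rfl
    have hpair := isLevyPair_multiphotonSpectrum hf hfi
    have hW := nonEmission_multiphotonSpectrum hf hfi
    refine ⟨hW, hpair.singularitiesLeftOf_top, fun U _ => exists_singularitiesLeftOf hpair.nonneg
      hpair.integrable (by rw [hW]; exact Real.exp_pos _) U, fun U c₀ hU0 hU => ⟨?_, ?_⟩,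
      ae_hasSum_selfConv hf hfi⟩
    · exact exists_isLogBranch_logArg hpair.nonneg hpair.nonEmission_nonneg hU
    · intro L hL c hc
      exact ⟨fun φ hφ hs hsU => tendsto_integral_mul_contourIntegral_sub_log hf hfi hU0 hU hL hc hφ
        hs hsU, fun ω₁ hω₁ hω₁U hD => tendsto_contourIntegral_sub_log hf hfi hU hL hc hω₁ hω₁U hD⟩
  · intro f hf hmin _ g hg
    have hpair := isLevyPair_of_isInfraredLimit hf hmin hg
    refine ⟨nonEmission_eq_zero_of_isInfraredLimit hf hmin hg, hpair.singularitiesLeftOf_top,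
      fun U c₀ hU0 hU => ⟨exists_isLogBranch_logArg hpair.nonneg hpair.nonEmission_nonneg hU, ?_⟩⟩
    intro L hL c hc φ hφ hs hsU
    have h := tendsto_integral_mul_contourIntegral hpair hU hL hU0 hc hφ hs fun ω hω => (hsU hω).2
    -- The support avoids 0, so the subtraction of φ(0), needed for convergence when f is not
    -- integrable, disappears.
    have h0 : φ 0 = 0 := image_eq_zero_of_notMem_tsupport fun h => lt_irrefl (0 : ℝ) (hsU h).1
    simpa only [h0, sub_zero, mul_comm] using h
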